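/- Let $T>0$, let $p\ge 2$ be an even integer, and let $q>p$ be real with $\lfloor q\rfloor=p$. Let $S\in C([0,T],\mathbb R^d)$. **Lebesgue partitions.** The $n$-th dyadic Lebesgue partition $\pi_n$ of $[0,T]$ generated by $S$ consists of $0$, $T$ and all times $\tau^{n,i}_k\in[0,T]$, $1\le i\le d$, where $\tau^{n,i}_0=0$ and $\tau^{n,i}_{k+1}=\inf\{t\ge\tau^{n,i}_k: S_i(t)\in 2^{-n}\mathbb Z\setminus\{S_i(\tau^{n,i}_k)\}\}\wedge T$. Assume $S\in V_p(\pi)$: the oscillation of $S$ along $\pi_n$ tends to $0$, and there is an atomless measure $\mu$ on $[0,T]$ with values in the symmetric $p$-tensors such that, for every continuous $\varphi$ on $[0,T]$ with values in the $p$-tensors, $$\lim_{n\to\infty}\sum_{[t_j,t_{j+1}]\in\pi_n}\langle\varphi(t_j),(S(t_{j+1})-S(t_j))^{\otimes p}\rangle=\int_0^T\langle\varphi,\mathrm d\mu\rangle .$$ Put $[S]^p(t)=\mu([0,t])$. **Reduced rough paths.** For $0\le s\le t\le T$ put $\mathbb X^k_{s,t}=\frac1{k!}(S(t)-S(s))^{\otimes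 k}$ for $0\le k<p$ and $\mathbb X^p_{s,t}=\frac1{p!}(S(t)-S(s))^{\otimes p}-\frac1{p!}([S]^p(t)-[S]^p(s))$. A control function is a continuous $c\ge0$ on $\{0\le s\le t\le T\}$ with $c(t,t)=0$ and $c(s,u)+c(u,t)\le c(s,t)$ for $s\le u\le t$. A symmetric-tensor-valued family $\mathbb X=(\mathbb X^0=1,\mathbb X^1,\dots,\mathbb X^{\lfloor q\rfloor})$ is a reduced rough path of finite $q$-variation if $\sum_{k=1}^{\lfloor q\rfloor}|\mathbb X^k_{s,t}|^{q/k}\le c(s,t)$ for some control function $c$, and $\mathbb X^k_{s,t}=\sum_{l+m=k}\mathrm{Sym}(\mathbb X^l_{s,u}\otimes\mathbb X^m_{u,t})$ for $k\le\lfloor q\rfloor$ and $s\le u\le t$. A continuous path $Y=(Y^0,\dots,Y^{\lfloor q\rfloor})$ of symmetric tensors is controlled by $\mathbb X$ if for some control function $c$ $$\sum_{l=1}^{\lfloor q\rfloor}\Big|Y^l(t)-\sum_{k=l}^{\lfloor q\rfloor}\langle Y^k(s),\mathbb X^{k-l}_{s,t}\rangle\Big|^{q/(\lfloor q\rfloor-l+1)}\le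 c(s,t),\qquad 0\le s\le t\le T .$$ **Statement.** Let $f\in C^{\lfloor q\rfloor}(\mathbb R^d,\mathbb R)$, and put $Y^0=1$, $Y^k=\nabla^kf(S)$ for $1\le k\le\lfloor q\rfloor$. Then: 1. $\mathbb X$ is a reduced rough path of finite $q$-variation. 2. If $\nabla^{\lfloor q\rfloor}f$ is locally Lipschitz continuous (for example if $f\in C^{\lfloor q\rfloor+1}$), then $Y$ is controlled by $\mathbb X$. 3. Whenever $Y$ is controlled by $\mathbb X$, for every $t\in[0,T]$ the rough path integral $$\int_0^t\langle\nabla f(S(s)),\mathrm d\mathbb X(s)\rangle=\lim_{|\pi|\to0}\sum_{[t_j,t_{j+1}]\in\pi}\sum_{k=1}^{\lfloor q\rfloor}\langle Y^k(t_j),\mathbb X^k_{t_j,t_{j+1}}\rangle,$$ the limit being over all finite partitions $\pi$ of $[0,t]$ with mesh $|\pi|\to0$, and the pathwise integral $$\int_0^t\langle\nabla f(S(s)),\mathrm dS(s)\rangle=\lim_{n\to\infty}\sum_{[t_j,t_{j+1}]\in\pi_n}\sum_{k=1}^{p-1}\frac1{k!}\langle\nabla^kf(S(t_j)),(S(t_{j+1}\wedge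 t)-S(t_j\wedge t))^{\otimes k}\rangle$$ both exist, and they are equal. -/

import Mathlib

open Set Filter Topology MeasureTheory

namespace PathwiseRough

/-! ### Partitions -/

/-- A finite partition of `[a, b]`, given by its set of points. -/
structure IntervalPartition (a b : ℝ) where
  points : Finset ℝ
  left_mem : a ∈ points
  right_mem : b ∈ points
  subset_Icc : ∀ x ∈ points, x ∈ Icc a b

/-- The pairs `(t_j, t_{j+1})` of immediate successors in a partition. -/
noncomputable def IntervalPartition.intervals {a b : ℝ} (P : IntervalPartition a b) :
    Finset (ℝ × ℝ) :=
  (P.points ×ˢ P.points).filter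
    (fun e => e.1 < e.2 ∧ ∀ r ∈ P.points, ¬ (e.1 < r ∧ r < e.2))

/-! ### The dyadic Lebesgue partition -/

/-- The successive times at which the real path `x` hits a point of the grid `2⁻ⁿ ℤ` different from
its value at the previous time, the value being `T` when there is no such time left in `[0, T]`. -/
noncomputable def lebesgueTime (T : ℝ) (x : ℝ → ℝ) (n : ℕ) : ℕ → ℝ
  | 0 => 0
  | k + 1 => sInf ({t : ℝ | lebesgueTime T x n k ≤ t ∧ t ≤ T ∧
      (∃ m : ℤ, x t = m * (2⁻¹ : ℝ) ^ n) ∧ x t ≠ x (lebesgueTime T x n k)} ∪ {T})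

theorem lebesgueTime_mem {T : ℝ} (hT : 0 ≤ T) (x : ℝ → ℝ) (n k : ℕ) :
    lebesgueTime T x n k ∈ Icc 0 T := by
  induction k with
  | zero => exact ⟨le_refl 0, hT⟩
  | succ k ih =>
    rw [lebesgueTime]
    constructor
    · refine le_csInf ⟨T, Or.inr rfl⟩ ?_
      rintro t (ht | ht)
      · exact ih.1.trans ht.1
      · rw [mem_singleton_iff.1 ht]; exact hT
    · refine csInf_le ⟨0, ?_⟩ (Or.inr rfl)
      rintro t (ht | ht)
      · exact ih.1.trans ht.1
      · rw [mem_singleton_iff.1 ht]; exact hT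

theorem lebesgueTime_le_succ {T : ℝ} (hT : 0 ≤ T) (x : ℝ → ℝ) (n k : ℕ) :
    lebesgueTime T x n k ≤ lebesgueTime T x n (k + 1) := by
  rw [lebesgueTime]
  refine le_csInf ⟨T, Or.inr rfl⟩ ?_
  rintro t (ht | ht)
  · exact ht.1
  · rw [mem_singleton_iff.1 ht]; exact (lebesgueTime_mem hT x n k).2

theorem lebesgueTime_eq_of_eq {T : ℝ} (hT : 0 ≤ T) (x : ℝ → ℝ) (n : ℕ) {k : ℕ}
    (hk : lebesgueTime T x n k = T) {j : ℕ} (hj : k ≤ j) : lebesgueTime T x n j = T := by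
  induction j, hj using Nat.le_induction with
  | base => exact hk
  | succ j _ ih =>
    exact le_antisymm (lebesgueTime_mem hT x n _).2
      (ih.symm.le.trans (lebesgueTime_le_succ hT x n j))

theorem finite_range_lebesgueTime {T : ℝ} (hT : 0 ≤ T) {x : ℝ → ℝ}
    (hx : ContinuousOn x (Icc 0 T)) (n : ℕ) : (range (lebesgueTime T x n)).Finite := by
  have hε : (0 : ℝ) < (2⁻¹ : ℝ) ^ n := by positivity
  set ε : ℝ := (2⁻¹ : ℝ) ^ n with hεdef
  set G : Set ℝ := {y | ∃ m : ℤ, y = m * ε} with hG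
  have hGc : IsClosed G := by
    have h1 : IsClosed (range ((↑) : ℤ → ℝ)) := Int.isClosedEmbedding_coe_real.isClosed_range
    have h2 := (Homeomorph.mulRight₀ ε hε.ne').isClosedMap _ h1
    convert h2 using 1
    ext y
    constructor
    · rintro ⟨m, rfl⟩
      exact ⟨m, ⟨m, rfl⟩, rfl⟩
    · rintro ⟨_, ⟨m, rfl⟩, rfl⟩
      exact ⟨m, rfl⟩
  have hgap : ∀ y ∈ G, ∀ z ∈ G, y ≠ z → ε ≤ |y - z| := by
    rintro _ ⟨a, rfl⟩ _ ⟨b, rfl⟩ hab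
    have hne : a - b ≠ 0 := fun h => hab (by rw [sub_eq_zero.1 h])
    have h1 : (1 : ℝ) ≤ |(a : ℝ) - b| := by exact_mod_cast Int.one_le_abs hne
    rw [← sub_mul, abs_mul, abs_of_pos hε]
    nlinarith
  obtain ⟨δ, hδ, hδx⟩ := Metric.uniformContinuousOn_iff.1
    (isCompact_Icc.uniformContinuousOn_of_continuous hx) ε hε
  have hclosed : IsClosed (Icc 0 T ∩ x ⁻¹' G) := hx.preimage_isClosed_of_isClosed isClosed_Icc hGc
  have hgrid : ∀ k, lebesgueTime T x n (k + 1) = T ∨ x (lebesgueTime T x n (k + 1)) ∈ G := by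
    intro k
    have hmem : lebesgueTime T x n (k + 1) ∈ closure (Icc 0 T ∩ x ⁻¹' G ∪ {T}) := by
      rw [lebesgueTime]
      refine closure_mono ?_ (csInf_mem_closure ⟨T, Or.inr rfl⟩ ⟨0, ?_⟩)
      · rintro t (ht | ht)
        · exact Or.inl ⟨⟨(lebesgueTime_mem hT x n k).1.trans ht.1, ht.2.1⟩, ht.2.2.1⟩
        · exact Or.inr ht
      · rintro t (ht | ht)
        · exact (lebesgueTime_mem hT x n k).1.trans ht.1
        · rw [mem_singleton_iff.1 ht]; exact hT
    rw [(hclosed.union isClosed_singleton).closure_eq] at hmem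
    rcases hmem with h | h
    · exact Or.inr h.2
    · exact Or.inl h
  have hstep : ∀ k, min (lebesgueTime T x n (k + 1) + δ) T ≤ lebesgueTime T x n (k + 1 + 1) := by
    intro k
    rcases hgrid k with h | h
    · rw [lebesgueTime_eq_of_eq hT x n h (Nat.le_succ _)]
      exact min_le_right _ _
    · conv_rhs => rw [lebesgueTime]
      refine le_csInf ⟨T, Or.inr rfl⟩ ?_
      rintro t (ht | ht)
      · refine (min_le_left _ _).trans ?_
        by_contra hlt
        have hk := lebesgueTime_mem hT x n (k + 1)
        have h1 := hδx t ⟨hk.1.trans ht.1, ht.2.1⟩ _ hk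
          (by rw [Real.dist_eq, abs_of_nonneg (sub_nonneg.2 ht.1)]; linarith)
        rw [Real.dist_eq] at h1
        exact absurd (hgap _ ht.2.2.1 _ h ht.2.2.2) (not_le.2 h1)
      · rw [mem_singleton_iff.1 ht]
        exact min_le_right _ _
  have hlow : ∀ k : ℕ, min (k * δ) T ≤ lebesgueTime T x n (k + 1) := by
    intro k
    induction k with
    | zero => simpa using Or.inl (lebesgueTime_mem hT x n 1).1
    | succ k ih =>
      refine le_trans ?_ (hstep k)
      refine le_min ?_ (min_le_right _ _)
      push_cast
      rcases le_total (k * δ) T with h | h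
      · rw [min_eq_left h] at ih
        exact (min_le_left _ _).trans (by linarith)
      · rw [min_eq_right h] at ih
        exact (min_le_right _ _).trans (by linarith)
  obtain ⟨K, hK⟩ := exists_nat_ge (T / δ)
  have hKT : lebesgueTime T x n (K + 1) = T := by
    refine le_antisymm (lebesgueTime_mem hT x n _).2 ?_
    have h := hlow K
    rwa [min_eq_right ((div_le_iff₀ hδ).1 hK)] at h
  refine ((finite_Iic (K + 1)).image (lebesgueTime T x n)).subset ?_
  rintro _ ⟨j, rfl⟩
  rcases le_total j (K + 1) with h | h
  · exact ⟨j, h, rfl⟩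
  · exact ⟨K + 1, le_refl (K + 1), hKT.trans (lebesgueTime_eq_of_eq hT x n hKT h).symm⟩

/-- The `n`-th dyadic Lebesgue partition generated by a path with values in `ℝ^d`: its points are
the Lebesgue times, at level `n`, of all the coordinates of the path, and the end points. -/
noncomputable def dyadicLebesgue {d : ℕ} {T : ℝ} (hT : 0 ≤ T) {S : ℝ → EuclideanSpace ℝ (Fin d)}
    (hS : ContinuousOn S (Icc 0 T)) (n : ℕ) : IntervalPartition 0 T where
  points := (((finite_singleton T).insert 0).union (finite_iUnion fun i : Fin d =>
    finite_range_lebesgueTime hT (x := fun t => S t i)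
      ((EuclideanSpace.proj (𝕜 := ℝ) i).continuous.comp_continuousOn hS) n)).toFinset
  left_mem := by simp
  right_mem := by simp
  subset_Icc := by
    intro y hy
    simp only [Finite.mem_toFinset] at hy
    rcases hy with hy | hy
    · rcases hy with rfl | hy
      · exact ⟨le_refl _, hT⟩
      · rw [mem_singleton_iff.1 hy]; exact ⟨hT, le_refl _⟩
    · obtain ⟨i, k, rfl⟩ := mem_iUnion.1 hy
      exact lebesgueTime_mem hT _ n k

/-! ### Tensors -/

/-- `k`-tensors on `ℝ^d` in coordinates, with their canonical inner product. -/
abbrev Tens (d k : ℕ) : Type := EuclideanSpace ℝ (Fin k → Fin d)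

/-- The tensor power `v^{⊗ k}`. -/
noncomputable def tpow {d : ℕ} (v : EuclideanSpace ℝ (Fin d)) (k : ℕ) : Tens d k :=
  WithLp.toLp 2 fun i => ∏ j, v (i j)

/-- The tensor product of an `l`-tensor and an `m`-tensor, as a `k`-tensor, where `l + m = k`. -/
noncomputable def tmul {d l m k : ℕ} (h : l + m = k) (A : Tens d l) (B : Tens d m) : Tens d k :=
  WithLp.toLp 2 fun i =>
    A (fun j => i (Fin.cast h (Fin.castAdd m j))) * B (fun j => i (Fin.cast h (Fin.natAdd l j)))

/-- The symmetric part of a tensor. -/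
noncomputable def tsym {d k : ℕ} (A : Tens d k) : Tens d k :=
  WithLp.toLp 2 fun i => (k.factorial : ℝ)⁻¹ * ∑ σ : Equiv.Perm (Fin k), A (fun j => i (σ j))

/-- Symmetric tensors. -/
def IsSymTens {d k : ℕ} (A : Tens d k) : Prop :=
  ∀ (σ : Equiv.Perm (Fin k)) (i : Fin k → Fin d), A (fun j => i (σ j)) = A i

/-- The pairing `⟨A, B⟩` of an `a`-tensor `A` with an `(a + b)`-tensor `B`: the `b`-tensor
`(v₁, …, v_b) ↦ ⟨A ⊗ v₁ ⊗ ⋯ ⊗ v_b, B⟩`. -/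
noncomputable def contract {d a b : ℕ} (A : Tens d a) (B : Tens d (a + b)) : Tens d b :=
  WithLp.toLp 2 fun j => ∑ i : Fin a → Fin d, A i * B (Fin.append i j)

/-- The derivative `∇^k f (x)` as a `k`-tensor. -/
noncomputable def nabla {d : ℕ} (k : ℕ) (f : EuclideanSpace ℝ (Fin d) → ℝ)
    (x : EuclideanSpace ℝ (Fin d)) : Tens d k :=
  WithLp.toLp 2 fun i => iteratedFDeriv ℝ k f x (fun j => EuclideanSpace.single (i j) (1 : ℝ))

/-! ### `p`-th variation along a sequence of partitions -/

/-- `S ∈ V_p(π)`, with limiting tensor valued measure `μ` on `[0, T]`. A homogeneous polynomial of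
degree `p` with continuous coefficients in `t ∈ [0, T]` is `v ↦ ⟨φ t, v^{⊗ p}⟩` with a continuous
tensor valued `φ`, and its pairing with a symmetric tensor is the inner product with `φ t`. -/
structure HasPthVariation {d : ℕ} {T : ℝ} (p : ℕ) (π : ℕ → IntervalPartition 0 T)
    (S : ℝ → EuclideanSpace ℝ (Fin d)) (μ : VectorMeasure (Icc (0 : ℝ) T) (Tens d p)) : Prop where
  osc_tendsto : ∀ ε > 0, ∀ᶠ n in atTop, ∀ e ∈ (π n).intervals,
    ∀ r ∈ Icc e.1 e.2, ∀ s ∈ Icc e.1 e.2, ‖S s - S r‖ ≤ ε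
  symm : ∀ A, IsSymTens (μ A)
  no_atoms : ∀ x, μ {x} = 0
  tendsto : ∀ φ : ℝ → Tens d p, ContinuousOn φ (Icc 0 T) →
    Tendsto (fun n => ∑ e ∈ (π n).intervals, inner ℝ (φ e.1) (tpow (S e.2 - S e.1) p)) atTop
      (𝓝 (μ.integral (fun x => φ x) (innerSL ℝ)))

/-- The `p`-th variation `[S]^p (t) = μ ([0, t])`. -/
noncomputable def pthVariation {d p : ℕ} {T : ℝ} (μ : VectorMeasure (Icc (0 : ℝ) T) (Tens d p))
    (t : ℝ) : Tens d p :=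
  μ {x | (x : ℝ) ≤ t}

/-- `I` is the pathwise integral `∫₀ᵗ ⟨∇f(S), dS⟩`, the limit of the compensated Riemann sums
along the sequence of partitions. -/
def IsPathwiseIntegral {d : ℕ} {T : ℝ} (p : ℕ) (π : ℕ → IntervalPartition 0 T)
    (S : ℝ → EuclideanSpace ℝ (Fin d)) (f : EuclideanSpace ℝ (Fin d) → ℝ) (t I : ℝ) : Prop :=
  Tendsto (fun n => ∑ e ∈ (π n).intervals, ∑ k ∈ Finset.Icc 1 (p - 1),
    (k.factorial : ℝ)⁻¹ * inner ℝ (nabla k f (S e.1)) (tpow (S (min e.2 t) - S (min e.1 t)) k))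
    atTop (𝓝 I)

/-! ### Reduced rough paths and controlled paths -/

/-- Control functions on `{(s, t) : 0 ≤ s ≤ t ≤ T}`. -/
structure IsControl (T : ℝ) (c : ℝ → ℝ → ℝ) : Prop where
  cont : ContinuousOn (fun z : ℝ × ℝ => c z.1 z.2) {z | 0 ≤ z.1 ∧ z.1 ≤ z.2 ∧ z.2 ≤ T}
  nonneg : ∀ s t, 0 ≤ s → s ≤ t → t ≤ T → 0 ≤ c s t
  diag : ∀ t ∈ Icc 0 T, c t t = 0
  superadd : ∀ s u t, 0 ≤ s → s ≤ u → u ≤ t → t ≤ T → c s u + c u t ≤ c s t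

/-- `𝕏 = (1, 𝕏¹, …, 𝕏^⌊q⌋)` is a reduced rough path of finite `q`-variation on `[0, T]`; the
components of order larger than `⌊q⌋` are irrelevant. -/
structure IsReducedRoughPath {d : ℕ} (q T : ℝ) (X : (k : ℕ) → ℝ → ℝ → Tens d k) : Prop where
  zero : ∀ s t, 0 ≤ s → s ≤ t → t ≤ T → ∀ i, X 0 s t i = 1
  symm : ∀ k ≤ ⌊q⌋₊, ∀ s t, 0 ≤ s → s ≤ t → t ≤ T → IsSymTens (X k s t)
  bound : ∃ c, IsControl T c ∧ ∀ s t, 0 ≤ s → s ≤ t → t ≤ T →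
    ∑ k ∈ Finset.Icc 1 ⌊q⌋₊, ‖X k s t‖ ^ (q / k) ≤ c s t
  chen : ∀ k ≤ ⌊q⌋₊, ∀ s u t, 0 ≤ s → s ≤ u → u ≤ t → t ≤ T →
    X k s t = ∑ x : Finset.HasAntidiagonal.antidiagonal k,
      tsym (tmul (Finset.HasAntidiagonal.mem_antidiagonal.1 x.2) (X x.1.1 s u) (X x.1.2 u t))

/-- `Y = (Y⁰, …, Y^⌊q⌋)` is controlled by `𝕏`, that is, `Y ∈ 𝒟_𝕏^{⌊q⌋/q}([0, T])`. In the sum below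
the summation index is `m = k - l`. -/
structure IsControlled {d : ℕ} (q T : ℝ) (X : (k : ℕ) → ℝ → ℝ → Tens d k)
    (Y : (k : ℕ) → ℝ → Tens d k) : Prop where
  cont : ∀ k ≤ ⌊q⌋₊, ContinuousOn (Y k) (Icc 0 T)
  symm : ∀ k ≤ ⌊q⌋₊, ∀ t ∈ Icc 0 T, IsSymTens (Y k t)
  bound : ∃ c, IsControl T c ∧ ∀ s t, 0 ≤ s → s ≤ t → t ≤ T →
    ∑ l ∈ Finset.Icc 1 ⌊q⌋₊,
      ‖Y l t - ∑ m ∈ Finset.range (⌊q⌋₊ - l + 1), contract (X m s t) (Y (m + l) s)‖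
        ^ (q / ((⌊q⌋₊ : ℝ) - l + 1)) ≤ c s t

/-- `I` is the rough path integral `∫₀ᵗ ⟨Y, d𝕏⟩`: the limit, as the mesh size of the partitions
of `[0, t]` tends to zero, of the sums of `∑_{k = 1}^N ⟨Y^k(t_j), 𝕏^k_{t_j, t_{j+1}}⟩`. -/
def IsRoughIntegral {d : ℕ} (N : ℕ) (X : (k : ℕ) → ℝ → ℝ → Tens d k)
    (Y : (k : ℕ) → ℝ → Tens d k) (t I : ℝ) : Prop :=
  ∀ ε > 0, ∃ δ > 0, ∀ P : IntervalPartition 0 t, (∀ e ∈ P.intervals, e.2 - e.1 < δ) →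
    |∑ e ∈ P.intervals, ∑ k ∈ Finset.Icc 1 N, inner ℝ (Y k e.1) (X k e.1 e.2) - I| < ε

/-- The reduced rough path built from `S` and from `V = [S]^p`: `𝕏^k_{s,t}` is
`(S(t) - S(s))^{⊗ k} / k!` for `k ≠ p`, and for `k = p` it is
`(S(t) - S(s))^{⊗ p} / p! - (V(t) - V(s)) / p!`. -/
noncomputable def reducedLift {d p : ℕ} (S : ℝ → EuclideanSpace ℝ (Fin d)) (V : ℝ → Tens d p)
    (k : ℕ) (s t : ℝ) : Tens d k :=
  (k.factorial : ℝ)⁻¹ • tpow (S t - S s) k -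
    if h : k = p then
      (k.factorial : ℝ)⁻¹ • (WithLp.toLp 2 fun i => (V t - V s) (fun j => i (Fin.cast h.symm j)))
    else 0

/-- The path `Y` with `Y⁰ = 1` and `Y^k = ∇^k f(S)` for `k ≥ 1`. -/
noncomputable def gradientPath {d : ℕ} (f : EuclideanSpace ℝ (Fin d) → ℝ)
    (S : ℝ → EuclideanSpace ℝ (Fin d)) (k : ℕ) (s : ℝ) : Tens d k :=
  if k = 0 then WithLp.toLp 2 fun _ => 1 else nabla k f (S s)

end PathwiseRough

/-!
The increments of `S` over the intervals of `π_n` are of order `2⁻ⁿ`, and since the `p`-th powers of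
these increments have bounded sums, `π_n` has `O(2^{pn})` points. Summing with weights `2^{-qn}` the
numbers of points of `π_n` before time `t`, smoothed into continuous functions of `t`, gives a
control for the `q`-variation of `S`, so `𝕏` is a reduced rough path; Chen's relation is the
binomial formula for `(u + v)^{⊗ k}` under symmetrisation, and `Y` is controlled by Taylor's
formula.

For the integrals, the additive function
`E(s, t) = f(S(t)) - f(S(s)) - (1 / p!) ∫_s^t ⟨∇^p f(S), dμ⟩` is compared with the germ
`Ξ(s, t) = ∑_k ⟨Y^k(s), 𝕏^k_{s,t}⟩`. The defect of additivity of `Ξ` is at most `C c(s, t)^θ` with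
`θ = (⌊q⌋ + 1) / q > 1`, so `|∑ (E - Ξ)|` over a partition of `[s, t]` changes by at most a constant
times `c(s, t)^θ` under refinement; it can be made arbitrarily small by the choice of the partition,
because Taylor's formula bounds each term by `η (|S(t_{j+1}) - S(t_j)|^p + |μ|((t_j, t_{j+1}]))`,
and `∑ |S(t_{j+1}) - S(t_j)|^p` stays bounded along `π_n`. Hence `E` is the rough path integral, and
Taylor's formula along `π_n`, together with the definition of `μ`, shows that it is the pathwise
integral as well.
-/

namespace PathwiseRough

/-! ### Partitions and the sewing estimate -/

namespace IntervalPartition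

variable {a b : ℝ} (P : IntervalPartition a b)

theorem mem_intervals {e : ℝ × ℝ} : e ∈ P.intervals ↔ e.1 ∈ P.points ∧ e.2 ∈ P.points ∧
    e.1 < e.2 ∧ ∀ r ∈ P.points, ¬ (e.1 < r ∧ r < e.2) := by
  simp only [intervals, Finset.mem_filter, Finset.mem_product, and_assoc]

theorem le_of_mem_intervals {e : ℝ × ℝ} (he : e ∈ P.intervals) :
    a ≤ e.1 ∧ e.1 ≤ e.2 ∧ e.2 ≤ b :=
  have h := P.mem_intervals.1 he
  ⟨(P.subset_Icc _ h.1).1, h.2.2.1.le, (P.subset_Icc _ h.2.1).2⟩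

theorem card_intervals_le : P.intervals.card ≤ P.points.card := by
  refine Finset.card_le_card_of_injOn Prod.fst (fun e he => (P.mem_intervals.1 he).1) ?_
  intro e he e' he' h
  obtain ⟨_, he₂, hlt, hgap⟩ := P.mem_intervals.1 he
  obtain ⟨_, he₂', hlt', hgap'⟩ := P.mem_intervals.1 he'
  exact Prod.ext h (le_antisymm (not_lt.1 fun hc => hgap _ he₂' ⟨h ▸ hlt', hc⟩)
    (not_lt.1 fun hc => hgap' _ he₂ ⟨h ▸ hlt, hc⟩))

theorem exists_intervals_of_forall_notMem {s t : ℝ} (hs : a ≤ s) (hst : s < t) (ht : t ≤ b)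
    (h : ∀ r ∈ P.points, ¬ (s < r ∧ r < t)) : ∃ e ∈ P.intervals, e.1 ≤ s ∧ t ≤ e.2 := by
  have hA : (P.points.filter (· ≤ s)).Nonempty := ⟨a, by simp [P.left_mem, hs]⟩
  have hB : (P.points.filter (t ≤ ·)).Nonempty := ⟨b, by simp [P.right_mem, ht]⟩
  have hx := Finset.max'_mem _ hA
  have hy := Finset.min'_mem _ hB
  rw [Finset.mem_filter] at hx hy
  refine ⟨(_, _), P.mem_intervals.2 ⟨hx.1, hy.1, hx.2.trans_lt (hst.trans_le hy.2), ?_⟩,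
    hx.2, hy.2⟩
  rintro r hr ⟨h1, h2⟩
  refine h r hr ⟨lt_of_not_ge fun hle => ?_, lt_of_not_ge fun hle => ?_⟩
  · exact absurd (Finset.le_max' _ r (Finset.mem_filter.2 ⟨hr, hle⟩)) (not_le.2 h1)
  · exact absurd (Finset.min'_le _ r (Finset.mem_filter.2 ⟨hr, hle⟩)) (not_le.2 h2)

theorem exists_restrict {s t : ℝ} (hs : a ≤ s) (hst : s ≤ t) (ht : t ≤ b) :
    ∃ Q : IntervalPartition s t, Q.points.card ≤ P.points.card + 2 ∧
      ∀ e ∈ Q.intervals, ∃ e' ∈ P.intervals, e'.1 ≤ e.1 ∧ e.2 ≤ e'.2 := by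
  classical
  let Q : IntervalPartition s t :=
    { points := insert s (insert t (P.points.filter (· ∈ Icc s t)))
      left_mem := by simp
      right_mem := by simp
      subset_Icc := by
        simp only [Finset.forall_mem_insert, Finset.mem_filter]
        exact ⟨left_mem_Icc.2 hst, right_mem_Icc.2 hst, fun _ hx => hx.2⟩ }
  refine ⟨Q, ?_, fun e he => ?_⟩
  · exact (Finset.card_insert_le _ _).trans (Nat.succ_le_succ
      ((Finset.card_insert_le _ _).trans (Nat.succ_le_succ (Finset.card_filter_le _ _))))
  · obtain ⟨hse, _, het⟩ := Q.le_of_mem_intervals he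
    obtain ⟨_, _, hlt, hgap⟩ := Q.mem_intervals.1 he
    refine P.exists_intervals_of_forall_notMem (hs.trans hse) hlt (het.trans ht) fun r hr hr' => ?_
    refine hgap r (Finset.mem_insert_of_mem (Finset.mem_insert_of_mem ?_)) hr'
    exact Finset.mem_filter.2 ⟨hr, hse.trans hr'.1.le, hr'.2.le.trans het⟩

theorem card_points_pos : 0 < P.points.card := Finset.card_pos.2 ⟨a, P.left_mem⟩

/-- The number of intervals of a partition, that is, the index of its last point. -/
def size : ℕ := P.points.card - 1

/-- The `i`-th point of a partition in increasing order. All indices beyond `P.size` give the last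
point, which makes `P.point` a monotone function on `ℕ`. -/
noncomputable def point (i : ℕ) : ℝ :=
  P.points.orderEmbOfFin rfl
    ⟨min i P.size, (min_le_right _ _).trans_lt (Nat.sub_one_lt P.card_points_pos.ne')⟩

theorem point_lt_point_iff {i j : ℕ} (hi : i ≤ P.size) (hj : j ≤ P.size) :
    P.point i < P.point j ↔ i < j := by
  simp [point, hi, hj]

theorem monotone_point : Monotone P.point := fun i j hij =>
  (P.points.orderEmbOfFin rfl).monotone (by simp only [Fin.mk_le_mk]; omega)

theorem mem_points_iff {x : ℝ} : x ∈ P.points ↔ ∃ i ≤ P.size, P.point i = x := by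
  rw [← Finset.mem_coe, ← Finset.range_orderEmbOfFin P.points rfl]
  constructor
  · rintro ⟨i, rfl⟩
    have hi : (i : ℕ) ≤ P.size := Nat.le_sub_one_of_lt i.2
    exact ⟨i, hi, by simp only [point, min_eq_left hi]⟩
  · rintro ⟨i, _, rfl⟩
    exact ⟨_, rfl⟩

theorem point_mem (i : ℕ) : P.point i ∈ P.points := Finset.orderEmbOfFin_mem _ _ _

theorem point_zero : P.point 0 = a := by
  obtain ⟨i, _, hi⟩ := P.mem_points_iff.1 P.left_mem
  exact le_antisymm ((P.monotone_point i.zero_le).trans_eq hi) (P.subset_Icc _ (P.point_mem 0)).1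

theorem point_size : P.point P.size = b := by
  obtain ⟨i, hi, hib⟩ := P.mem_points_iff.1 P.right_mem
  exact le_antisymm (P.subset_Icc _ (P.point_mem _)).2 (hib.symm.trans_le (P.monotone_point hi))

theorem mem_intervals_iff_exists_point {e : ℝ × ℝ} :
    e ∈ P.intervals ↔ ∃ i < P.size, (P.point i, P.point (i + 1)) = e := by
  constructor
  · intro he
    obtain ⟨h1, h2, hlt, hgap⟩ := P.mem_intervals.1 he
    obtain ⟨i, hi, hie⟩ := P.mem_points_iff.1 h1
    obtain ⟨j, hj, hje⟩ := P.mem_points_iff.1 h2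
    rw [← hie, ← hje] at hlt hgap
    have hij := (P.point_lt_point_iff hi hj).1 hlt
    have hji : ¬ i + 1 < j := fun h => hgap _ (P.point_mem (i + 1))
      ⟨(P.point_lt_point_iff hi (h.le.trans hj)).2 i.lt_succ_self,
        (P.point_lt_point_iff (h.le.trans hj) hj).2 h⟩
    obtain rfl : j = i + 1 := by omega
    exact ⟨i, hj, Prod.ext hie hje⟩
  · rintro ⟨i, hi, rfl⟩
    refine P.mem_intervals.2 ⟨P.point_mem i, P.point_mem (i + 1),
      (P.point_lt_point_iff hi.le hi).2 i.lt_succ_self, fun r hr ⟨hir, hri⟩ => ?_⟩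
    obtain ⟨j, hj, rfl⟩ := P.mem_points_iff.1 hr
    have := (P.point_lt_point_iff hi.le hj).1 hir
    have := (P.point_lt_point_iff hj hi).1 hri
    omega

theorem sum_intervals_eq_sum_range {M : Type*} [AddCommMonoid M] (F : ℝ × ℝ → M) :
    ∑ e ∈ P.intervals, F e = ∑ i ∈ Finset.range P.size, F (P.point i, P.point (i + 1)) := by
  symm
  refine Finset.sum_nbij (fun i => (P.point i, P.point (i + 1)))
    (fun i hi => P.mem_intervals_iff_exists_point.2 ⟨i, Finset.mem_range.1 hi, rfl⟩) ?_ ?_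
    fun _ _ => rfl
  · intro i hi j hj hij
    have hi := (Finset.mem_range.1 hi).le
    have hj := (Finset.mem_range.1 hj).le
    have hij : P.point i = P.point j := congrArg Prod.fst hij
    exact le_antisymm (not_lt.1 fun h => ((P.point_lt_point_iff hj hi).2 h).ne' hij)
      (not_lt.1 fun h => ((P.point_lt_point_iff hi hj).2 h).ne hij)
  · intro e he
    obtain ⟨i, hi, hie⟩ := P.mem_intervals_iff_exists_point.1 he
    exact ⟨i, Finset.mem_coe.2 (Finset.mem_range.2 hi), hie⟩

theorem sum_intervals_sub {M : Type*} [AddCommGroup M] (g : ℝ → M) :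
    ∑ e ∈ P.intervals, (g e.2 - g e.1) = g b - g a := by
  rw [P.sum_intervals_eq_sum_range, Finset.sum_range_sub (fun i => g (P.point i)), P.point_zero,
    P.point_size]

end IntervalPartition

section AlmostAdditive

variable {F : Type*} [NormedAddCommGroup F] {C θ : ℝ}

theorem exists_le_le_succ {h : ℕ → ℝ} {m : ℝ} {a b : ℕ} (hab : a < b) (ha : h a ≤ m)
    (hb : m ≤ h b) : ∃ j, a ≤ j ∧ j < b ∧ h j ≤ m ∧ m ≤ h (j + 1) := by
  induction b, hab using Nat.le_induction with
  | base => exact ⟨a, le_rfl, a.lt_succ_self, ha, hb⟩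
  | succ b hab ih =>
    rcases le_total m (h b) with hm | hm
    · obtain ⟨j, haj, hjb, hj⟩ := ih hm
      exact ⟨j, haj, hjb.trans b.lt_succ_self, hj⟩
    · exact ⟨b, (Nat.lt_of_succ_le hab).le, b.lt_succ_self, hm, hb⟩

/-- The constant `K` of the sewing lemma with exponent `θ > 1`. -/
noncomputable def sewingConst (C θ : ℝ) : ℝ := 2 * C / (1 - 2 ^ (1 - θ))

theorem two_rpow_one_sub_lt_one (hθ : 1 < θ) : (2 : ℝ) ^ (1 - θ) < 1 :=
  Real.rpow_lt_one_of_one_lt_of_neg one_lt_two (sub_neg.2 hθ)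

theorem sewingConst_nonneg (hC : 0 ≤ C) (hθ : 1 < θ) : 0 ≤ sewingConst C θ :=
  div_nonneg (by positivity) (sub_pos.2 (two_rpow_one_sub_lt_one hθ)).le

theorem two_mul_add_sewingConst_mul (hθ : 1 < θ) :
    2 * C + sewingConst C θ * 2 ^ (1 - θ) = sewingConst C θ := by
  have h := (sub_pos.2 (two_rpow_one_sub_lt_one hθ)).ne'
  rw [sewingConst]
  field_simp
  ring

theorem half_rpow_eq {w : ℝ} (hw : 0 ≤ w) : (w / 2) ^ θ = 2 ^ (1 - θ) * w ^ θ / 2 := by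
  rw [Real.div_rpow hw zero_le_two, Real.rpow_sub two_pos, Real.rpow_one]
  field_simp

/-- Splitting at the interval that contains the midpoint of `[h a, h b]` leaves two families of
half the size: the constant solves `K = 2 C + 2 K (1 / 2) ^ θ`. -/
theorem norm_sub_sum_Ico_le {E : ℕ → ℕ → F} {h : ℕ → ℝ} (hC : 0 ≤ C) (hθ : 1 < θ)
    (hh : Monotone h)
    (hE : ∀ i j k, i ≤ j → j ≤ k → ‖E i k - E i j - E j k‖ ≤ C * (h k - h i) ^ θ) {a b : ℕ}
    (hab : a ≤ b) :
    ‖E a b - ∑ i ∈ Finset.Ico a b, E i (i + 1)‖ ≤ sewingConst C θ * (h b - h a) ^ θ := by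
  have hθ0 : 0 < θ := one_pos.trans hθ
  have hK := sewingConst_nonneg hC hθ
  induction hn : b - a using Nat.strong_induction_on generalizing a b with
  | _ n ih =>
  rcases hab.eq_or_lt with rfl | hlt
  · simpa [Real.zero_rpow hθ0.ne'] using hE a a a le_rfl le_rfl
  set w := h b - h a
  have hw0 : 0 ≤ w := sub_nonneg.2 (hh hab)
  obtain ⟨j, haj, hjb, hj, hj'⟩ :=
    exists_le_le_succ (h := h) (m := h a + w / 2) hlt (by linarith) (by linarith)
  have hleft := ih (j - a) (by omega) haj rfl
  have hright := ih (b - (j + 1)) (by omega) hjb rfl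
  have hhalf : ∀ x, 0 ≤ x → x ≤ w / 2 →
      sewingConst C θ * x ^ θ ≤ sewingConst C θ * 2 ^ (1 - θ) * w ^ θ / 2 := fun x hx hxw =>
    calc sewingConst C θ * x ^ θ ≤ sewingConst C θ * (w / 2) ^ θ := by gcongr
      _ = sewingConst C θ * 2 ^ (1 - θ) * w ^ θ / 2 := by rw [half_rpow_eq hw0]; ring
  have hsplit : E a b - ∑ i ∈ Finset.Ico a b, E i (i + 1) =
      (E a b - E a j - E j b) + (E j b - E j (j + 1) - E (j + 1) b) +
        (E a j - ∑ i ∈ Finset.Ico a j, E i (i + 1)) +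
        (E (j + 1) b - ∑ i ∈ Finset.Ico (j + 1) b, E i (i + 1)) := by
    rw [← Finset.sum_Ico_consecutive _ haj hjb.le, Finset.sum_eq_sum_Ico_succ_bot hjb]
    abel
  calc ‖E a b - ∑ i ∈ Finset.Ico a b, E i (i + 1)‖
      ≤ C * (h b - h a) ^ θ + C * (h b - h j) ^ θ + sewingConst C θ * (h j - h a) ^ θ +
          sewingConst C θ * (h b - h (j + 1)) ^ θ := by
        rw [hsplit]
        exact norm_add₄_le.trans (by gcongr; exacts [hE _ _ _ haj hjb.le, hE _ _ _ j.le_succ hjb])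
    _ ≤ C * w ^ θ + C * w ^ θ + sewingConst C θ * 2 ^ (1 - θ) * w ^ θ / 2 +
          sewingConst C θ * 2 ^ (1 - θ) * w ^ θ / 2 := by
        gcongr
        · exact sub_nonneg.2 (hh hjb.le)
        · linarith [hh haj]
        · exact hhalf _ (sub_nonneg.2 (hh haj)) (by linarith)
        · exact hhalf _ (sub_nonneg.2 (hh hjb)) (by linarith)
    _ = (2 * C + sewingConst C θ * 2 ^ (1 - θ)) * w ^ θ := by ring
    _ = sewingConst C θ * w ^ θ := by rw [two_mul_add_sewingConst_mul hθ]

/-- A two-parameter functional on `[a, b]` is almost additive if its additivity defect is of order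
`θ` with respect to the control `(s, t) ↦ H t - H s`; the case of interest is `θ > 1`. -/
def AlmostAdditive (a b C θ : ℝ) (H : ℝ → ℝ) (E : ℝ → ℝ → F) : Prop :=
  ∀ s u t, a ≤ s → s ≤ u → u ≤ t → t ≤ b → ‖E s t - E s u - E u t‖ ≤ C * (H t - H s) ^ θ

variable {a b : ℝ} {H : ℝ → ℝ} {E : ℝ → ℝ → F}

theorem AlmostAdditive.norm_sub_sum_intervals_le (hE : AlmostAdditive a b C θ H E) (hC : 0 ≤ C)
    (hθ : 1 < θ) (hH : MonotoneOn H (Icc a b)) {s t : ℝ} (hs : a ≤ s) (ht : t ≤ b)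
    (P : IntervalPartition s t) :
    ‖E s t - ∑ e ∈ P.intervals, E e.1 e.2‖ ≤ sewingConst C θ * (H t - H s) ^ θ := by
  have hmem : ∀ i, P.point i ∈ Icc a b := fun i =>
    Icc_subset_Icc hs ht (P.subset_Icc _ (P.point_mem i))
  have h := norm_sub_sum_Ico_le (E := fun i j => E (P.point i) (P.point j))
    (h := fun i => H (P.point i)) hC hθ (fun i j hij => hH (hmem i) (hmem j) (P.monotone_point hij))
    (fun i j k hij hjk => hE _ _ _ (hmem i).1 (P.monotone_point hij) (P.monotone_point hjk)
      (hmem k).2) P.size.zero_le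
  rwa [← Finset.range_eq_Ico, P.point_zero, P.point_size,
    ← P.sum_intervals_eq_sum_range (fun e => E e.1 e.2)] at h

theorem AlmostAdditive.norm_le_of_small_sums (hE : AlmostAdditive a b C θ H E) (hC : 0 ≤ C)
    (hθ : 1 < θ) (hH : MonotoneOn H (Icc a b)) {s t : ℝ} (hs : a ≤ s) (ht : t ≤ b)
    (hsmall : ∀ ε > 0, ∃ P : IntervalPartition s t, ‖∑ e ∈ P.intervals, E e.1 e.2‖ ≤ ε) :
    ‖E s t‖ ≤ sewingConst C θ * (H t - H s) ^ θ := by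
  refine le_of_forall_pos_le_add fun ε hε => ?_
  obtain ⟨P, hP⟩ := hsmall ε hε
  calc ‖E s t‖ ≤ ‖E s t - ∑ e ∈ P.intervals, E e.1 e.2‖ + ‖∑ e ∈ P.intervals, E e.1 e.2‖ :=
        norm_le_norm_sub_add _ _
    _ ≤ sewingConst C θ * (H t - H s) ^ θ + ε :=
        add_le_add (hE.norm_sub_sum_intervals_le hC hθ hH hs ht P) hP

theorem rpow_le_rpow_sub_one_mul {x η : ℝ} (hx : 0 ≤ x) (hxη : x ≤ η) (hθ : 1 < θ) :
    x ^ θ ≤ η ^ (θ - 1) * x := by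
  have h : x ^ θ = x ^ (θ - 1) * x := by
    rw [← Real.rpow_add_one' hx (by linarith), sub_add_cancel]
  rw [h]
  gcongr

theorem exists_pos_mul_rpow_lt (hθ : 0 < θ) (K : ℝ) {ε : ℝ} (hε : 0 < ε) :
    ∃ η > 0, K * η ^ θ < ε := by
  have hlim : Tendsto (fun η : ℝ => K * η ^ θ) (𝓝[>] 0) (𝓝 0) := by
    have h := ((Real.continuousAt_rpow_const 0 θ (Or.inr hθ.le)).const_mul K).tendsto
    rw [Real.zero_rpow hθ.ne', mul_zero] at h
    exact h.mono_left nhdsWithin_le_nhds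
  obtain ⟨η, hη, hη0⟩ := ((hlim.eventually_lt_const hε).and self_mem_nhdsWithin).exists
  exact ⟨η, hη0, hη⟩

theorem exists_norm_sum_intervals_lt (hC : 0 ≤ C) (hθ : 1 < θ) (hH : MonotoneOn H (Icc a b))
    (hHc : ContinuousOn H (Icc a b))
    (hE : ∀ s t, a ≤ s → s ≤ t → t ≤ b → ‖E s t‖ ≤ C * (H t - H s) ^ θ) {ε : ℝ}
    (hε : 0 < ε) : ∃ δ > 0, ∀ P : IntervalPartition a b, (∀ e ∈ P.intervals, e.2 - e.1 < δ) →
      ‖∑ e ∈ P.intervals, E e.1 e.2‖ < ε := by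
  obtain ⟨η, hη0, hη⟩ := exists_pos_mul_rpow_lt (sub_pos.2 hθ) (C * (H b - H a)) hε
  obtain ⟨δ, hδ, hδH⟩ := Metric.uniformContinuousOn_iff.1
    (isCompact_Icc.uniformContinuousOn_of_continuous hHc) η hη0
  refine ⟨δ, hδ, fun P hP => ?_⟩
  have hterm : ∀ e ∈ P.intervals, ‖E e.1 e.2‖ ≤ C * (η ^ (θ - 1) * (H e.2 - H e.1)) := by
    intro e he
    obtain ⟨h1, h2, h3⟩ := P.le_of_mem_intervals he
    have hm1 : e.1 ∈ Icc a b := ⟨h1, h2.trans h3⟩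
    have hm2 : e.2 ∈ Icc a b := ⟨h1.trans h2, h3⟩
    have hlt := hδH e.2 hm2 e.1 hm1
      (by rw [Real.dist_eq, abs_of_nonneg (sub_nonneg.2 h2)]; exact hP e he)
    exact (hE _ _ h1 h2 h3).trans (mul_le_mul_of_nonneg_left (rpow_le_rpow_sub_one_mul
      (sub_nonneg.2 (hH hm1 hm2 h2)) ((le_abs_self _).trans hlt.le) hθ) hC)
  calc ‖∑ e ∈ P.intervals, E e.1 e.2‖
      ≤ ∑ e ∈ P.intervals, C * (η ^ (θ - 1) * (H e.2 - H e.1)) := norm_sum_le_of_le _ hterm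
    _ = C * (H b - H a) * η ^ (θ - 1) := by
        rw [← Finset.mul_sum, ← Finset.mul_sum, P.sum_intervals_sub]
        ring
    _ < ε := hη

theorem AlmostAdditive.exists_norm_sum_intervals_lt (hE : AlmostAdditive a b C θ H E)
    (hC : 0 ≤ C) (hθ : 1 < θ) (hH : MonotoneOn H (Icc a b)) (hHc : ContinuousOn H (Icc a b))
    (hsmall : ∀ s t, a ≤ s → s ≤ t → t ≤ b → ∀ ε > 0, ∃ P : IntervalPartition s t,
      ‖∑ e ∈ P.intervals, E e.1 e.2‖ ≤ ε) {t : ℝ} (ht : t ≤ b) {ε : ℝ} (hε : 0 < ε) :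
    ∃ δ > 0, ∀ P : IntervalPartition a t, (∀ e ∈ P.intervals, e.2 - e.1 < δ) →
      ‖∑ e ∈ P.intervals, E e.1 e.2‖ < ε :=
  have hsub : Icc a t ⊆ Icc a b := Icc_subset_Icc_right ht
  PathwiseRough.exists_norm_sum_intervals_lt (sewingConst_nonneg hC hθ) hθ (hH.mono hsub)
    (hHc.mono hsub) (fun s u hs hsu hu => hE.norm_le_of_small_sums hC hθ hH hs (hu.trans ht)
      (hsmall s u hs hsu (hu.trans ht))) hε

end AlmostAdditive

/-! ### Geometric refinement of dyadic Lebesgue partitions -/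

theorem IntervalPartition.sum_dist_le_sum_intervals {a b : ℝ} {F : Type*} [PseudoMetricSpace F]
    (P : IntervalPartition a b) {τ : ℕ → ℝ} (hτ : Monotone τ) (hτP : ∀ k, τ k ∈ P.points)
    (x : ℝ → F) (m : ℕ) :
    ∑ k ∈ Finset.range m, dist (x (τ k)) (x (τ (k + 1))) ≤
      ∑ e ∈ P.intervals, dist (x e.1) (x e.2) := by
  choose j hj hjτ using fun k => P.mem_points_iff.1 (hτP k)
  have hmono : ∀ k, j k ≤ j (k + 1) := fun k => not_lt.1 fun hlt => by
    have h := (P.point_lt_point_iff (hj _) (hj _)).2 hlt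
    rw [hjτ, hjτ] at h
    exact (hτ k.le_succ).not_gt h
  have hsum : ∀ m, ∑ k ∈ Finset.range m, dist (x (τ k)) (x (τ (k + 1))) ≤
      ∑ i ∈ Finset.range (j m), dist (x (P.point i)) (x (P.point (i + 1))) := by
    intro m
    induction m with
    | zero => exact Finset.sum_nonneg fun _ _ => dist_nonneg
    | succ m ih =>
      rw [Finset.sum_range_succ, ← Finset.sum_range_add_sum_Ico _ (hmono m), ← hjτ, ← hjτ]
      exact add_le_add ih (dist_le_Ico_sum_dist (fun i => x (P.point i)) (hmono m))
  rw [P.sum_intervals_eq_sum_range]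
  exact (hsum m).trans (Finset.sum_le_sum_of_subset_of_nonneg (Finset.range_mono (hj m))
    fun _ _ _ => dist_nonneg)

section Grid

variable {ε : ℝ}

theorem isClosed_of_forall_exists_int_mul (hε : ε ≠ 0) {A : Set ℝ}
    (hA : ∀ y ∈ A, ∃ m : ℤ, y = m * ε) : IsClosed A := by
  let g : ℤ → ℝ := fun m => m * ε
  have hg : Topology.IsClosedEmbedding g :=
    (Homeomorph.mulRight₀ ε hε).isClosedEmbedding.comp Int.isClosedEmbedding_coe_real
  have hAg : g '' (g ⁻¹' A) = A := image_preimage_eq_of_subset fun y hy =>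
    let ⟨m, hm⟩ := hA y hy
    ⟨m, hm.symm⟩
  exact hAg ▸ hg.isClosedMap _ (isClosed_discrete _)

theorem le_abs_int_mul_sub_int_mul (hε : 0 ≤ ε) {a b : ℤ} (hab : (a : ℝ) * ε ≠ b * ε) :
    ε ≤ |a * ε - b * ε| := by
  have hne : a - b ≠ 0 := fun h => hab (by rw [sub_eq_zero.1 h])
  have hone : (1 : ℝ) ≤ |(a : ℝ) - b| := by exact_mod_cast Int.one_le_abs hne
  rw [← sub_mul, abs_mul, abs_of_nonneg hε]
  exact le_mul_of_one_le_left hε hone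

theorem exists_int_mul_mem_Ioo (hε : 0 < ε) {y z : ℝ} (hyz : ε < z - y) :
    ∃ m : ℤ, (m : ℝ) * ε ∈ Ioo y z := by
  have hlt := (div_lt_iff₀ hε).1 (Int.lt_floor_add_one (y / ε))
  have hle := (le_div_iff₀ hε).1 (Int.floor_le (y / ε))
  refine ⟨⌊y / ε⌋ + 1, ?_⟩
  push_cast
  exact ⟨hlt, by linarith⟩

theorem exists_int_mul_mem_uIcc (hε : 0 < ε) {y z : ℝ} (hyz : ε < |z - y|) :
    ∃ m : ℤ, (m : ℝ) * ε ∈ uIcc y z ∧ (m : ℝ) * ε ≠ y ∧ (m : ℝ) * ε ≠ z := by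
  rcases lt_abs.1 hyz with h | h
  · obtain ⟨m, hy, hz⟩ := exists_int_mul_mem_Ioo hε h
    exact ⟨m, Icc_subset_uIcc ⟨hy.le, hz.le⟩, hy.ne', hz.ne⟩
  · obtain ⟨m, hz, hy⟩ := exists_int_mul_mem_Ioo hε (h.trans_eq (neg_sub z y))
    exact ⟨m, Icc_subset_uIcc' ⟨hz.le, hy.le⟩, hy.ne, hz.ne'⟩

end Grid

section LebesgueTime

variable {T : ℝ} {x : ℝ → ℝ}

theorem lebesgueTime_monotone (hT : 0 ≤ T) (x : ℝ → ℝ) (n : ℕ) :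
    Monotone (lebesgueTime T x n) :=
  monotone_nat_of_le_succ (lebesgueTime_le_succ hT x n)

theorem lebesgueTime_succ_mem (hT : 0 ≤ T) (hx : ContinuousOn x (Icc 0 T)) (n k : ℕ) :
    lebesgueTime T x n (k + 1) = T ∨
      ((∃ m : ℤ, x (lebesgueTime T x n (k + 1)) = m * (2⁻¹ : ℝ) ^ n) ∧
        x (lebesgueTime T x n (k + 1)) ≠ x (lebesgueTime T x n k)) := by
  set τ := lebesgueTime T x n k with hτ
  have hτT : τ ∈ Icc 0 T := lebesgueTime_mem hT x n k
  let A : Set ℝ := {t | τ ≤ t ∧ t ≤ T ∧ (∃ m : ℤ, x t = m * (2⁻¹ : ℝ) ^ n) ∧ x t ≠ x τ}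
  let G : Set ℝ := {y | (∃ m : ℤ, y = m * (2⁻¹ : ℝ) ^ n) ∧ y ≠ x τ}
  have hAG : A = Icc τ T ∩ x ⁻¹' G := by
    ext t
    simp only [A, G, mem_ofPred_eq, mem_inter_iff, mem_Icc, mem_preimage, and_assoc]
  have hA : IsClosed (A ∪ {T}) := by
    refine IsClosed.union ?_ isClosed_singleton
    rw [hAG]
    exact (hx.mono (Icc_subset_Icc_left hτT.1)).preimage_isClosed_of_isClosed isClosed_Icc
      (isClosed_of_forall_exists_int_mul (by positivity) fun y hy => hy.1)
  have hbdd : BddBelow (A ∪ {T}) :=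
    BddBelow.union ⟨τ, fun t ht => ht.1⟩ bddBelow_singleton
  have hmem : lebesgueTime T x n (k + 1) ∈ A ∪ {T} := by
    rw [lebesgueTime, ← hτ]
    exact hA.csInf_mem ⟨T, Or.inr rfl⟩ hbdd
  exact hmem.symm.imp_right fun h => h.2.2

theorem lebesgueTime_succ_le (hT : 0 ≤ T) (x : ℝ → ℝ) (n k : ℕ) {t : ℝ}
    (ht : lebesgueTime T x n k ≤ t) (htT : t ≤ T) (hgrid : ∃ m : ℤ, x t = m * (2⁻¹ : ℝ) ^ n)
    (hne : x t ≠ x (lebesgueTime T x n k)) : lebesgueTime T x n (k + 1) ≤ t := by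
  rw [lebesgueTime]
  refine csInf_le ⟨lebesgueTime T x n k, ?_⟩ (Or.inl ⟨ht, htT, hgrid, hne⟩)
  rintro s (hs | rfl)
  · exact hs.1
  · exact (lebesgueTime_mem hT x n k).2

theorem lebesgueTime_lt_succ (hT : 0 ≤ T) (hx : ContinuousOn x (Icc 0 T)) (n k : ℕ)
    (hk : lebesgueTime T x n k < T) : lebesgueTime T x n k < lebesgueTime T x n (k + 1) := by
  refine lt_of_le_of_ne (lebesgueTime_le_succ hT x n k) fun h => ?_
  rcases lebesgueTime_succ_mem hT hx n k with hsucc | hsucc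
  · exact hk.ne (h.trans hsucc)
  · exact hsucc.2 (by rw [← h])

theorem exists_lebesgueTime_eq (hT : 0 ≤ T) (hx : ContinuousOn x (Icc 0 T)) (n : ℕ) :
    ∃ k, lebesgueTime T x n k = T := by
  by_contra! h
  have hlt : ∀ k, lebesgueTime T x n k < T := fun k =>
    lt_of_le_of_ne (lebesgueTime_mem hT x n k).2 (h k)
  have hmono : StrictMono (lebesgueTime T x n) :=
    strictMono_nat_of_lt_succ fun k => lebesgueTime_lt_succ hT hx n k (hlt k)
  exact infinite_range_of_injective hmono.injective (finite_range_lebesgueTime hT hx n)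

theorem abs_sub_lebesgueTime_le (hT : 0 ≤ T) (hx : ContinuousOn x (Icc 0 T)) (n k : ℕ) {t : ℝ}
    (ht : t ∈ Icc (lebesgueTime T x n k) (lebesgueTime T x n (k + 1))) :
    |x t - x (lebesgueTime T x n k)| ≤ (2⁻¹ : ℝ) ^ n := by
  set τ := lebesgueTime T x n k
  have hτT : τ ∈ Icc 0 T := lebesgueTime_mem hT x n k
  have htT : t ≤ T := ht.2.trans (lebesgueTime_mem hT x n _).2
  have hcont : ContinuousOn x (uIcc τ t) := by
    rw [uIcc_of_le ht.1]
    exact hx.mono (Icc_subset_Icc hτT.1 htT)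
  by_contra! hlt
  obtain ⟨m, hm, hmτ, hmt⟩ := exists_int_mul_mem_uIcc (by positivity) hlt
  obtain ⟨r, hr, hrm⟩ := intermediate_value_uIcc hcont hm
  rw [uIcc_of_le ht.1] at hr
  have hrt : r < t := lt_of_le_of_ne hr.2 fun h => hmt (by rw [← hrm, h])
  exact absurd (lebesgueTime_succ_le hT x n k hr.1 (hr.2.trans htT) ⟨m, hrm⟩ (by rwa [hrm]))
    (not_le.2 (hrt.trans_le ht.2))

theorem le_abs_sub_lebesgueTime (hT : 0 ≤ T) (hx : ContinuousOn x (Icc 0 T)) (n k : ℕ)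
    (hk : lebesgueTime T x n (k + 2) < T) :
    (2⁻¹ : ℝ) ^ n ≤ |x (lebesgueTime T x n (k + 1)) - x (lebesgueTime T x n (k + 2))| := by
  obtain ⟨⟨a, ha⟩, hne⟩ := (lebesgueTime_succ_mem hT hx n (k + 1)).resolve_left hk.ne
  obtain ⟨⟨b, hb⟩, -⟩ := (lebesgueTime_succ_mem hT hx n k).resolve_left
    ((lebesgueTime_le_succ hT x n (k + 1)).trans_lt hk).ne
  rw [ha, hb] at hne ⊢
  exact le_abs_int_mul_sub_int_mul (by positivity) hne.symm

/-- The index of the first Lebesgue time which equals `T`. -/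
noncomputable def lebesgueCount (T : ℝ) (x : ℝ → ℝ) (n : ℕ) : ℕ :=
  sInf {k | lebesgueTime T x n k = T}

theorem lebesgueTime_lebesgueCount (hT : 0 ≤ T) (hx : ContinuousOn x (Icc 0 T)) (n : ℕ) :
    lebesgueTime T x n (lebesgueCount T x n) = T :=
  Nat.sInf_mem (exists_lebesgueTime_eq hT hx n)

theorem lebesgueTime_lt_of_lt_lebesgueCount (hT : 0 ≤ T) {n k : ℕ}
    (hk : k < lebesgueCount T x n) : lebesgueTime T x n k < T :=
  lt_of_le_of_ne (lebesgueTime_mem hT x n k).2 (Nat.notMem_of_lt_sInf hk)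

theorem exists_le_lebesgueCount_lebesgueTime_eq (hT : 0 ≤ T) (hx : ContinuousOn x (Icc 0 T))
    (n k : ℕ) : ∃ j ≤ lebesgueCount T x n, lebesgueTime T x n j = lebesgueTime T x n k := by
  rcases le_total k (lebesgueCount T x n) with h | h
  · exact ⟨k, h, rfl⟩
  · have hT' := lebesgueTime_lebesgueCount hT hx n
    exact ⟨_, le_rfl, hT'.trans (lebesgueTime_eq_of_eq hT x n hT' h).symm⟩

theorem lebesgueCount_mul_le (hT : 0 ≤ T) (hx : ContinuousOn x (Icc 0 T)) (n : ℕ)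
    (P : IntervalPartition 0 T) (hP : ∀ k, lebesgueTime T x n k ∈ P.points) :
    lebesgueCount T x n * (2⁻¹ : ℝ) ^ n ≤
      2 * (2⁻¹ : ℝ) ^ n + ∑ e ∈ P.intervals, |x e.1 - x e.2| := by
  set m := lebesgueCount T x n - 2
  have hcount : (lebesgueCount T x n : ℝ) ≤ 2 + m := by norm_cast; omega
  have hlow : m * (2⁻¹ : ℝ) ^ n ≤ ∑ e ∈ P.intervals, |x e.1 - x e.2| := by
    refine le_trans ?_ (P.sum_dist_le_sum_intervals (τ := fun k => lebesgueTime T x n (k + 1))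
      (fun i j hij => lebesgueTime_monotone hT x n (by omega)) (fun k => hP (k + 1)) x m)
    rw [← nsmul_eq_mul]
    nth_rw 1 [← Finset.card_range m]
    refine Finset.card_nsmul_le_sum _ _ _ fun k hk => ?_
    have hk : k < m := Finset.mem_range.1 hk
    exact le_abs_sub_lebesgueTime hT hx n k (lebesgueTime_lt_of_lt_lebesgueCount hT (by omega))
  calc lebesgueCount T x n * (2⁻¹ : ℝ) ^ n ≤ (2 + m) * (2⁻¹ : ℝ) ^ n := by gcongr
    _ ≤ 2 * (2⁻¹ : ℝ) ^ n + ∑ e ∈ P.intervals, |x e.1 - x e.2| := by linarith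

end LebesgueTime

section DyadicLebesgue

/-- The sequence of partitions resolves the path at a geometric scale `r ^ n` without wasting
points: the path oscillates by `O(r ^ n)` on the intervals of `π n`, and `π n` has `O(r ^ (-n p))`
points, as many as a path of finite `p`-th variation needs at this scale. -/
def IsGeometricallyFine {F : Type*} [SeminormedAddCommGroup F] {a b : ℝ} (p : ℕ)
    (π : ℕ → IntervalPartition a b) (S : ℝ → F) : Prop :=
  ∃ r D C : ℝ, 0 < r ∧ r < 1 ∧
    (∀ n, ∀ e ∈ (π n).intervals, ∀ s ∈ Icc e.1 e.2, ∀ t ∈ Icc e.1 e.2, ‖S t - S s‖ ≤ D * r ^ n) ∧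
    ∀ n, (π n).points.card * (r ^ n) ^ p ≤ C

theorem norm_le_sum_norm {ι : Type*} [Fintype ι] (v : EuclideanSpace ℝ ι) : ‖v‖ ≤ ∑ i, ‖v i‖ := by
  rw [EuclideanSpace.norm_eq]
  exact (Real.sqrt_le_left (Finset.sum_nonneg fun i _ => norm_nonneg (v i))).2
    (Finset.sum_sq_le_sq_sum_of_nonneg fun i _ => norm_nonneg (v i))

theorem norm_le_card_mul_of_forall_abs_le {ι : Type*} [Fintype ι] {v : EuclideanSpace ℝ ι} {m : ℝ}
    (hv : ∀ i, |v i| ≤ m) : ‖v‖ ≤ Fintype.card ι * m := by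
  calc ‖v‖ ≤ ∑ i, ‖v i‖ := norm_le_sum_norm v
    _ ≤ ∑ _i : ι, m := Finset.sum_le_sum fun i _ => hv i
    _ = Fintype.card ι * m := by rw [Finset.sum_const, Finset.card_univ, nsmul_eq_mul]

variable {d : ℕ} {T : ℝ} {S : ℝ → EuclideanSpace ℝ (Fin d)} {hT : 0 ≤ T}
  {hS : ContinuousOn S (Icc 0 T)} {n : ℕ}

theorem continuousOn_coord (hS : ContinuousOn S (Icc 0 T)) (i : Fin d) :
    ContinuousOn (fun t => S t i) (Icc 0 T) :=
  (EuclideanSpace.proj (𝕜 := ℝ) i).continuous.comp_continuousOn hS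

theorem mem_points_dyadicLebesgue {t : ℝ} :
    t ∈ (dyadicLebesgue hT hS n).points ↔
      (t = 0 ∨ t = T) ∨ ∃ i k, lebesgueTime T (fun t => S t i) n k = t := by
  simp only [dyadicLebesgue, Finite.mem_toFinset, mem_union, mem_insert_iff, mem_singleton_iff,
    mem_iUnion, mem_range]

theorem lebesgueTime_mem_points_dyadicLebesgue (i : Fin d) (k : ℕ) :
    lebesgueTime T (fun t => S t i) n k ∈ (dyadicLebesgue hT hS n).points :=
  mem_points_dyadicLebesgue.2 (Or.inr ⟨i, k, rfl⟩)

theorem exists_Icc_subset_Icc_lebesgueTime {e : ℝ × ℝ}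
    (he : e ∈ (dyadicLebesgue hT hS n).intervals) (i : Fin d) :
    ∃ k, Icc e.1 e.2 ⊆ Icc (lebesgueTime T (fun t => S t i) n k)
      (lebesgueTime T (fun t => S t i) n (k + 1)) := by
  obtain ⟨he0, -, heT⟩ := IntervalPartition.le_of_mem_intervals _ he
  obtain ⟨-, -, hlt, hgap⟩ := (dyadicLebesgue hT hS n).mem_intervals.1 he
  obtain ⟨K, hK⟩ := exists_lebesgueTime_eq hT (continuousOn_coord hS i) n
  have hex : ∃ k, e.1 < lebesgueTime T (fun t => S t i) n k :=
    ⟨K, hlt.trans_le (heT.trans_eq hK.symm)⟩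
  classical
  obtain ⟨k, hk⟩ : ∃ k, Nat.find hex = k + 1 := by
    refine Nat.exists_eq_succ_of_ne_zero fun h0 => ?_
    have h := Nat.find_spec hex
    rw [h0, lebesgueTime] at h
    exact he0.not_gt h
  have hspec := Nat.find_spec hex
  rw [hk] at hspec
  exact ⟨k, Icc_subset_Icc (not_lt.1 (Nat.find_min hex (by omega)))
    (not_lt.1 fun h => hgap _ (lebesgueTime_mem_points_dyadicLebesgue i (k + 1)) ⟨hspec, h⟩)⟩

theorem norm_sub_le_of_mem_intervals_dyadicLebesgue {e : ℝ × ℝ}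
    (he : e ∈ (dyadicLebesgue hT hS n).intervals) {r s : ℝ} (hr : r ∈ Icc e.1 e.2)
    (hs : s ∈ Icc e.1 e.2) : ‖S r - S s‖ ≤ d * 2 * (2⁻¹ : ℝ) ^ n := by
  have hcoord : ∀ i, |(S r - S s) i| ≤ 2 * (2⁻¹ : ℝ) ^ n := by
    intro i
    obtain ⟨k, hk⟩ := exists_Icc_subset_Icc_lebesgueTime he i
    have hr' := abs_sub_lebesgueTime_le hT (continuousOn_coord hS i) n k (hk hr)
    have hs' := abs_sub_lebesgueTime_le hT (continuousOn_coord hS i) n k (hk hs)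
    rw [PiLp.sub_apply, two_mul, ← sub_sub_sub_cancel_right _ _
      (S (lebesgueTime T (fun t => S t i) n k) i)]
    exact (abs_sub _ _).trans (add_le_add hr' hs')
  refine (norm_le_card_mul_of_forall_abs_le hcoord).trans_eq ?_
  rw [Fintype.card_fin, mul_assoc]

theorem card_dyadicLebesgue_le (hT : 0 ≤ T) (hS : ContinuousOn S (Icc 0 T)) (n : ℕ) :
    (dyadicLebesgue hT hS n).points.card ≤
      2 + ∑ i, (lebesgueCount T (fun t => S t i) n + 1) := by
  classical
  let A : Fin d → Finset ℝ := fun i =>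
    (Finset.range (lebesgueCount T (fun t => S t i) n + 1)).image
      (lebesgueTime T (fun t => S t i) n)
  have hsub : (dyadicLebesgue hT hS n).points ⊆ {0, T} ∪ Finset.univ.biUnion A := by
    intro t ht
    rcases mem_points_dyadicLebesgue.1 ht with (rfl | rfl) | ⟨i, k, rfl⟩
    · simp
    · simp
    · obtain ⟨j, hj, hjk⟩ :=
        exists_le_lebesgueCount_lebesgueTime_eq hT (continuousOn_coord hS i) n k
      exact Finset.mem_union_right _ (Finset.mem_biUnion.2 ⟨i, Finset.mem_univ _,
        Finset.mem_image.2 ⟨j, Finset.mem_range_succ_iff.2 hj, hjk⟩⟩)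
  calc (dyadicLebesgue hT hS n).points.card ≤ ({0, T} ∪ Finset.univ.biUnion A).card :=
        Finset.card_le_card hsub
    _ ≤ 2 + ∑ i, (A i).card := (Finset.card_union_le _ _).trans
        (add_le_add Finset.card_le_two Finset.card_biUnion_le)
    _ ≤ 2 + ∑ i, (lebesgueCount T (fun t => S t i) n + 1) := by
        gcongr with i
        exact Finset.card_image_le.trans_eq (Finset.card_range _)

theorem card_dyadicLebesgue_mul_le (hT : 0 ≤ T) (hS : ContinuousOn S (Icc 0 T)) (n : ℕ) :
    (dyadicLebesgue hT hS n).points.card * (2⁻¹ : ℝ) ^ n ≤ (2 + 3 * d) * (2⁻¹ : ℝ) ^ n +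
      ∑ e ∈ (dyadicLebesgue hT hS n).intervals, ∑ i, |S e.1 i - S e.2 i| := by
  have hcard : ((dyadicLebesgue hT hS n).points.card : ℝ) ≤
      2 + d + ∑ i, (lebesgueCount T (fun t => S t i) n : ℝ) := by
    have h := card_dyadicLebesgue_le hT hS n
    rw [Finset.sum_add_distrib, Finset.sum_const, Finset.card_univ, Fintype.card_fin] at h
    rify at h
    linarith [h.trans_eq (by simp : _ = 2 + (∑ i, (lebesgueCount T (fun t => S t i) n : ℝ) + d))]
  have hcount := Finset.sum_le_sum fun i (_ : i ∈ Finset.univ) =>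
    lebesgueCount_mul_le hT (continuousOn_coord hS i) n (dyadicLebesgue hT hS n)
      (lebesgueTime_mem_points_dyadicLebesgue i)
  rw [← Finset.sum_mul, Finset.sum_add_distrib, Finset.sum_const, Finset.card_univ,
    Fintype.card_fin, nsmul_eq_mul, Finset.sum_comm] at hcount
  calc (dyadicLebesgue hT hS n).points.card * (2⁻¹ : ℝ) ^ n
      ≤ (2 + d + ∑ i, (lebesgueCount T (fun t => S t i) n : ℝ)) * (2⁻¹ : ℝ) ^ n := by gcongr
    _ ≤ _ := by linarith

theorem pow_sum_abs_le {P : IntervalPartition 0 T} {m : ℕ} {B : ℝ}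
    (hB : ∑ e ∈ P.intervals, ∑ i, |S e.1 i - S e.2 i| ^ (m + 1) ≤ B) :
    (∑ e ∈ P.intervals, ∑ i, |S e.1 i - S e.2 i|) ^ (m + 1) ≤
      d ^ m * B * (P.points.card : ℝ) ^ m := by
  have hB0 : 0 ≤ B := (Finset.sum_nonneg fun e _ => Finset.sum_nonneg fun i _ => by positivity :
    (0 : ℝ) ≤ _).trans hB
  rw [← Finset.sum_product'] at hB ⊢
  calc (∑ z ∈ P.intervals ×ˢ Finset.univ, |S z.1.1 z.2 - S z.1.2 z.2|) ^ (m + 1)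
      ≤ ((P.intervals ×ˢ (Finset.univ : Finset (Fin d))).card : ℝ) ^ m *
          ∑ z ∈ P.intervals ×ˢ Finset.univ, |S z.1.1 z.2 - S z.1.2 z.2| ^ (m + 1) :=
        pow_sum_le_card_mul_sum_pow (fun _ _ => abs_nonneg _) m
    _ ≤ (P.points.card * d : ℝ) ^ m * B := by
        rw [Finset.card_product, Finset.card_univ, Fintype.card_fin]
        push_cast
        gcongr
        exact P.card_intervals_le
    _ = d ^ m * B * (P.points.card : ℝ) ^ m := by ring

theorem mul_pow_le_of_mul_le_add {M ε X A c : ℝ} {m : ℕ} (hM : 0 < M) (hε : 0 < ε) (hε1 : ε ≤ 1)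
    (hc : 0 ≤ c) (hA : 0 ≤ A) (hMX : M * ε ≤ c * ε + X) (hX : X ^ (m + 1) ≤ A * M ^ m) :
    M * ε ^ (m + 1) ≤ 2 * c + 2 ^ (m + 1) * A := by
  rcases le_total M (2 * c) with hMc | hMc
  · calc M * ε ^ (m + 1) ≤ 2 * c * 1 := by gcongr; exact pow_le_one₀ hε.le hε1
      _ ≤ 2 * c + 2 ^ (m + 1) * A := by rw [mul_one]; exact le_add_of_nonneg_right (by positivity)
  · have hX' : M * ε ≤ 2 * X := by nlinarith
    have hpow : M ^ m * (M * ε ^ (m + 1)) ≤ M ^ m * (2 ^ (m + 1) * A) :=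
      calc M ^ m * (M * ε ^ (m + 1)) = (M * ε) ^ (m + 1) := by ring
        _ ≤ (2 * X) ^ (m + 1) := by gcongr
        _ ≤ M ^ m * (2 ^ (m + 1) * A) := by
          rw [mul_pow, mul_left_comm, mul_comm (M ^ m)]
          gcongr
    exact (le_of_mul_le_mul_left hpow (by positivity)).trans (le_add_of_nonneg_left (by positivity))

theorem isGeometricallyFine_dyadicLebesgue (hT : 0 ≤ T) (hS : ContinuousOn S (Icc 0 T)) {p : ℕ}
    (hp : 0 < p) {B : ℝ} (hB : ∀ n, ∑ e ∈ (dyadicLebesgue hT hS n).intervals,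
      ∑ i, |S e.1 i - S e.2 i| ^ p ≤ B) :
    IsGeometricallyFine p (dyadicLebesgue hT hS) S := by
  obtain ⟨m, rfl⟩ := Nat.exists_eq_succ_of_ne_zero hp.ne'
  have hB0 : 0 ≤ B := (Finset.sum_nonneg fun e _ => Finset.sum_nonneg fun i _ => by positivity :
    (0 : ℝ) ≤ _).trans (hB 0)
  refine ⟨2⁻¹, d * 2, 2 * (2 + 3 * d) + 2 ^ (m + 1) * (d ^ m * B), by norm_num, by norm_num,
    fun n e he s hs t ht => norm_sub_le_of_mem_intervals_dyadicLebesgue he ht hs, fun n => ?_⟩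
  exact mul_pow_le_of_mul_le_add (by exact_mod_cast IntervalPartition.card_points_pos _)
    (by positivity) (pow_le_one₀ (by norm_num) (by norm_num)) (by positivity) (by positivity)
    (card_dyadicLebesgue_mul_le hT hS n) (pow_sum_abs_le (hB n))

end DyadicLebesgue

/-! ### Finite variation of exponent larger than `p` -/

section Ramp

/-- The continuous piecewise linear function which increases from `0` to `1` on `[a, b]`. -/
noncomputable def ramp (a b t : ℝ) : ℝ := max 0 (min 1 ((t - a) / (b - a)))

variable {a b t : ℝ}

@[fun_prop]
theorem continuous_ramp (a b : ℝ) : Continuous (ramp a b) := by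
  unfold ramp
  fun_prop

theorem monotone_ramp (hab : a ≤ b) : Monotone (ramp a b) := by
  intro s t hst
  have : 0 ≤ b - a := sub_nonneg.2 hab
  unfold ramp
  gcongr

theorem ramp_nonneg (a b t : ℝ) : 0 ≤ ramp a b t := le_max_left _ _

theorem ramp_le_one (a b t : ℝ) : ramp a b t ≤ 1 := max_le zero_le_one (min_le_left _ _)

theorem ramp_of_le (hab : a ≤ b) (hta : t ≤ a) : ramp a b t = 0 :=
  max_eq_left ((min_le_right _ _).trans
    (div_nonpos_of_nonpos_of_nonneg (sub_nonpos.2 hta) (sub_nonneg.2 hab)))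

theorem ramp_of_ge (hab : a < b) (hbt : b ≤ t) : ramp a b t = 1 := by
  have hle : 1 ≤ (t - a) / (b - a) := (one_le_div (sub_pos.2 hab)).2 (by linarith)
  rw [ramp, min_eq_left hle, max_eq_right zero_le_one]

end Ramp

section VariationControl

namespace IntervalPartition

variable {a b : ℝ} (P : IntervalPartition a b)

/-- The continuous increasing function that grows by one on each interval of a partition. -/
noncomputable def rampSum (t : ℝ) : ℝ := ∑ e ∈ P.intervals, ramp e.1 e.2 t

theorem continuous_rampSum : Continuous P.rampSum :=
  continuous_finsetSum _ fun e _ => continuous_ramp e.1 e.2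

theorem monotone_rampSum : Monotone P.rampSum := fun _ _ hst =>
  Finset.sum_le_sum fun _ he => monotone_ramp (P.le_of_mem_intervals he).2.1 hst

theorem norm_rampSum_le (t : ℝ) : ‖P.rampSum t‖ ≤ P.points.card := by
  have hnonneg : 0 ≤ P.rampSum t := Finset.sum_nonneg fun e _ => ramp_nonneg e.1 e.2 t
  rw [Real.norm_of_nonneg hnonneg]
  calc P.rampSum t ≤ P.intervals.card • (1 : ℝ) :=
        Finset.sum_le_card_nsmul _ _ _ fun e _ => ramp_le_one e.1 e.2 t
    _ ≤ P.points.card := by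
        rw [nsmul_one]
        exact_mod_cast P.card_intervals_le

theorem one_le_rampSum_sub {s t : ℝ} {e : ℝ × ℝ} (he : e ∈ P.intervals) (hs : s ≤ e.1)
    (ht : e.2 ≤ t) : 1 ≤ P.rampSum t - P.rampSum s := by
  have hlt := (P.mem_intervals.1 he).2.2.1
  have h := Finset.single_le_sum (f := fun e : ℝ × ℝ => ramp e.1 e.2 t - ramp e.1 e.2 s)
    (fun e' he' => sub_nonneg.2 (monotone_ramp (P.le_of_mem_intervals he').2.1
      (hs.trans (hlt.le.trans ht)))) he
  rwa [Finset.sum_sub_distrib, ramp_of_ge hlt ht, ramp_of_le hlt.le hs, sub_zero] at h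

theorem exists_intervals_subset_Icc {r r' : ℝ} (hr : r ∈ P.points) (hr' : r' ∈ P.points)
    (hlt : r < r') : ∃ e ∈ P.intervals, r ≤ e.1 ∧ e.2 ≤ r' := by
  have hne : (P.points.filter (r < ·)).Nonempty := ⟨r', Finset.mem_filter.2 ⟨hr', hlt⟩⟩
  have hmin := Finset.mem_filter.1 (Finset.min'_mem _ hne)
  refine ⟨(r, _), P.mem_intervals.2 ⟨hr, hmin.1, hmin.2, fun y hy hy' => ?_⟩, le_rfl,
    Finset.min'_le _ _ (Finset.mem_filter.2 ⟨hr', hlt⟩)⟩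
  exact (Finset.min'_le _ y (Finset.mem_filter.2 ⟨hy, hy'.1⟩)).not_gt hy'.2

theorem exists_intervals_of_lt_norm_sub {F : Type*} [SeminormedAddCommGroup F] {S : ℝ → F} {η : ℝ}
    (hη : ∀ e ∈ P.intervals, ∀ r ∈ Icc e.1 e.2, ∀ s ∈ Icc e.1 e.2, ‖S s - S r‖ ≤ η)
    {s t : ℝ} (hs : a ≤ s) (hst : s < t) (ht : t ≤ b) (h : 2 * η < ‖S t - S s‖) :
    ∃ e ∈ P.intervals, s ≤ e.1 ∧ e.2 ≤ t := by
  have hgap : ∀ u v, a ≤ u → u < v → v ≤ b → (∀ r ∈ P.points, ¬ (u < r ∧ r < v)) →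
      ‖S v - S u‖ ≤ η := by
    intro u v hu huv hv hno
    obtain ⟨e, he, heu, hev⟩ := P.exists_intervals_of_forall_notMem hu huv hv hno
    exact hη e he _ ⟨heu, huv.le.trans hev⟩ _ ⟨heu.trans huv.le, hev⟩
  by_contra! hcon
  have honly : ∀ y ∈ P.points, ∀ z ∈ P.points, s < y → z < t → ¬ y < z := by
    intro y hy z hz hsy hzt hyz
    obtain ⟨e, he, hye, hez⟩ := P.exists_intervals_subset_Icc hy hz hyz
    exact (hcon e he (hsy.le.trans hye)).not_ge (hez.trans hzt.le)
  by_cases hno : ∀ r ∈ P.points, ¬ (s < r ∧ r < t)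
  · linarith [hgap s t hs hst ht hno, norm_nonneg (S t - S s)]
  · push Not at hno
    obtain ⟨r, hr, hsr, hrt⟩ := hno
    have hleft := hgap s r hs hsr (hrt.le.trans ht) fun y hy hy' =>
      honly y hy r hr hy'.1 hrt hy'.2
    have hright := hgap r t (hs.trans hsr.le) hrt ht fun y hy hy' =>
      honly r hr y hy hsr hy'.2 hy'.1
    linarith [norm_sub_le_norm_sub_add_norm_sub (S t) (S r) (S s)]

end IntervalPartition

variable {F : Type*} [SeminormedAddCommGroup F] {S : ℝ → F} {a b r q C : ℝ} {p : ℕ}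
  {π : ℕ → IntervalPartition a b}

/-- A function of `t` that grows by at least `(r ^ n) ^ q` on every interval of `π n`, for
all `n`. -/
noncomputable def variationControl (π : ℕ → IntervalPartition a b) (r q t : ℝ) : ℝ :=
  ∑' n, (r ^ n) ^ q * (π n).rampSum t

theorem norm_rpow_mul_rampSum_le (hr0 : 0 < r)
    (hcard : ∀ n, (π n).points.card * (r ^ n) ^ p ≤ C) (n : ℕ) (t : ℝ) :
    ‖(r ^ n) ^ q * (π n).rampSum t‖ ≤ C * (r ^ (q - p)) ^ n := by
  have hrn : 0 < r ^ n := by positivity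
  have hscale : (r ^ n) ^ q = (r ^ n) ^ p * (r ^ (q - p)) ^ n := by
    rw [← Real.rpow_mul_natCast hr0.le, mul_comm (q - p), Real.rpow_natCast_mul hr0.le,
      ← Real.rpow_natCast (r ^ n) p, ← Real.rpow_add hrn, add_sub_cancel]
  calc ‖(r ^ n) ^ q * (π n).rampSum t‖ ≤ (r ^ n) ^ q * (π n).points.card := by
        rw [norm_mul, Real.norm_of_nonneg (by positivity)]
        gcongr
        exact (π n).norm_rampSum_le t
    _ = (π n).points.card * (r ^ n) ^ p * (r ^ (q - p)) ^ n := by rw [hscale]; ring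
    _ ≤ C * (r ^ (q - p)) ^ n := by
        gcongr
        exact hcard n

theorem summable_mul_rpow_sub_pow (hr0 : 0 < r) (hr1 : r < 1) (hpq : (p : ℝ) < q) :
    Summable fun n => C * (r ^ (q - p)) ^ n :=
  (summable_geometric_of_lt_one (by positivity)
    (Real.rpow_lt_one hr0.le hr1 (sub_pos.2 hpq))).mul_left C

theorem continuous_variationControl (hr0 : 0 < r) (hr1 : r < 1) (hpq : (p : ℝ) < q)
    (hcard : ∀ n, (π n).points.card * (r ^ n) ^ p ≤ C) : Continuous (variationControl π r q) :=
  continuous_tsum (fun n => (π n).continuous_rampSum.const_mul _)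
    (summable_mul_rpow_sub_pow hr0 hr1 hpq) (norm_rpow_mul_rampSum_le hr0 hcard)

theorem mul_rampSum_sub_le_variationControl_sub (hr0 : 0 < r) (hr1 : r < 1) (hpq : (p : ℝ) < q)
    (hcard : ∀ n, (π n).points.card * (r ^ n) ^ p ≤ C) {s t : ℝ} (hst : s ≤ t) (n : ℕ) :
    (r ^ n) ^ q * ((π n).rampSum t - (π n).rampSum s) ≤
      variationControl π r q t - variationControl π r q s := by
  have hsummable : ∀ t, Summable fun n => (r ^ n) ^ q * (π n).rampSum t := fun t =>
    .of_norm_bounded (summable_mul_rpow_sub_pow hr0 hr1 hpq)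
      fun n => norm_rpow_mul_rampSum_le hr0 hcard n t
  rw [variationControl, variationControl, ← (hsummable t).tsum_sub (hsummable s), mul_sub]
  refine ((hsummable t).sub (hsummable s)).le_tsum n fun m _ => ?_
  rw [← mul_sub]
  exact mul_nonneg (by positivity) (sub_nonneg.2 ((π m).monotone_rampSum hst))

theorem monotone_variationControl (hr0 : 0 < r) (hr1 : r < 1) (hpq : (p : ℝ) < q)
    (hcard : ∀ n, (π n).points.card * (r ^ n) ^ p ≤ C) : Monotone (variationControl π r q) :=
  fun _ _ hst => sub_nonneg.1 (le_trans
    (mul_nonneg (by positivity) (sub_nonneg.2 ((π 0).monotone_rampSum hst)))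
    (mul_rampSum_sub_le_variationControl_sub hr0 hr1 hpq hcard hst 0))

theorem exists_forall_norm_sub_le (hS : ContinuousOn S (Icc a b)) (D : ℝ) :
    ∃ K > 0, 2 * D ≤ K ∧ ∀ s ∈ Icc a b, ∀ t ∈ Icc a b, ‖S t - S s‖ ≤ K := by
  obtain ⟨R, hR⟩ := isCompact_Icc.exists_bound_of_continuousOn hS
  refine ⟨2 * |R| + 2 * |D| + 1, by positivity, ?_, fun s hs t ht => ?_⟩
  · linarith [le_abs_self D, abs_nonneg R]
  · linarith [norm_sub_le (S t) (S s), hR s hs, hR t ht, le_abs_self R, abs_nonneg D]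

/-- An increment of size about `r ^ n` contains an interval of the partition of that scale, and
the number of these intervals is controlled. -/
theorem IsGeometricallyFine.exists_norm_sub_rpow_le (hπ : IsGeometricallyFine p π S)
    (hS : ContinuousOn S (Icc a b)) (hpq : (p : ℝ) < q) :
    ∃ H : ℝ → ℝ, Continuous H ∧ Monotone H ∧ ∀ s t, a ≤ s → s ≤ t → t ≤ b →
      ‖S t - S s‖ ^ q ≤ H t - H s := by
  obtain ⟨r, D, C, hr0, hr1, hosc, hcard⟩ := hπ
  obtain ⟨K, hK0, hDK, hSK⟩ := exists_forall_norm_sub_le hS D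
  have hq0 : 0 < q := p.cast_nonneg.trans_lt hpq
  have hmono := monotone_variationControl hr0 hr1 hpq hcard
  refine ⟨fun t => (K / r) ^ q * variationControl π r q t,
    (continuous_variationControl hr0 hr1 hpq hcard).const_mul _,
    hmono.const_mul (by positivity), fun s t hs hst ht => ?_⟩
  rw [← mul_sub]
  rcases (norm_nonneg (S t - S s)).eq_or_lt with hzero | hpos
  · rw [← hzero, Real.zero_rpow hq0.ne']
    exact mul_nonneg (by positivity) (sub_nonneg.2 (hmono hst))
  have hlt : s < t := hst.lt_of_ne fun h => hpos.ne' (by rw [h, sub_self, norm_zero])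
  have hle : ‖S t - S s‖ ≤ K := hSK s ⟨hs, hst.trans ht⟩ t ⟨hs.trans hst, ht⟩
  obtain ⟨m, hm, hm'⟩ := exists_nat_pow_near_of_lt_one (div_pos hpos hK0)
    ((div_le_one hK0).2 hle) hr0 hr1
  rw [lt_div_iff₀ hK0] at hm
  rw [div_le_iff₀ hK0] at hm'
  have hfine : 2 * (D * r ^ (m + 1)) < ‖S t - S s‖ := lt_of_le_of_lt
    (by rw [← mul_assoc, mul_comm (r ^ (m + 1))]; gcongr) hm
  obtain ⟨e, he, hse, het⟩ :=
    (π (m + 1)).exists_intervals_of_lt_norm_sub (hosc (m + 1)) hs hlt ht hfine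
  calc ‖S t - S s‖ ^ q ≤ (K / r * r ^ (m + 1)) ^ q := by
        gcongr
        exact hm'.trans_eq (by rw [pow_succ]; field_simp)
    _ = (K / r) ^ q * (r ^ (m + 1)) ^ q := Real.mul_rpow (by positivity) (by positivity)
    _ ≤ (K / r) ^ q * ((r ^ (m + 1)) ^ q *
          ((π (m + 1)).rampSum t - (π (m + 1)).rampSum s)) := by
        gcongr
        exact le_mul_of_one_le_right (by positivity) ((π (m + 1)).one_le_rampSum_sub he hse het)
    _ ≤ (K / r) ^ q * (variationControl π r q t - variationControl π r q s) := by
        gcongr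
        exact mul_rampSum_sub_le_variationControl_sub hr0 hr1 hpq hcard hst (m + 1)

end VariationControl

/-! ### Symmetric tensors and Chen's relation -/

section SymmetricTensors

variable {d k l m : ℕ}

theorem inner_eq_sum_mul {ι : Type*} [Fintype ι] (u v : EuclideanSpace ℝ ι) :
    inner ℝ u v = ∑ i, u i * v i := by
  simp only [PiLp.inner_apply, RCLike.inner_apply, conj_trivial, mul_comm]

theorem inner_tpow_tpow (u v : EuclideanSpace ℝ (Fin d)) (k : ℕ) :
    inner ℝ (tpow u k) (tpow v k) = inner ℝ u v ^ k := by
  simp only [inner_eq_sum_mul, tpow, ← Finset.prod_mul_distrib]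
  rw [← Fin.prod_const k, Finset.prod_univ_sum, Fintype.piFinset_univ]

theorem norm_tpow (v : EuclideanSpace ℝ (Fin d)) (k : ℕ) : ‖tpow v k‖ = ‖v‖ ^ k := by
  rw [← pow_left_inj₀ (norm_nonneg _) (by positivity) two_ne_zero, ← real_inner_self_eq_norm_sq,
    inner_tpow_tpow, real_inner_self_eq_norm_sq, pow_right_comm]

theorem tpow_zero_left (hk : k ≠ 0) : tpow (0 : EuclideanSpace ℝ (Fin d)) k = 0 := by
  rw [← norm_eq_zero, norm_tpow, norm_zero, zero_pow hk]

theorem isSymTens_tpow (v : EuclideanSpace ℝ (Fin d)) (k : ℕ) : IsSymTens (tpow v k) :=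
  fun σ i => Equiv.prod_comp σ fun j => v (i j)

theorem IsSymTens.sub {A B : Tens d k} (hA : IsSymTens A) (hB : IsSymTens B) :
    IsSymTens (A - B) := fun σ i => by
  simp only [PiLp.sub_apply, hA σ i, hB σ i]

theorem IsSymTens.smul {A : Tens d k} (c : ℝ) (hA : IsSymTens A) : IsSymTens (c • A) :=
  fun σ i => by simp only [PiLp.smul_apply, hA σ i]

theorem inv_factorial_mul_sum_perm_const (k : ℕ) (x : ℝ) :
    (k.factorial : ℝ)⁻¹ * ∑ _σ : Equiv.Perm (Fin k), x = x := by
  rw [Finset.sum_const, Finset.card_univ, Fintype.card_perm, Fintype.card_fin, nsmul_eq_mul,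
    inv_mul_cancel_left₀ (by positivity)]

theorem tsym_eq_self {A : Tens d k} (hA : IsSymTens A) : tsym A = A := by
  ext i
  simp only [tsym, fun σ => hA σ i, inv_factorial_mul_sum_perm_const]

theorem tsym_sub (A B : Tens d k) : tsym (A - B) = tsym A - tsym B := by
  ext i
  simp only [tsym, PiLp.sub_apply, Finset.sum_sub_distrib, mul_sub]

theorem IsSymTens.sum_mul_comp_perm {Y : Tens d k} (hY : IsSymTens Y) (A : Tens d k)
    (σ : Equiv.Perm (Fin k)) : ∑ i, Y i * A (fun j => i (σ j)) = ∑ i, Y i * A i := by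
  rw [← Equiv.sum_comp (σ.symm.arrowCongr (Equiv.refl (Fin d))) fun i => Y i * A i]
  exact Finset.sum_congr rfl fun i _ => congrArg (· * A fun j => i (σ j)) (hY σ i).symm

theorem inner_tsym {Y : Tens d k} (hY : IsSymTens Y) (A : Tens d k) :
    inner ℝ Y (tsym A) = inner ℝ Y A := by
  calc inner ℝ Y (tsym A)
      = (k.factorial : ℝ)⁻¹ * ∑ i, Y i * ∑ σ : Equiv.Perm (Fin k), A (fun j => i (σ j)) := by
        rw [inner_eq_sum_mul, Finset.mul_sum]
        exact Finset.sum_congr rfl fun i _ => mul_left_comm _ _ _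
    _ = (k.factorial : ℝ)⁻¹ * ∑ _σ : Equiv.Perm (Fin k), ∑ i, Y i * A i := by
        congr 1
        simp only [Finset.mul_sum]
        rw [Finset.sum_comm]
        simp only [hY.sum_mul_comp_perm A]
    _ = inner ℝ Y A := by rw [inv_factorial_mul_sum_perm_const, inner_eq_sum_mul]

theorem inner_contract {a b : ℕ} (A : Tens d a) (Y : Tens d (a + b)) (B : Tens d b) :
    inner ℝ (contract A Y) B = inner ℝ Y (tmul rfl A B) := by
  rw [inner_eq_sum_mul, inner_eq_sum_mul, ← (Fin.appendEquiv a b).sum_comp,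
    Fintype.sum_prod_type, Finset.sum_comm]
  simp only [contract, tmul, Finset.sum_mul, Fin.appendEquiv, Equiv.coe_fn_mk, Fin.cast_eq_self,
    Fin.append_left, Fin.append_right]
  refine Finset.sum_congr rfl fun j _ => Finset.sum_congr rfl fun i _ => ?_
  ring

theorem tmul_sub_left (h : l + m = k) (A A' : Tens d l) (B : Tens d m) :
    tmul h (A - A') B = tmul h A B - tmul h A' B := by
  ext i
  simp only [tmul, PiLp.sub_apply, sub_mul]

theorem tmul_sub_right (h : l + m = k) (A : Tens d l) (B B' : Tens d m) :
    tmul h A (B - B') = tmul h A B - tmul h A B' := by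
  ext i
  simp only [tmul, PiLp.sub_apply, mul_sub]

theorem tmul_of_forall_eq_one_right (h : k + 0 = k) (A : Tens d k) {B : Tens d 0}
    (hB : ∀ i, B i = 1) : tmul h A B = A := by
  ext i
  simp only [tmul, hB, mul_one]
  rfl

theorem tmul_of_forall_eq_one_left (h : 0 + k = k) {A : Tens d 0} (B : Tens d k)
    (hA : ∀ i, A i = 1) : tmul h A B = B := by
  ext i
  simp only [tmul, hA, one_mul, Fin.natAdd_zero, Fin.cast_cast, Fin.cast_eq_self]

theorem exists_perm_mem_iff_mem {ι : Type*} [Finite ι] {A B : Finset ι} (h : A.card = B.card) :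
    ∃ τ : Equiv.Perm ι, ∀ j, τ j ∈ B ↔ j ∈ A := by
  classical
  let e : {x // x ∈ A} ≃ {x // x ∈ B} := Finset.equivOfCardEq h
  exact ⟨e.extendSubtype, fun j =>
    ⟨fun hj => not_imp_not.1 (e.extendSubtype_not_mem j) hj, e.extendSubtype_mem j⟩⟩

section SymProd

variable {ι R : Type*} [Fintype ι] [DecidableEq ι] [CommSemiring R]

/-- The symmetrised product of two families of factors, those of the first family standing at the
positions in `A`; the sum over all permutations is not normalised. -/
def symProd (a b : ι → R) (A : Finset ι) : R :=
  ∑ σ : Equiv.Perm ι, ∏ j, if j ∈ A then a (σ j) else b (σ j)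

theorem symProd_congr (a b : ι → R) {A B : Finset ι} (h : A.card = B.card) :
    symProd a b A = symProd a b B := by
  obtain ⟨τ, hτ⟩ := exists_perm_mem_iff_mem h
  rw [symProd, symProd, ← Equiv.sum_comp (Equiv.mulRight τ)]
  refine Finset.sum_congr rfl fun σ _ => ?_
  rw [← Equiv.prod_comp τ fun j => if j ∈ B then a (σ j) else b (σ j)]
  simp only [hτ, Equiv.coe_mulRight, Equiv.Perm.coe_mul, Function.comp_apply]

theorem factorial_mul_prod_add (a b : ι → R) :
    ((Fintype.card ι).factorial : R) * ∏ j, (a j + b j) =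
      ∑ A ∈ (Finset.univ : Finset ι).powerset, symProd a b A := by
  have hexpand : ∀ σ : Equiv.Perm ι, ∏ j, (a j + b j) =
      ∑ A ∈ (Finset.univ : Finset ι).powerset, ∏ j, if j ∈ A then a (σ j) else b (σ j) := by
    intro σ
    rw [← Equiv.prod_comp σ, Finset.prod_add]
    refine Finset.sum_congr rfl fun A _ => ?_
    rw [Finset.prod_ite, Finset.filter_univ_mem, Finset.filter_not, Finset.filter_univ_mem]
  calc ((Fintype.card ι).factorial : R) * ∏ j, (a j + b j)
      = ∑ _σ : Equiv.Perm ι, ∏ j, (a j + b j) := by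
        rw [Finset.sum_const, Finset.card_univ, Fintype.card_perm, nsmul_eq_mul]
    _ = ∑ A ∈ (Finset.univ : Finset ι).powerset, symProd a b A := by
        rw [Finset.sum_congr rfl fun σ _ => hexpand σ, Finset.sum_comm]
        rfl

theorem factorial_mul_prod_add_eq_sum_choose (a b : ι → R) {A : ℕ → Finset ι}
    (hA : ∀ l ≤ Fintype.card ι, (A l).card = l) :
    ((Fintype.card ι).factorial : R) * ∏ j, (a j + b j) =
      ∑ l ∈ Finset.range (Fintype.card ι + 1),
        ((Fintype.card ι).choose l : R) * symProd a b (A l) := by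
  rw [factorial_mul_prod_add, Finset.sum_powerset, Finset.card_univ]
  refine Finset.sum_congr rfl fun l hl => ?_
  rw [Finset.sum_congr rfl fun B hB => symProd_congr a b ((Finset.mem_powersetCard.1 hB).2.trans
    (hA l (Finset.mem_range_succ_iff.1 hl)).symm), Finset.sum_const, Finset.card_powersetCard,
    Finset.card_univ, nsmul_eq_mul]

end SymProd

theorem tsym_tmul_tpow_apply (h : l + m = k) (a b : EuclideanSpace ℝ (Fin d)) (i : Fin k → Fin d) :
    tsym (tmul h ((l.factorial : ℝ)⁻¹ • tpow a l) ((m.factorial : ℝ)⁻¹ • tpow b m)) i =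
      (k.factorial : ℝ)⁻¹ * ((l.factorial : ℝ)⁻¹ * (m.factorial : ℝ)⁻¹ *
        symProd (fun j => a (i j)) (fun j => b (i j)) {j | (j : ℕ) < l}) := by
  subst h
  simp only [tsym, tmul, tpow, PiLp.smul_apply, smul_eq_mul, symProd, Finset.mul_sum]
  refine Finset.sum_congr rfl fun σ _ => ?_
  simp only [Fin.prod_univ_add, Finset.mem_filter_univ, Fin.val_castAdd, Fin.val_natAdd,
    Fin.is_lt, not_lt.2 (Nat.le_add_right l _), if_true, if_false, Fin.cast_eq_self]
  ring

theorem inv_factorial_smul_tpow_add (a b : EuclideanSpace ℝ (Fin d)) (k : ℕ) :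
    (k.factorial : ℝ)⁻¹ • tpow (a + b) k =
      ∑ x : Finset.HasAntidiagonal.antidiagonal k,
        tsym (tmul (Finset.HasAntidiagonal.mem_antidiagonal.1 x.2)
          ((x.1.1.factorial : ℝ)⁻¹ • tpow a x.1.1) ((x.1.2.factorial : ℝ)⁻¹ • tpow b x.1.2)) := by
  ext i
  have hcard : ∀ l ≤ Fintype.card (Fin k),
      (Finset.univ.filter fun j : Fin k => (j : ℕ) < l).card = l := fun l hl => by
    rw [Fin.card_filter_val_lt, min_eq_right (Fintype.card_fin k ▸ hl)]
  have hprod := factorial_mul_prod_add_eq_sum_choose (fun j => a (i j)) (fun j => b (i j)) hcard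
  simp only [Fintype.card_fin] at hprod
  simp only [WithLp.ofLp_sum, Finset.sum_apply, tsym_tmul_tpow_apply]
  rw [Finset.sum_coe_sort (Finset.HasAntidiagonal.antidiagonal k) fun x => (k.factorial : ℝ)⁻¹ *
      ((x.1.factorial : ℝ)⁻¹ * (x.2.factorial : ℝ)⁻¹ *
        symProd (fun j => a (i j)) (fun j => b (i j)) {j | (j : ℕ) < x.1}),
    Finset.Nat.sum_antidiagonal_eq_sum_range_succ_mk, ← Finset.mul_sum]
  simp only [tpow, PiLp.smul_apply, PiLp.add_apply, smul_eq_mul]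
  congr 1
  have hk : (k.factorial : ℝ) ≠ 0 := by positivity
  rw [← mul_right_inj' hk, hprod, Finset.mul_sum]
  refine Finset.sum_congr rfl fun l hl => ?_
  rw [Nat.cast_choose ℝ (Finset.mem_range_succ_iff.1 hl)]
  field_simp

end SymmetricTensors

/-! ### Lifts and germs -/

section Lift

variable {d p k l m : ℕ} {q T : ℝ}

section Control

variable {c : ℝ → ℝ → ℝ} {H : ℝ → ℝ}

theorem isControl_sub (hc : ContinuousOn H (Icc 0 T)) (hm : MonotoneOn H (Icc 0 T)) :
    IsControl T fun s t => H t - H s where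
  cont := ContinuousOn.sub (hc.comp continuousOn_snd fun _ h => ⟨h.1.trans h.2.1, h.2.2⟩)
    (hc.comp continuousOn_fst fun _ h => ⟨h.1, h.2.1.trans h.2.2⟩)
  nonneg s t hs hst ht := sub_nonneg.2 (hm ⟨hs, hst.trans ht⟩ ⟨hs.trans hst, ht⟩ hst)
  diag t _ := sub_self _
  superadd s u t _ _ _ _ := by linarith

theorem IsControl.exists_monotoneOn (hc : IsControl T c) :
    ∃ H : ℝ → ℝ, ContinuousOn H (Icc 0 T) ∧ MonotoneOn H (Icc 0 T) ∧
      ∀ s t, 0 ≤ s → s ≤ t → t ≤ T → c s t ≤ H t - H s := by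
  have hsuper : ∀ s t, 0 ≤ s → s ≤ t → t ≤ T → c s t ≤ c 0 t - c 0 s := fun s t hs hst ht => by
    linarith [hc.superadd 0 s t le_rfl hs hst ht]
  refine ⟨c 0, ?_, fun s hs t ht hst => ?_, hsuper⟩
  · exact hc.cont.comp (f := fun t : ℝ => ((0 : ℝ), t)) (by fun_prop)
      fun t ht => ⟨le_rfl, ht.1, ht.2⟩
  · exact sub_nonneg.1 ((hc.nonneg s t hs.1 hst ht.2).trans (hsuper s t hs.1 hst ht.2))

end Control

section ReducedLift

variable {S : ℝ → EuclideanSpace ℝ (Fin d)} {V : ℝ → Tens d p}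

/-- The correction subtracted from the tensor power in `reducedLift`: the increment of `V` divided
by `p!`, seen as a `k`-tensor which vanishes for `k ≠ p`. -/
noncomputable def variationIncrement (V : ℝ → Tens d p) (k : ℕ) (s t : ℝ) : Tens d k :=
  if h : k = p then
    (k.factorial : ℝ)⁻¹ • (WithLp.toLp 2 fun i => (V t - V s) (fun j => i (Fin.cast h.symm j)))
  else 0

theorem variationIncrement_self (V : ℝ → Tens d p) (s t : ℝ) :
    variationIncrement V p s t = (p.factorial : ℝ)⁻¹ • (V t - V s) := by
  rw [variationIncrement, dif_pos rfl]
  rfl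

theorem variationIncrement_of_ne (V : ℝ → Tens d p) (h : k ≠ p) (s t : ℝ) :
    variationIncrement V k s t = 0 := dif_neg h

theorem variationIncrement_add (V : ℝ → Tens d p) (k : ℕ) (s u t : ℝ) :
    variationIncrement V k s u + variationIncrement V k u t = variationIncrement V k s t := by
  by_cases h : k = p
  · subst h
    simp only [variationIncrement_self, ← smul_add, sub_add_sub_cancel']
  · simp only [variationIncrement_of_ne V h, add_zero]

theorem isSymTens_variationIncrement (hV : ∀ t, IsSymTens (V t)) (k : ℕ) (s t : ℝ) :
    IsSymTens (variationIncrement V k s t) := by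
  by_cases h : k = p
  · subst h
    rw [variationIncrement_self]
    exact ((hV t).sub (hV s)).smul _
  · rw [variationIncrement_of_ne V h]
    exact fun _ _ => rfl

theorem reducedLift_eq_sub (S : ℝ → EuclideanSpace ℝ (Fin d)) (V : ℝ → Tens d p) (k : ℕ)
    (s t : ℝ) : reducedLift S V k s t =
      (k.factorial : ℝ)⁻¹ • tpow (S t - S s) k - variationIncrement V k s t := rfl

theorem reducedLift_of_ne (S : ℝ → EuclideanSpace ℝ (Fin d)) (V : ℝ → Tens d p) (h : k ≠ p)
    (s t : ℝ) : reducedLift S V k s t = (k.factorial : ℝ)⁻¹ • tpow (S t - S s) k := by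
  rw [reducedLift_eq_sub, variationIncrement_of_ne V h, sub_zero]

theorem inv_factorial_smul_tpow_zero (v : EuclideanSpace ℝ (Fin d)) (i : Fin 0 → Fin d) :
    ((Nat.factorial 0 : ℝ)⁻¹ • tpow v 0) i = 1 := by
  simp [tpow]

theorem reducedLift_zero (hp0 : 0 < p) (s t : ℝ) (i : Fin 0 → Fin d) :
    reducedLift S V 0 s t i = 1 := by
  rw [reducedLift_of_ne S V hp0.ne, inv_factorial_smul_tpow_zero]

theorem isSymTens_reducedLift (hV : ∀ t, IsSymTens (V t)) (k : ℕ) (s t : ℝ) :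
    IsSymTens (reducedLift S V k s t) :=
  ((isSymTens_tpow _ _).smul _).sub (isSymTens_variationIncrement hV k s t)

/-- Products of two corrections have order at least `2 p` and do not occur. -/
theorem tsym_tmul_reducedLift (hp0 : 0 < p) (hV : ∀ t, IsSymTens (V t)) (h : l + m = k)
    (hk : k ≤ p) (s u t : ℝ) :
    tsym (tmul h (reducedLift S V l s u) (reducedLift S V m u t)) =
      tsym (tmul h ((l.factorial : ℝ)⁻¹ • tpow (S u - S s) l)
        ((m.factorial : ℝ)⁻¹ • tpow (S t - S u) m)) -
      (if m = 0 then variationIncrement V k s u else 0) -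
      (if l = 0 then variationIncrement V k u t else 0) := by
  by_cases hl : l = p
  · obtain rfl : m = 0 := by omega
    obtain rfl : l = k := by omega
    rw [reducedLift_of_ne S V hp0.ne, reducedLift_eq_sub, tmul_sub_left, tsym_sub,
      tmul_of_forall_eq_one_right h (variationIncrement V l s u) (inv_factorial_smul_tpow_zero _),
      tsym_eq_self (isSymTens_variationIncrement hV _ _ _), if_pos rfl, if_neg (by omega),
      sub_zero]
  rw [reducedLift_of_ne S V hl]
  by_cases hm : m = p
  · obtain rfl : l = 0 := by omega
    obtain rfl : m = k := by omega
    rw [reducedLift_eq_sub, tmul_sub_right, tsym_sub,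
      tmul_of_forall_eq_one_left h (variationIncrement V m u t) (inv_factorial_smul_tpow_zero _),
      tsym_eq_self (isSymTens_variationIncrement hV _ _ _), if_pos rfl, if_neg (by omega),
      sub_zero]
  · rw [reducedLift_of_ne S V hm,
      ite_eq_right_iff.2 fun hm0 => variationIncrement_of_ne V (by omega) s u,
      ite_eq_right_iff.2 fun hl0 => variationIncrement_of_ne V (by omega) u t, sub_zero, sub_zero]

theorem chen_reducedLift (hp0 : 0 < p) (hV : ∀ t, IsSymTens (V t)) (hk : k ≤ p) (s u t : ℝ) :
    reducedLift S V k s t = ∑ x : Finset.HasAntidiagonal.antidiagonal k,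
      tsym (tmul (Finset.HasAntidiagonal.mem_antidiagonal.1 x.2)
        (reducedLift S V x.1.1 s u) (reducedLift S V x.1.2 u t)) := by
  have hright : ∑ x ∈ Finset.HasAntidiagonal.antidiagonal k,
      (if x.2 = 0 then variationIncrement V k s u else 0) = variationIncrement V k s u := by
    rw [← Finset.sum_filter, Finset.HasAntidiagonal.filter_snd_eq_antidiagonal k 0,
      if_pos k.zero_le, Finset.sum_singleton]
  have hleft : ∑ x ∈ Finset.HasAntidiagonal.antidiagonal k,
      (if x.1 = 0 then variationIncrement V k u t else 0) = variationIncrement V k u t := by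
    rw [← Finset.sum_filter, Finset.HasAntidiagonal.filter_fst_eq_antidiagonal k 0,
      if_pos k.zero_le, Finset.sum_singleton]
  rw [Finset.sum_congr rfl fun x _ => tsym_tmul_reducedLift hp0 hV
    (Finset.HasAntidiagonal.mem_antidiagonal.1 x.2) hk s u t, Finset.sum_sub_distrib,
    Finset.sum_sub_distrib, ← inv_factorial_smul_tpow_add,
    Finset.sum_coe_sort (Finset.HasAntidiagonal.antidiagonal k)
      (fun x => if x.2 = 0 then variationIncrement V k s u else 0),
    Finset.sum_coe_sort (Finset.HasAntidiagonal.antidiagonal k)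
      (fun x => if x.1 = 0 then variationIncrement V k u t else 0),
    hright, hleft, sub_sub, variationIncrement_add, reducedLift_eq_sub, sub_add_sub_cancel']

theorem norm_inv_factorial_smul_le {F : Type*} [SeminormedAddCommGroup F] [NormedSpace ℝ F]
    (k : ℕ) (x : F) : ‖(k.factorial : ℝ)⁻¹ • x‖ ≤ ‖x‖ := by
  rw [norm_smul, Real.norm_of_nonneg (by positivity)]
  refine mul_le_of_le_one_left (norm_nonneg _) (inv_le_one_of_one_le₀ ?_)
  exact_mod_cast k.factorial_pos

theorem norm_inv_factorial_smul_tpow_rpow_le (hq : 0 ≤ q) (hk : 1 ≤ k)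
    (v : EuclideanSpace ℝ (Fin d)) : ‖(k.factorial : ℝ)⁻¹ • tpow v k‖ ^ (q / k) ≤ ‖v‖ ^ q := by
  have hk0 : (k : ℝ) ≠ 0 := by positivity
  calc ‖(k.factorial : ℝ)⁻¹ • tpow v k‖ ^ (q / k) ≤ (‖v‖ ^ k) ^ (q / k) := by
        gcongr
        exact (norm_inv_factorial_smul_le k _).trans_eq (norm_tpow v k)
    _ = ‖v‖ ^ q := by
        rw [← Real.rpow_natCast, ← Real.rpow_mul (norm_nonneg _), mul_div_cancel₀ _ hk0]

theorem norm_variationIncrement_rpow_le {θ h M : ℝ} (hθ : 1 < θ) (hh : 0 ≤ h) (hhM : h ≤ M)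
    {s t : ℝ} (hV : ‖V t - V s‖ ≤ h) (k : ℕ) :
    ‖variationIncrement V k s t‖ ^ θ ≤ M ^ (θ - 1) * h := by
  by_cases hkp : k = p
  · subst hkp
    rw [variationIncrement_self]
    calc ‖(k.factorial : ℝ)⁻¹ • (V t - V s)‖ ^ θ ≤ h ^ θ := by
          gcongr
          exact (norm_inv_factorial_smul_le k _).trans hV
      _ ≤ M ^ (θ - 1) * h := rpow_le_rpow_sub_one_mul hh hhM hθ
  · rw [variationIncrement_of_ne V hkp, norm_zero, Real.zero_rpow (by linarith)]
    exact mul_nonneg (Real.rpow_nonneg (hh.trans hhM) _) hh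

theorem norm_reducedLift_rpow_le (hpq : (p : ℝ) < q) {h M : ℝ} (hh : 0 ≤ h) (hhM : h ≤ M)
    {s t : ℝ} (hS : ‖S t - S s‖ ^ q ≤ h) (hV : ‖V t - V s‖ ≤ h) (hk : 1 ≤ k) (hkp : k ≤ p) :
    ‖reducedLift S V k s t‖ ^ (q / k) ≤ 2 ^ (q / k - 1) * (1 + M ^ (q / k - 1)) * h := by
  have hk0 : (0 : ℝ) < k := by exact_mod_cast hk
  have hkq : (k : ℝ) < q := hpq.trans_le' (by exact_mod_cast hkp)
  have hθ : 1 < q / k := (one_lt_div hk0).2 hkq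
  rw [reducedLift_eq_sub]
  set A := (k.factorial : ℝ)⁻¹ • tpow (S t - S s) k
  set B := variationIncrement V k s t
  calc ‖A - B‖ ^ (q / k) ≤ (‖A‖ + ‖B‖) ^ (q / k) := by
        gcongr
        exact norm_sub_le A B
    _ ≤ 2 ^ (q / k - 1) * (‖A‖ ^ (q / k) + ‖B‖ ^ (q / k)) := by
        exact_mod_cast NNReal.rpow_add_le_mul_rpow_add_rpow ‖A‖₊ ‖B‖₊ hθ.le
    _ ≤ 2 ^ (q / k - 1) * (h + M ^ (q / k - 1) * h) := by
        gcongr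
        · exact (norm_inv_factorial_smul_tpow_rpow_le (hk0.trans hkq).le hk _).trans hS
        · exact norm_variationIncrement_rpow_le hθ hh hhM hV k
    _ = 2 ^ (q / k - 1) * (1 + M ^ (q / k - 1)) * h := by ring

theorem isReducedRoughPath_reducedLift (hp0 : 0 < p) (hpq : (p : ℝ) < q) (hq : ⌊q⌋₊ = p)
    (hV : ∀ t, IsSymTens (V t)) {H : ℝ → ℝ} (hHc : ContinuousOn H (Icc 0 T))
    (hHm : MonotoneOn H (Icc 0 T))
    (hSH : ∀ s t, 0 ≤ s → s ≤ t → t ≤ T → ‖S t - S s‖ ^ q ≤ H t - H s)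
    (hVH : ∀ s t, 0 ≤ s → s ≤ t → t ≤ T → ‖V t - V s‖ ≤ H t - H s) :
    IsReducedRoughPath q T (reducedLift S V) where
  zero s t _ _ _ := reducedLift_zero hp0 s t
  symm k _ s t _ _ _ := isSymTens_reducedLift hV k s t
  chen k hk s u t _ _ _ _ := chen_reducedLift hp0 hV (hk.trans hq.le) s u t
  bound := by
    let M := |H T - H 0|
    let K := ∑ k ∈ Finset.Icc 1 ⌊q⌋₊, (2 : ℝ) ^ (q / k - 1) * (1 + M ^ (q / k - 1))
    have hK0 : 0 ≤ K := Finset.sum_nonneg fun k _ => by positivity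
    refine ⟨fun s t => K * H t - K * H s, isControl_sub (continuousOn_const.mul hHc)
      fun s hs t ht hst => mul_le_mul_of_nonneg_left (hHm hs ht hst) hK0, ?_⟩
    intro s t hs hst ht
    have hsm : s ∈ Icc 0 T := ⟨hs, hst.trans ht⟩
    have htm : t ∈ Icc 0 T := ⟨hs.trans hst, ht⟩
    have hle : H t - H s ≤ M := (sub_le_sub (hHm htm ⟨htm.1.trans ht, le_rfl⟩ ht)
      (hHm ⟨le_rfl, htm.1.trans ht⟩ hsm hs)).trans (le_abs_self _)
    change _ ≤ K * H t - K * H s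
    rw [← mul_sub, Finset.sum_mul]
    refine Finset.sum_le_sum fun k hk => ?_
    obtain ⟨hk1, hkp⟩ := Finset.mem_Icc.1 hk
    exact norm_reducedLift_rpow_le hpq (sub_nonneg.2 (hHm hsm htm hst)) hle (hSH s t hs hst ht)
      (hVH s t hs hst ht) hk1 (hkp.trans hq.le)

end ReducedLift

section CompensatedGerm

variable {N : ℕ} {X : (k : ℕ) → ℝ → ℝ → Tens d k} {Y : (k : ℕ) → ℝ → Tens d k} {s u t : ℝ}

/-- The summand `∑_{k = 1}^N ⟨Y^k(s), 𝕏^k_{s,t}⟩` of the compensated Riemann sums that define the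
rough path integral of order `N`. -/
noncomputable def compensatedGerm (N : ℕ) (X : (k : ℕ) → ℝ → ℝ → Tens d k)
    (Y : (k : ℕ) → ℝ → Tens d k) (s t : ℝ) : ℝ :=
  ∑ k ∈ Finset.Icc 1 N, inner ℝ (Y k s) (X k s t)

/-- The remainder of order `l` in the definition of a controlled path. -/
noncomputable def controlledRemainder (N : ℕ) (X : (k : ℕ) → ℝ → ℝ → Tens d k)
    (Y : (k : ℕ) → ℝ → Tens d k) (l : ℕ) (s t : ℝ) : Tens d l :=
  Y l t - ∑ m ∈ Finset.range (N - l + 1), contract (X m s t) (Y (m + l) s)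

theorem inner_tsym_tmul (h : l + m = k) {Y : (k : ℕ) → Tens d k} (hY : IsSymTens (Y k))
    (A : Tens d l) (B : Tens d m) :
    inner ℝ (Y k) (tsym (tmul h A B)) = inner ℝ (contract A (Y (l + m))) B := by
  subst h
  rw [inner_tsym hY, inner_contract]

theorem IsReducedRoughPath.inner_eq_add_sum_contract (hX : IsReducedRoughPath q T X)
    {Y : (k : ℕ) → Tens d k} (hk : k ≤ ⌊q⌋₊) (hY : IsSymTens (Y k)) (hs : 0 ≤ s) (hsu : s ≤ u)
    (hut : u ≤ t) (ht : t ≤ T) :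
    inner ℝ (Y k) (X k s t) = inner ℝ (Y k) (X k s u) +
      ∑ l ∈ Finset.Icc 1 k, inner ℝ (contract (X (k - l) s u) (Y (k - l + l))) (X l u t) := by
  have hzero : inner ℝ (contract (X k s u) (Y (k + 0))) (X 0 u t) =
      inner ℝ (Y k) (X k s u) := by
    rw [inner_contract,
      tmul_of_forall_eq_one_right rfl (X k s u) (hX.zero u t (hs.trans hsu) hut ht)]
    rfl
  rw [hX.chen k hk s u t hs hsu hut ht, inner_sum, Finset.sum_congr rfl fun x _ =>
      inner_tsym_tmul (Finset.HasAntidiagonal.mem_antidiagonal.1 x.2) hY _ _,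
    Finset.sum_coe_sort (Finset.HasAntidiagonal.antidiagonal k)
      (fun x => inner ℝ (contract (X x.1 s u) (Y (x.1 + x.2))) (X x.2 u t)),
    ← Finset.Nat.sum_antidiagonal_swap, Finset.Nat.sum_antidiagonal_eq_sum_range_succ_mk,
    Finset.sum_range_succ']
  simp only [Prod.swap, Nat.sub_zero, hzero]
  rw [add_comm, Finset.range_eq_Ico, Finset.sum_Ico_add'
    (fun l => inner ℝ (contract (X (k - l) s u) (Y (k - l + l))) (X l u t)) 0 k 1]
  rfl

theorem sum_Icc_sum_Icc_sub {M : Type*} [AddCommMonoid M] (N : ℕ) (g : ℕ → ℕ → M) :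
    ∑ k ∈ Finset.Icc 1 N, ∑ l ∈ Finset.Icc 1 k, g (k - l) l =
      ∑ l ∈ Finset.Icc 1 N, ∑ m ∈ Finset.range (N - l + 1), g m l := by
  rw [Finset.sum_comm' (s' := fun l => Finset.Ico l (N + 1)) (t' := Finset.Icc 1 N) (by
    intro k l; simp only [Finset.mem_Icc, Finset.mem_Ico]; omega)]
  refine Finset.sum_congr rfl fun l hl => ?_
  rw [Finset.sum_Ico_eq_sum_range, Nat.sub_add_comm (Finset.mem_Icc.1 hl).2]
  simp only [Nat.add_sub_cancel_left]

theorem IsReducedRoughPath.compensatedGerm_sub_sub (hX : IsReducedRoughPath q T X)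
    (hY : ∀ k ≤ ⌊q⌋₊, IsSymTens (Y k s)) (hs : 0 ≤ s) (hsu : s ≤ u) (hut : u ≤ t) (ht : t ≤ T) :
    compensatedGerm ⌊q⌋₊ X Y s t - compensatedGerm ⌊q⌋₊ X Y s u - compensatedGerm ⌊q⌋₊ X Y u t =
      -∑ l ∈ Finset.Icc 1 ⌊q⌋₊, inner ℝ (controlledRemainder ⌊q⌋₊ X Y l s u) (X l u t) := by
  have hchen : compensatedGerm ⌊q⌋₊ X Y s t = compensatedGerm ⌊q⌋₊ X Y s u +
      ∑ l ∈ Finset.Icc 1 ⌊q⌋₊, ∑ m ∈ Finset.range (⌊q⌋₊ - l + 1),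
        inner ℝ (contract (X m s u) (Y (m + l) s)) (X l u t) := by
    rw [compensatedGerm, compensatedGerm, Finset.sum_congr rfl fun k hk =>
      hX.inner_eq_add_sum_contract (Y := fun k => Y k s) (Finset.mem_Icc.1 hk).2
        (hY k (Finset.mem_Icc.1 hk).2) hs hsu hut ht, Finset.sum_add_distrib]
    exact congrArg (_ + ·) (sum_Icc_sum_Icc_sub ⌊q⌋₊ fun m l =>
      inner ℝ (contract (X m s u) (Y (m + l) s)) (X l u t))
  rw [hchen]
  simp only [compensatedGerm, controlledRemainder, inner_sub_left, sum_inner,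
    Finset.sum_sub_distrib]
  ring

theorem le_rpow_of_sum_rpow_div_le {ι : Type*} {I : Finset ι} {x w : ι → ℝ} {q ω : ℝ}
    (hx : ∀ i ∈ I, 0 ≤ x i) (hq : 0 < q) (h : ∑ i ∈ I, x i ^ (q / w i) ≤ ω) {i : ι} (hi : i ∈ I)
    (hw : 0 < w i) : x i ≤ ω ^ (w i / q) := by
  have hle : x i ^ (q / w i) ≤ ω :=
    (Finset.single_le_sum (fun j hj => Real.rpow_nonneg (hx j hj) (q / w j)) hi).trans h
  calc x i = (x i ^ (q / w i)) ^ (w i / q) := by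
        rw [← Real.rpow_mul (hx i hi), div_mul_div_cancel₀ hw.ne', div_self hq.ne',
          Real.rpow_one]
    _ ≤ ω ^ (w i / q) := Real.rpow_le_rpow (Real.rpow_nonneg (hx i hi) _) hle (by positivity)

theorem abs_inner_controlledRemainder_le (hq : 0 < q) {ω : ℝ} (hω : 0 ≤ ω)
    (hX : ∑ k ∈ Finset.Icc 1 N, ‖X k u t‖ ^ (q / k) ≤ ω)
    (hY : ∑ l ∈ Finset.Icc 1 N, ‖controlledRemainder N X Y l s u‖ ^ (q / ((N : ℝ) - l + 1)) ≤ ω)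
    (hl : l ∈ Finset.Icc 1 N) :
    |inner ℝ (controlledRemainder N X Y l s u) (X l u t)| ≤ ω ^ ((N + 1 : ℝ) / q) := by
  obtain ⟨hl1, hlN⟩ := Finset.mem_Icc.1 hl
  have hl0 : (0 : ℝ) < l := by exact_mod_cast hl1
  have hNl : (0 : ℝ) < (N : ℝ) - l + 1 := by
    have : (l : ℝ) ≤ N := by exact_mod_cast hlN
    linarith
  calc |inner ℝ (controlledRemainder N X Y l s u) (X l u t)|
      ≤ ‖controlledRemainder N X Y l s u‖ * ‖X l u t‖ := abs_real_inner_le_norm _ _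
    _ ≤ ω ^ (((N : ℝ) - l + 1) / q) * ω ^ (l / q : ℝ) := by
        gcongr
        · exact le_rpow_of_sum_rpow_div_le (x := fun l => ‖controlledRemainder N X Y l s u‖)
            (w := fun l => (N : ℝ) - l + 1) (fun _ _ => norm_nonneg _) hq hY hl hNl
        · exact le_rpow_of_sum_rpow_div_le (x := fun k => ‖X k u t‖) (w := fun k => (k : ℝ))
            (fun _ _ => norm_nonneg _) hq hX hl hl0
    _ = ω ^ ((N + 1 : ℝ) / q) := by
        rw [← Real.rpow_add_of_nonneg hω (by positivity) (by positivity), ← add_div]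
        congr 2
        ring

theorem IsControlled.exists_almostAdditive_compensatedGerm (hq : 0 < q)
    (hX : IsReducedRoughPath q T X) (hY : IsControlled q T X Y) :
    ∃ H : ℝ → ℝ, ContinuousOn H (Icc 0 T) ∧ MonotoneOn H (Icc 0 T) ∧
      AlmostAdditive 0 T ⌊q⌋₊ ((⌊q⌋₊ + 1 : ℝ) / q) H (compensatedGerm ⌊q⌋₊ X Y) := by
  obtain ⟨c₁, hc₁, hX_le⟩ := hX.bound
  obtain ⟨c₂, hc₂, hY_le⟩ := hY.bound
  obtain ⟨H₁, hcont₁, hmono₁, hH₁⟩ := hc₁.exists_monotoneOn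
  obtain ⟨H₂, hcont₂, hmono₂, hH₂⟩ := hc₂.exists_monotoneOn
  refine ⟨fun t => H₁ t + H₂ t, hcont₁.add hcont₂, hmono₁.add hmono₂, ?_⟩
  intro s u t hs hsu hut ht
  have hsm : s ∈ Icc 0 T := ⟨hs, hsu.trans (hut.trans ht)⟩
  have hum : u ∈ Icc 0 T := ⟨hs.trans hsu, hut.trans ht⟩
  have htm : t ∈ Icc 0 T := ⟨hum.1.trans hut, ht⟩
  have hincr₁ := And.intro (hmono₁ hsm hum hsu) (hmono₁ hum htm hut)
  have hincr₂ := And.intro (hmono₂ hsm hum hsu) (hmono₂ hum htm hut)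
  rw [hX.compensatedGerm_sub_sub (fun k hk => hY.symm k hk s hsm) hs hsu hut ht, norm_neg]
  refine (norm_sum_le_of_le _ fun l hl => abs_inner_controlledRemainder_le hq
    (ω := H₁ t + H₂ t - (H₁ s + H₂ s)) ?_ ?_ ?_ hl).trans_eq ?_
  · linarith
  · linarith [hX_le u t hum.1 hut ht, hH₁ u t hum.1 hut ht]
  · have hYsu := (hY_le s u hs hsu hum.2).trans (hH₂ s u hs hsu hum.2)
    exact hYsu.trans (by linarith)
  · rw [Finset.sum_const, Nat.card_Icc, Nat.add_sub_cancel, nsmul_eq_mul]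

end CompensatedGerm

end Lift

/-! ### Iterated derivatives as tensors -/

section IteratedDerivative

variable {E F : Type*} [NormedAddCommGroup E] [NormedSpace ℝ E] [NormedAddCommGroup F]
  [NormedSpace ℝ F] {f : E → F} {n : ℕ}

theorem iteratedFDeriv_add_two_apply (f : E → F) (x : E) (v : Fin (n + 2) → E) :
    iteratedFDeriv ℝ (n + 2) f x v =
      fderiv ℝ (fderiv ℝ (iteratedFDeriv ℝ n f)) x (v 0) (v 1) (Fin.tail (Fin.tail v)) := by
  let I : (E →L[ℝ] E [×n]→L[ℝ] F) ≃L[ℝ] E [×(n + 1)]→L[ℝ] F :=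
    (continuousMultilinearCurryLeftEquiv ℝ (fun _ : Fin (n + 1) => E) F).symm
  exact congrArg (fun L : E →L[ℝ] E [×(n + 1)]→L[ℝ] F => L (v 0) (Fin.tail v))
    (I.comp_fderiv (f := fderiv ℝ (iteratedFDeriv ℝ n f)) (x := x))

theorem iteratedFDeriv_comp_swap_zero_one (hf : ContDiff ℝ (n + 2 : ℕ) f) (x : E)
    (v : Fin (n + 2) → E) :
    iteratedFDeriv ℝ (n + 2) f x (v ∘ Equiv.swap 0 1) = iteratedFDeriv ℝ (n + 2) f x v := by
  have hf₂ : ContDiff ℝ 2 (iteratedFDeriv ℝ n f) :=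
    hf.iteratedFDeriv_right (by exact_mod_cast (add_comm 2 n).le)
  have htail : Fin.tail (Fin.tail (v ∘ Equiv.swap 0 1)) = Fin.tail (Fin.tail v) := by
    funext j
    refine congrArg v (Equiv.swap_apply_of_ne_of_ne (Fin.succ_ne_zero _) ?_)
    exact fun h => Fin.succ_ne_zero j (Fin.succ_injective _ h)
  have hsymm := hf₂.contDiffAt.isSymmSndFDerivAt (x := x) (by simp)
  rw [iteratedFDeriv_add_two_apply, iteratedFDeriv_add_two_apply, htail, Function.comp_apply,
    Function.comp_apply, Equiv.swap_apply_left, Equiv.swap_apply_right, hsymm.eq]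

theorem iteratedFDeriv_succ_congr (hf : ContDiff ℝ (n + 1 : ℕ) f) (x : E)
    {v w : Fin (n + 1) → E} (h₀ : v 0 = w 0)
    (h : ∀ y, iteratedFDeriv ℝ n f y (Fin.tail v) = iteratedFDeriv ℝ n f y (Fin.tail w)) :
    iteratedFDeriv ℝ (n + 1) f x v = iteratedFDeriv ℝ (n + 1) f x w := by
  have hd : DifferentiableAt ℝ (iteratedFDeriv ℝ n f) x :=
    hf.differentiable_iteratedFDeriv (by exact_mod_cast n.lt_succ_self) x
  rw [hd.iteratedFDeriv_succ_apply_left', hd.iteratedFDeriv_succ_apply_left', h₀, funext h]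

theorem iteratedFDeriv_comp_perm_of_contDiff (hf : ContDiff ℝ n f) (x : E) (v : Fin n → E)
    (σ : Equiv.Perm (Fin n)) : iteratedFDeriv ℝ n f x (v ∘ σ) = iteratedFDeriv ℝ n f x v := by
  induction n generalizing x with
  | zero => exact congrArg _ (Subsingleton.elim _ _)
  | succ n ih =>
    have hσ : σ ∈ Submonoid.closure (range fun i : Fin n => Equiv.swap i.castSucc i.succ) := by
      rw [Equiv.Perm.mclosure_swap_castSucc_succ]
      exact Submonoid.mem_top σ
    induction hσ using Submonoid.closure_induction generalizing v with
    | one => rfl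
    | mul σ τ _ _ hσ hτ => exact (hτ (v ∘ σ)).trans (hσ v)
    | mem σ hσ =>
      obtain ⟨i, rfl⟩ := hσ
      rcases n with _ | n
      · exact i.elim0
      refine Fin.cases ?_ (fun i => ?_) i
      · exact iteratedFDeriv_comp_swap_zero_one hf x v
      · refine iteratedFDeriv_succ_congr hf x ?_ fun y => ?_
        · refine congrArg v (Equiv.swap_apply_of_ne_of_ne ?_ (Fin.succ_ne_zero _).symm)
          exact (Fin.castSucc_pos i.succ_pos).ne
        · have htail : Fin.tail (v ∘ Equiv.swap i.succ.castSucc i.succ.succ) =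
              Fin.tail v ∘ Equiv.swap i.castSucc i.succ := by
            funext j
            simp only [Fin.tail, Function.comp_apply]
            rw [Fin.castSucc_succ, ← (Fin.succ_injective _).map_swap]
          rw [htail]
          exact ih (hf.of_le (by exact_mod_cast n.succ.le_succ)) y _ _

theorem iteratedFDeriv_apply_cast {n' : ℕ} (h : n = n') (x : E) (v : Fin n' → E) :
    iteratedFDeriv ℝ n f x (v ∘ Fin.cast h) = iteratedFDeriv ℝ n' f x v := by
  subst h
  rfl

theorem hasDerivAt_iteratedFDeriv_append {m l : ℕ} (hf : ContDiff ℝ (m + 1 + l : ℕ) f) (x v : E)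
    (w : Fin l → E) (θ : ℝ) :
    HasDerivAt
      (fun θ : ℝ => iteratedFDeriv ℝ (m + l) f (x + θ • v) (Fin.append (fun _ : Fin m => v) w))
      (iteratedFDeriv ℝ (m + 1 + l) f (x + θ • v) (Fin.append (fun _ : Fin (m + 1) => v) w)) θ := by
  have happend : Fin.append (fun _ : Fin (m + 1) => v) w =
      Fin.cons v (Fin.append (fun _ : Fin m => v) w) ∘ Fin.cast (Nat.add_right_comm m 1 l) := by
    rw [← Fin.append_cons]
    congr 1
    funext j
    exact Fin.cases rfl (fun _ => rfl) j
  have hd : DifferentiableAt ℝ (iteratedFDeriv ℝ (m + l) f) (x + θ • v) :=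
    hf.differentiable_iteratedFDeriv (by exact_mod_cast (by omega : m + l < m + 1 + l)) _
  have hline : HasDerivAt (fun θ : ℝ => x + θ • v) v θ := by
    simpa only [one_smul] using ((hasDerivAt_id' θ).smul_const v).const_add x
  rw [happend, iteratedFDeriv_apply_cast, iteratedFDeriv_succ_apply_left]
  exact (ContinuousMultilinearMap.apply ℝ (fun _ : Fin (m + l) => E) F
    (Fin.append (fun _ : Fin m => v) w)).hasFDerivAt.comp_hasDerivAt θ
      (hd.hasFDerivAt.comp_hasDerivAt θ hline)

theorem iteratedDeriv_iteratedFDeriv_add_smul {m l : ℕ} (hf : ContDiff ℝ (m + l : ℕ) f) (x v : E)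
    (w : Fin l → E) :
    iteratedDeriv m (fun θ : ℝ => iteratedFDeriv ℝ l f (x + θ • v) w) =
      fun θ => iteratedFDeriv ℝ (m + l) f (x + θ • v) (Fin.append (fun _ : Fin m => v) w) := by
  induction m with
  | zero =>
    have happend : Fin.append (fun _ : Fin 0 => v) w = w ∘ Fin.cast (Nat.zero_add l) := by
      rw [Subsingleton.elim (fun _ : Fin 0 => v) Fin.elim0, Fin.elim0_append]
    simp only [iteratedDeriv_zero, happend, iteratedFDeriv_apply_cast]
  | succ m ih =>
    rw [iteratedDeriv_succ, ih (hf.of_le (by exact_mod_cast (by omega : m + l ≤ m + 1 + l)))]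
    exact funext fun θ => (hasDerivAt_iteratedFDeriv_append hf x v w θ).deriv

theorem exists_eq_sum_iteratedDeriv_add {g : ℝ → ℝ} (hg : ContDiff ℝ n g) :
    ∃ θ ∈ Icc (0 : ℝ) 1, g 1 = ∑ m ∈ Finset.range n, (m.factorial : ℝ)⁻¹ * iteratedDeriv m g 0 +
      (n.factorial : ℝ)⁻¹ * iteratedDeriv n g θ := by
  rcases n with _ | n
  · exact ⟨1, right_mem_Icc.2 zero_le_one, by simp⟩
  obtain ⟨θ, hθ, htaylor⟩ := taylor_mean_remainder_lagrange_iteratedDeriv (x := 1) (x₀ := 0)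
    (n := n) zero_ne_one (by exact_mod_cast hg.contDiffOn)
  rw [uIoo_of_le zero_le_one] at hθ
  refine ⟨θ, Ioo_subset_Icc_self hθ, ?_⟩
  rw [taylor_within_apply, sub_eq_iff_eq_add'] at htaylor
  rw [htaylor]
  congr 1
  · refine Finset.sum_congr rfl fun m hm => ?_
    rw [iteratedDerivWithin_eq_iteratedDeriv (uniqueDiffOn_uIcc zero_ne_one)
      (hg.of_le (by exact_mod_cast (Finset.mem_range.1 hm).le)).contDiffAt left_mem_uIcc]
    simp only [sub_zero, one_pow, mul_one, smul_eq_mul]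
  · rw [sub_zero, one_pow, mul_one, div_eq_inv_mul]

theorem exists_iteratedFDeriv_add_eq_sum {f : E → ℝ} {n l : ℕ} (hf : ContDiff ℝ (n + l : ℕ) f)
    (x v : E) (w : Fin l → E) : ∃ θ ∈ Icc (0 : ℝ) 1,
      iteratedFDeriv ℝ l f (x + v) w = ∑ m ∈ Finset.range n, (m.factorial : ℝ)⁻¹ *
        iteratedFDeriv ℝ (m + l) f x (Fin.append (fun _ : Fin m => v) w) +
      (n.factorial : ℝ)⁻¹ *
        iteratedFDeriv ℝ (n + l) f (x + θ • v) (Fin.append (fun _ : Fin n => v) w) := by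
  have hg : ContDiff ℝ n fun θ : ℝ => iteratedFDeriv ℝ l f (x + θ • v) w := by
    have hl : ContDiff ℝ n (iteratedFDeriv ℝ l f) := hf.iteratedFDeriv_right (by norm_cast)
    exact (ContinuousMultilinearMap.apply ℝ (fun _ : Fin l => E) ℝ w).contDiff.comp
      (hl.comp (by fun_prop))
  obtain ⟨θ, hθ, h⟩ := exists_eq_sum_iteratedDeriv_add hg
  refine ⟨θ, hθ, ?_⟩
  rw [iteratedDeriv_iteratedFDeriv_add_smul hf, Finset.sum_congr rfl fun m hm => by
    rw [iteratedDeriv_iteratedFDeriv_add_smul (hf.of_le (by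
      exact_mod_cast Nat.add_le_add_right (Finset.mem_range.1 hm).le l))]] at h
  simpa only [one_smul, zero_smul, add_zero] using h

end IteratedDerivative

section Nabla

variable {d : ℕ} {f : EuclideanSpace ℝ (Fin d) → ℝ}

theorem isSymTens_nabla {k : ℕ} (hf : ContDiff ℝ k f) (x : EuclideanSpace ℝ (Fin d)) :
    IsSymTens (nabla k f x) := fun σ i =>
  iteratedFDeriv_comp_perm_of_contDiff hf x (fun j => EuclideanSpace.single (i j) (1 : ℝ)) σ

theorem multilinearMap_apply_const {M : Type*} [AddCommGroup M] [Module ℝ M] {m : ℕ}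
    (g : MultilinearMap ℝ (fun _ : Fin m => EuclideanSpace ℝ (Fin d)) M)
    (v : EuclideanSpace ℝ (Fin d)) :
    g (fun _ => v) = ∑ i : Fin m → Fin d, (∏ j, v (i j)) •
      g (fun j => EuclideanSpace.single (i j) (1 : ℝ)) := by
  have hv : v = ∑ a : Fin d, v a • EuclideanSpace.single a (1 : ℝ) := by
    ext b
    simp [Finset.sum_apply, Pi.single_apply]
  conv_lhs => rw [hv]
  rw [MultilinearMap.map_sum]
  exact Finset.sum_congr rfl fun i _ => g.map_smul_univ _ _

theorem inner_nabla_tpow (k : ℕ) (x v : EuclideanSpace ℝ (Fin d)) :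
    inner ℝ (nabla k f x) (tpow v k) = iteratedFDeriv ℝ k f x (fun _ => v) := by
  rw [inner_eq_sum_mul]
  refine Eq.trans ?_ (multilinearMap_apply_const (iteratedFDeriv ℝ k f x).toMultilinearMap v).symm
  exact Finset.sum_congr rfl fun i _ => mul_comm _ _

theorem append_eq_elim {α : Type*} {m l : ℕ} (z : Fin m → α) (w : Fin l → α) :
    Fin.append z w = Sum.elim z w ∘ finSumFinEquiv.symm := by
  funext j
  refine Fin.addCases (fun a => ?_) (fun a => ?_) j <;> simp

theorem contract_tpow_nabla (m l : ℕ) (x v : EuclideanSpace ℝ (Fin d)) (j : Fin l → Fin d) :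
    contract (tpow v m) (nabla (m + l) f x) j =
      iteratedFDeriv ℝ (m + l) f x
        (Fin.append (fun _ : Fin m => v) fun a => EuclideanSpace.single (j a) (1 : ℝ)) := by
  let g := ((iteratedFDeriv ℝ (m + l) f x).toMultilinearMap.domDomCongr
    finSumFinEquiv.symm).currySum
  have hg (z : Fin m → EuclideanSpace ℝ (Fin d)) (w : Fin l → EuclideanSpace ℝ (Fin d)) :
      g z w = iteratedFDeriv ℝ (m + l) f x (Fin.append z w) := by
    rw [append_eq_elim]
    rfl
  rw [← hg, multilinearMap_apply_const, _root_.sum_apply]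
  refine Finset.sum_congr rfl fun i _ => ?_
  have happend : Fin.append (fun a => EuclideanSpace.single (i a) (1 : ℝ))
      (fun a => EuclideanSpace.single (j a) (1 : ℝ)) =
      fun b => EuclideanSpace.single (Fin.append i j b) (1 : ℝ) := by
    funext b
    refine Fin.addCases (fun a => ?_) (fun a => ?_) b <;> simp
  rw [_root_.smul_apply, hg, smul_eq_mul, happend]
  rfl

theorem abs_nabla_sub_taylor_le {n l : ℕ} (hf : ContDiff ℝ (n + l : ℕ) f)
    (x v : EuclideanSpace ℝ (Fin d)) (j : Fin l → Fin d) {ε : ℝ}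
    (hε : ∀ θ ∈ Icc (0 : ℝ) 1,
      ‖iteratedFDeriv ℝ (n + l) f (x + θ • v) - iteratedFDeriv ℝ (n + l) f x‖ ≤ ε) :
    |nabla l f (x + v) j - ∑ m ∈ Finset.range (n + 1), (m.factorial : ℝ)⁻¹ *
      contract (tpow v m) (nabla (m + l) f x) j| ≤ ε * ‖v‖ ^ n := by
  let w : Fin l → EuclideanSpace ℝ (Fin d) := fun a => EuclideanSpace.single (j a) (1 : ℝ)
  obtain ⟨θ, hθ, htaylor⟩ := exists_iteratedFDeriv_add_eq_sum hf x v w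
  let Δ := iteratedFDeriv ℝ (n + l) f (x + θ • v) - iteratedFDeriv ℝ (n + l) f x
  have hrem : nabla l f (x + v) j - ∑ m ∈ Finset.range (n + 1), (m.factorial : ℝ)⁻¹ *
      contract (tpow v m) (nabla (m + l) f x) j =
        (n.factorial : ℝ)⁻¹ • Δ (Fin.append (fun _ : Fin n => v) w) := by
    simp only [contract_tpow_nabla]
    rw [Finset.sum_range_succ, smul_eq_mul, _root_.sub_apply, mul_sub, sub_eq_iff_eq_add]
    refine htaylor.trans ?_
    ring
  have hprod : ∏ i : Fin (n + l), ‖Fin.append (fun _ : Fin n => v) w i‖ = ‖v‖ ^ n := by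
    rw [Fin.prod_univ_add]
    simp [w]
  rw [hrem, ← Real.norm_eq_abs]
  calc ‖(n.factorial : ℝ)⁻¹ • Δ (Fin.append (fun _ : Fin n => v) w)‖
      ≤ ‖Δ (Fin.append (fun _ : Fin n => v) w)‖ := norm_inv_factorial_smul_le n _
    _ ≤ ‖Δ‖ * ‖v‖ ^ n := hprod ▸ Δ.le_opNorm _
    _ ≤ ε * ‖v‖ ^ n := by gcongr; exact hε θ hθ

end Nabla

/-! ### Integrals against a vector measure -/

section TotalVariation

variable {X : Type*} [MeasurableSpace X]

instance isFiniteMeasure_variation {ι : Type*} [Fintype ι]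
    (μ : VectorMeasure X (EuclideanSpace ℝ ι)) : IsFiniteMeasure μ.variation := by
  let coord (i : ι) : SignedMeasure X :=
    μ.mapRange (EuclideanSpace.proj (𝕜 := ℝ) i : EuclideanSpace ℝ ι →L[ℝ] ℝ).toAddMonoidHom
      (EuclideanSpace.proj (𝕜 := ℝ) i : EuclideanSpace ℝ ι →L[ℝ] ℝ).continuous
  have hfin : IsFiniteMeasure (∑ i, (coord i).variation) := by
    refine ⟨?_⟩
    rw [Measure.coe_finsetSum, Finset.sum_apply]
    refine ENNReal.sum_lt_top.2 fun i _ => ?_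
    rw [← SignedMeasure.totalVariation_eq_variation]
    exact measure_lt_top _ _
  refine isFiniteMeasure_of_le (∑ i, (coord i).variation)
    (VectorMeasure.variation_le_of_forall_enorm_le fun A _ => ?_)
  rw [Measure.coe_finsetSum, Finset.sum_apply]
  calc ‖μ A‖ₑ ≤ ∑ i, ‖μ A i‖ₑ := by
        simp only [← ofReal_norm]
        rw [← ENNReal.ofReal_sum_of_nonneg fun i _ => norm_nonneg _]
        exact ENNReal.ofReal_le_ofReal (norm_le_sum_norm _)
    _ ≤ ∑ i, (coord i).variation A :=
        Finset.sum_le_sum fun i _ => VectorMeasure.enorm_measure_le_variation (coord i) A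

theorem nullSingletonClass_variation [MeasurableSingletonClass X] {F : Type*}
    [NormedAddCommGroup F] {μ : VectorMeasure X F} (hμ : ∀ x, μ {x} = 0) :
    NullSingletonClass μ.variation := by
  refine ⟨fun x => (VectorMeasure.variation_apply_eq_zero (measurableSet_singleton x)).2 ?_⟩
  intro A hA _
  rcases subset_singleton_iff_eq.1 hA with rfl | rfl
  · exact μ.empty
  · exact hμ x

theorem norm_integral_indicator_le {E F G : Type*} [NormedAddCommGroup E] [NormedSpace ℝ E]
    [NormedAddCommGroup F] [NormedSpace ℝ F] [NormedAddCommGroup G] [NormedSpace ℝ G]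
    (μ : VectorMeasure X F) [IsFiniteMeasure μ.variation] (B : E →L[ℝ] F →L[ℝ] G) {A : Set X}
    (hA : MeasurableSet A) {g : X → E} {η : ℝ} (hg : ∀ x ∈ A, ‖g x‖ ≤ η) :
    ‖μ.integral (A.indicator g) B‖ ≤ ‖B‖ * (η * μ.variation.real A) := by
  refine VectorMeasure.norm_integral_le_integral_norm.trans
    (mul_le_mul_of_nonneg_left ?_ (norm_nonneg B))
  calc ∫ x, ‖A.indicator g x‖ ∂μ.variation
      ≤ ∫ x, A.indicator (fun _ => η) x ∂μ.variation := by
        refine integral_mono_of_nonneg (Eventually.of_forall fun _ => norm_nonneg _)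
          ((integrable_const η).indicator hA) (Eventually.of_forall fun x => ?_)
        simp only [norm_indicator_eq_indicator_norm]
        exact indicator_le_indicator' (hg x)
    _ = η * μ.variation.real A := by rw [integral_indicator_const _ hA, smul_eq_mul, mul_comm]

end TotalVariation

theorem continuous_measureReal_Iic (ν : Measure ℝ) [IsFiniteMeasure ν] [NullSingletonClass ν] :
    Continuous fun t => ν.real (Iic t) := by
  have h := intervalIntegral.continuous_primitive (μ := ν) (f := fun _ => (1 : ℝ))
    (fun _ _ => intervalIntegrable_const) 0
  simp only [intervalIntegral.integral_const_of_cdf, smul_eq_mul, mul_one] at h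
  simpa only [sub_add_cancel] using h.add_const (ν.real (Iic 0))

section DistributionFunction

variable {T : ℝ} {F : Type*} [NormedAddCommGroup F] (μ : VectorMeasure (Icc (0 : ℝ) T) F)

/-- The distribution function `t ↦ |μ|([0, t])` of the variation of a vector measure on `[0, T]`. -/
noncomputable def massUpTo (t : ℝ) : ℝ := μ.variation.real {x | (x : ℝ) ≤ t}

theorem measurableSet_val_le (t : ℝ) : MeasurableSet {x : Icc (0 : ℝ) T | (x : ℝ) ≤ t} :=
  measurable_subtype_coe measurableSet_Iic

theorem preimage_val_Ioc (s t : ℝ) : (Subtype.val ⁻¹' Ioc s t : Set (Icc (0 : ℝ) T)) =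
    {x : Icc (0 : ℝ) T | (x : ℝ) ≤ t} \ {x : Icc (0 : ℝ) T | (x : ℝ) ≤ s} := by
  rw [← Iic_sdiff_Iic]
  rfl

theorem setOf_val_le_subset {s t : ℝ} (hst : s ≤ t) :
    {x : Icc (0 : ℝ) T | (x : ℝ) ≤ s} ⊆ {x : Icc (0 : ℝ) T | (x : ℝ) ≤ t} :=
  fun _ hx => le_trans hx hst

variable [IsFiniteMeasure μ.variation]

theorem massUpTo_sub {s t : ℝ} (hst : s ≤ t) :
    massUpTo μ t - massUpTo μ s = μ.variation.real (Subtype.val ⁻¹' Ioc s t) := by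
  rw [preimage_val_Ioc, measureReal_sdiff (setOf_val_le_subset hst) (measurableSet_val_le s)]
  rfl

theorem monotone_massUpTo : Monotone (massUpTo μ) :=
  fun _ _ hst => measureReal_mono (setOf_val_le_subset hst)

theorem continuous_massUpTo [NullSingletonClass μ.variation] : Continuous (massUpTo μ) := by
  have : NullSingletonClass (μ.variation.map Subtype.val) := by
    refine ⟨fun t => ?_⟩
    rw [Measure.map_apply measurable_subtype_coe (measurableSet_singleton t)]
    exact (subsingleton_singleton.preimage Subtype.val_injective).measure_zero _
  refine (continuous_measureReal_Iic (μ.variation.map Subtype.val)).congr fun t => ?_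
  exact map_measureReal_apply measurable_subtype_coe measurableSet_Iic

end DistributionFunction

section TensorIntegral

variable {d p : ℕ} {T : ℝ} (μ : VectorMeasure (Icc (0 : ℝ) T) (Tens d p)) {φ : ℝ → Tens d p}

theorem pthVariation_sub {s t : ℝ} (hst : s ≤ t) :
    pthVariation μ t - pthVariation μ s = μ (Subtype.val ⁻¹' Ioc s t) := by
  rw [preimage_val_Ioc, VectorMeasure.of_sdiff (measurableSet_val_le s) (measurableSet_val_le t)
    (setOf_val_le_subset hst)]
  rfl

theorem norm_pthVariation_sub_le {s t : ℝ} (hst : s ≤ t) :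
    ‖pthVariation μ t - pthVariation μ s‖ ≤ massUpTo μ t - massUpTo μ s := by
  rw [pthVariation_sub μ hst, massUpTo_sub μ hst]
  exact VectorMeasure.norm_measure_le_variation (measure_ne_top _ _)

/-- The integral `∫₀ᵗ ⟨φ, dμ⟩` of a tensor valued function. -/
noncomputable def tensorIntegral (φ : ℝ → Tens d p) (t : ℝ) : ℝ :=
  μ.integral ({x : Icc (0 : ℝ) T | (x : ℝ) ≤ t}.indicator fun x => φ x) (innerSL ℝ)

variable (hφ : ContinuousOn φ (Icc 0 T))
include hφ

theorem integrable_of_continuousOn : μ.Integrable (fun x : Icc (0 : ℝ) T => φ x) := by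
  obtain ⟨C, hC⟩ := isCompact_Icc.exists_bound_of_continuousOn hφ
  exact Integrable.of_bound (continuousOn_iff_continuous_domRestrict.1 hφ).aestronglyMeasurable C
    (Eventually.of_forall fun x => hC x x.2)

theorem tensorIntegral_sub_sub_inner {s t : ℝ} (hst : s ≤ t) :
    tensorIntegral μ φ t - tensorIntegral μ φ s -
        inner ℝ (φ s) (pthVariation μ t - pthVariation μ s) =
      μ.integral ((Subtype.val ⁻¹' Ioc s t).indicator fun x => φ x - φ s) (innerSL ℝ) := by
  have hint := integrable_of_continuousOn μ hφ
  have hmeas : MeasurableSet (Subtype.val ⁻¹' Ioc s t : Set (Icc (0 : ℝ) T)) :=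
    measurable_subtype_coe measurableSet_Ioc
  have hsub : tensorIntegral μ φ t - tensorIntegral μ φ s =
      μ.integral ((Subtype.val ⁻¹' Ioc s t).indicator fun x => φ x) (innerSL ℝ) := by
    rw [tensorIntegral, tensorIntegral, ← VectorMeasure.integral_sub
      (hint.indicator (measurableSet_val_le t)) (hint.indicator (measurableSet_val_le s)),
      preimage_val_Ioc, indicator_sdiff (setOf_val_le_subset hst)]
  have hconst : inner ℝ (φ s) (pthVariation μ t - pthVariation μ s) =
      μ.integral ((Subtype.val ⁻¹' Ioc s t).indicator fun _ => φ s) (innerSL ℝ) := by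
    rw [VectorMeasure.integral_indicator_const _ hmeas, pthVariation_sub μ hst]
    rfl
  rw [hsub, hconst, ← VectorMeasure.integral_sub (hint.indicator hmeas)
    ((integrable_const (φ s)).indicator hmeas), ← indicator_sub']
  rfl

theorem abs_tensorIntegral_sub_sub_inner_le {s t η : ℝ} (hst : s ≤ t)
    (hη : ∀ r ∈ Icc s t, ‖φ r - φ s‖ ≤ η) :
    |tensorIntegral μ φ t - tensorIntegral μ φ s -
        inner ℝ (φ s) (pthVariation μ t - pthVariation μ s)| ≤
      η * (massUpTo μ t - massUpTo μ s) := by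
  rw [tensorIntegral_sub_sub_inner μ hφ hst, massUpTo_sub μ hst]
  refine (norm_integral_indicator_le μ (innerSL ℝ) (measurable_subtype_coe measurableSet_Ioc)
    fun x hx => hη x (Ioc_subset_Icc_self hx)).trans ?_
  have hη0 : 0 ≤ η := (norm_nonneg _).trans (hη s (left_mem_Icc.2 hst))
  exact mul_le_of_le_one_left (mul_nonneg hη0 measureReal_nonneg) (norm_innerSL_le ℝ)

theorem tendsto_integral_smul {ι : Type*} {l : Filter ι} [l.IsCountablyGenerated]
    {ψ : ι → ℝ → ℝ} (hψ : ∀ i, Continuous (ψ i)) (hψ1 : ∀ i r, |ψ i r| ≤ 1)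
    {g : Icc (0 : ℝ) T → Tens d p}
    (hlim : ∀ᵐ x : Icc (0 : ℝ) T ∂μ.variation, Tendsto (fun i => ψ i x • φ x) l (𝓝 (g x))) :
    Tendsto (fun i => μ.integral (fun x : Icc (0 : ℝ) T => ψ i x • φ x) (innerSL ℝ)) l
      (𝓝 (μ.integral g (innerSL ℝ))) := by
  obtain ⟨C, hC⟩ := isCompact_Icc.exists_bound_of_continuousOn hφ
  have hφc : Continuous fun x : Icc (0 : ℝ) T => φ x :=
    continuousOn_iff_continuous_domRestrict.1 hφ
  refine VectorMeasure.tendsto_integral_filter_of_norm_le_const (Eventually.of_forall fun i =>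
    (((hψ i).comp continuous_subtype_val).smul hφc).aestronglyMeasurable)
    ⟨C, Eventually.of_forall fun i => Eventually.of_forall fun x => ?_⟩ hlim
  rw [norm_smul]
  exact (mul_le_of_le_one_left (norm_nonneg _) (hψ1 i x)).trans (hC x x.2)

end TensorIntegral

/-! ### Variation up to an intermediate time -/

section StoppedSums

variable {d p : ℕ} {T : ℝ}

/-- The tensor that represents the `p`-th power of the `ℓ^p` norm, for even `p`: its pairing with
`v^{⊗ p}` is `∑ᵢ vᵢ^p`. -/
noncomputable def diagTens (d p : ℕ) : Tens d p :=
  ∑ i : Fin d, tpow (EuclideanSpace.single i (1 : ℝ)) p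

theorem inner_diagTens (v : EuclideanSpace ℝ (Fin d)) :
    inner ℝ (diagTens d p) (tpow v p) = ∑ i, v i ^ p := by
  simp only [diagTens, sum_inner, inner_tpow_tpow, EuclideanSpace.inner_single_left, map_one,
    one_mul]

theorem norm_pow_le_inner_diagTens (hp : Even p) (hp0 : 0 < p) (v : EuclideanSpace ℝ (Fin d)) :
    ‖v‖ ^ p ≤ d ^ p * inner ℝ (diagTens d p) (tpow v p) := by
  rw [inner_diagTens]
  have hnonneg : ∀ i ∈ Finset.univ, 0 ≤ v i ^ p := fun i _ => hp.pow_nonneg _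
  have hsum : 0 ≤ ∑ i, v i ^ p := Finset.sum_nonneg hnonneg
  have hcoord : ∀ i, |v i| ≤ (∑ i, v i ^ p) ^ (p : ℝ)⁻¹ := fun i => by
    rw [Real.le_rpow_inv_iff_of_pos (abs_nonneg _) hsum (by positivity), Real.rpow_natCast,
      hp.pow_abs]
    exact Finset.single_le_sum hnonneg (Finset.mem_univ i)
  calc ‖v‖ ^ p ≤ (d * (∑ i, v i ^ p) ^ (p : ℝ)⁻¹) ^ p := by
        have h := norm_le_card_mul_of_forall_abs_le hcoord
        rw [Fintype.card_fin] at h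
        exact pow_le_pow_left₀ (norm_nonneg _) h p
    _ = d ^ p * ∑ i, v i ^ p := by rw [mul_pow, Real.rpow_inv_natCast_pow hsum hp0.ne']

theorem abs_inner_tpow_le {A : Tens d p} {Φ : ℝ} (hA : ‖A‖ ≤ Φ) (v : EuclideanSpace ℝ (Fin d)) :
    |inner ℝ A (tpow v p)| ≤ Φ * ‖v‖ ^ p := by
  refine (abs_real_inner_le_norm _ _).trans ?_
  rw [norm_tpow]
  gcongr

theorem tendsto_integral_cutoff (μ : VectorMeasure (Icc (0 : ℝ) T) (Tens d p)) {φ : ℝ → Tens d p}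
    (hφ : ContinuousOn φ (Icc 0 T)) (t : ℝ) :
    Tendsto (fun ε => μ.integral (fun x : Icc (0 : ℝ) T => (1 - ramp t (t + ε) x) • φ x)
      (innerSL ℝ)) (𝓝[>] 0) (𝓝 (tensorIntegral μ φ t)) := by
  refine tendsto_integral_smul μ hφ (ψ := fun ε r => 1 - ramp t (t + ε) r)
    (fun ε => continuous_const.sub (continuous_ramp t (t + ε))) (fun ε r => ?_)
    (Eventually.of_forall fun x => tendsto_const_nhds.congr' ?_)
  · rw [abs_of_nonneg (sub_nonneg.2 (ramp_le_one _ _ _))]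
    exact sub_le_self _ (ramp_nonneg _ _ _)
  rcases le_or_gt (x : ℝ) t with hx | hx
  · filter_upwards [self_mem_nhdsWithin] with ε hε
    rw [ramp_of_le (le_add_of_nonneg_right (le_of_lt hε)) hx, sub_zero, one_smul,
      indicator_of_mem (show x ∈ {x : Icc (0 : ℝ) T | (x : ℝ) ≤ t} from hx)]
  · filter_upwards [Ioo_mem_nhdsGT (sub_pos.2 hx)] with ε hε
    rw [ramp_of_ge (lt_add_of_pos_right t hε.1) (by linarith [hε.2]), sub_self, zero_smul,
      indicator_of_notMem (show x ∉ {x : Icc (0 : ℝ) T | (x : ℝ) ≤ t} from not_le.2 hx)]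

theorem tendsto_integral_bump (μ : VectorMeasure (Icc (0 : ℝ) T) (Tens d p))
    [NullSingletonClass μ.variation] (D : Tens d p) (t : ℝ) :
    Tendsto (fun ε => μ.integral (fun x : Icc (0 : ℝ) T =>
      (ramp (t - ε) t x - ramp t (t + ε) x) • D) (innerSL ℝ)) (𝓝[>] 0) (𝓝 0) := by
  have hne : ∀ᵐ x : Icc (0 : ℝ) T ∂μ.variation, (x : ℝ) ≠ t :=
    measure_mono_null (fun x hx => not_not.1 hx)
      ((subsingleton_singleton.preimage Subtype.val_injective).measure_zero _)
  have h0 : μ.integral (fun _ : Icc (0 : ℝ) T => (0 : Tens d p)) (innerSL ℝ) = 0 :=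
    VectorMeasure.integral_zero
  suffices h : Tendsto (fun ε => μ.integral (fun x : Icc (0 : ℝ) T =>
      (ramp (t - ε) t x - ramp t (t + ε) x) • D) (innerSL ℝ)) (𝓝[>] 0)
      (𝓝 (μ.integral (fun _ : Icc (0 : ℝ) T => (0 : Tens d p)) (innerSL ℝ))) from
    h.trans_eq (congrArg 𝓝 h0)
  refine tendsto_integral_smul μ continuousOn_const
    (ψ := fun ε r => ramp (t - ε) t r - ramp t (t + ε) r)
    (fun ε => (continuous_ramp (t - ε) t).sub (continuous_ramp t (t + ε)))
    (fun ε r => abs_sub_le_of_nonneg_of_le (ramp_nonneg _ _ _) (ramp_le_one _ _ _)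
      (ramp_nonneg _ _ _) (ramp_le_one _ _ _))
    (hne.mono fun x hx => tendsto_const_nhds.congr' ?_)
  rcases lt_or_gt_of_ne hx with hxt | hxt
  · filter_upwards [Ioo_mem_nhdsGT (sub_pos.2 hxt)] with ε hε
    rw [ramp_of_le (sub_le_self t hε.1.le) (by linarith [hε.2]),
      ramp_of_le (le_add_of_nonneg_right hε.1.le) hxt.le, sub_self, zero_smul]
  · filter_upwards [Ioo_mem_nhdsGT (sub_pos.2 hxt)] with ε hε
    rw [ramp_of_ge (sub_lt_self t hε.1) hxt.le,
      ramp_of_ge (lt_add_of_pos_right t hε.1) (by linarith [hε.2]), sub_self, zero_smul]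

variable {S : ℝ → EuclideanSpace ℝ (Fin d)} {A : Tens d p} {Φ δ ε a b t : ℝ}

theorem abs_inner_tpow_stopped_sub_le (hA : ‖A‖ ≤ Φ) (hat : a ≤ t) (hab : a ≤ b)
    (hosc : ∀ r ∈ Icc a b, ‖S r - S a‖ ≤ δ) :
    |inner ℝ A (tpow (S (min b t) - S a) p) - inner ℝ A (tpow (S b - S a) p)| ≤
      2 * Φ * δ ^ p * (Ici t).indicator 1 b := by
  have hΦ : 0 ≤ Φ := (norm_nonneg _).trans hA
  have hsmall : ∀ r ∈ Icc a b, |inner ℝ A (tpow (S r - S a) p)| ≤ Φ * δ ^ p := fun r hr =>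
    (abs_inner_tpow_le hA _).trans (by have := hosc r hr; gcongr)
  rcases lt_or_ge b t with hbt | htb
  · rw [min_eq_left hbt.le, sub_self, abs_zero, indicator_of_notMem (notMem_Ici.2 hbt), mul_zero]
  · rw [min_eq_right htb, indicator_of_mem (mem_Ici.2 htb), Pi.one_apply, mul_one]
    linarith [abs_sub (inner ℝ A (tpow (S t - S a) p)) (inner ℝ A (tpow (S b - S a) p)),
      hsmall t ⟨hat, htb⟩, hsmall b ⟨hab, le_rfl⟩]

theorem abs_inner_stopped_sub_cutoff_le (hp : Even p) (hp0 : 0 < p) (hA : ‖A‖ ≤ Φ) (hε : 0 < ε)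
    (hab : a ≤ b) (hosc : ∀ r ∈ Icc a b, ‖S r - S a‖ ≤ δ) :
    |inner ℝ A (tpow (S (min b t) - S (min a t)) p) -
      inner ℝ ((1 - ramp t (t + ε) a) • A) (tpow (S b - S a) p)| ≤
    Φ * d ^ p * inner ℝ ((ramp (t - ε) t a - ramp t (t + ε) a) • diagTens d p)
      (tpow (S b - S a) p) + 2 * Φ * δ ^ p * ((Ici t).indicator 1 b - (Ici t).indicator 1 a) := by
  have hΦ : 0 ≤ Φ := (norm_nonneg _).trans hA
  have hdiag := norm_pow_le_inner_diagTens hp hp0 (S b - S a)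
  rw [real_inner_smul_left, real_inner_smul_left]
  rcases le_or_gt t a with hta | hat
  · have hcut := sub_nonneg.2 (ramp_le_one t (t + ε) a)
    rw [min_eq_right hta, min_eq_right (hta.trans hab), sub_self, tpow_zero_left hp0.ne',
      inner_zero_right, zero_sub, abs_neg, abs_mul, abs_of_nonneg hcut,
      ramp_of_ge (sub_lt_self t hε) hta, indicator_of_mem (mem_Ici.2 hta),
      indicator_of_mem (mem_Ici.2 (hta.trans hab)), Pi.one_apply, Pi.one_apply, sub_self,
      mul_zero, add_zero]
    calc (1 - ramp t (t + ε) a) * |inner ℝ A (tpow (S b - S a) p)|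
        ≤ (1 - ramp t (t + ε) a) * (Φ * (d ^ p * inner ℝ (diagTens d p) (tpow (S b - S a) p))) :=
          mul_le_mul_of_nonneg_left ((abs_inner_tpow_le hA _).trans
            (mul_le_mul_of_nonneg_left hdiag hΦ)) hcut
      _ = _ := by ring
  · have hbump : 0 ≤ Φ * d ^ p *
        (ramp (t - ε) t a * inner ℝ (diagTens d p) (tpow (S b - S a) p)) := by
      have hdiag0 : 0 ≤ inner ℝ (diagTens d p) (tpow (S b - S a) p) := by
        rw [inner_diagTens]
        exact Finset.sum_nonneg fun _ _ => hp.pow_nonneg _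
      have := ramp_nonneg (t - ε) t a
      positivity
    rw [ramp_of_le (le_add_of_nonneg_right hε.le) hat.le, sub_zero, sub_zero, one_mul,
      min_eq_left hat.le, indicator_of_notMem (notMem_Ici.2 hat), sub_zero]
    exact le_add_of_nonneg_of_le hbump (abs_inner_tpow_stopped_sub_le hA hat.le hab hosc)

theorem abs_sum_inner_stopped_sub_cutoff_le (hp : Even p) (hp0 : 0 < p)
    (P : IntervalPartition 0 T) {φ : ℝ → Tens d p} (t : ℝ) (hΦ0 : 0 ≤ Φ)
    (hΦ : ∀ r ∈ Icc 0 T, ‖φ r‖ ≤ Φ) (hε : 0 < ε)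
    (hosc : ∀ e ∈ P.intervals, ∀ r ∈ Icc e.1 e.2, ‖S r - S e.1‖ ≤ δ) :
    |∑ e ∈ P.intervals, inner ℝ (φ e.1) (tpow (S (min e.2 t) - S (min e.1 t)) p) -
      ∑ e ∈ P.intervals, inner ℝ ((1 - ramp t (t + ε) e.1) • φ e.1) (tpow (S e.2 - S e.1) p)| ≤
    Φ * d ^ p * ∑ e ∈ P.intervals,
      inner ℝ ((ramp (t - ε) t e.1 - ramp t (t + ε) e.1) • diagTens d p)
        (tpow (S e.2 - S e.1) p) + 2 * Φ * δ ^ p := by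
  have hmass : (Ici t).indicator (1 : ℝ → ℝ) T - (Ici t).indicator 1 0 ≤ 1 := by
    have h0 : 0 ≤ (Ici t).indicator (1 : ℝ → ℝ) 0 := indicator_nonneg (fun _ _ => zero_le_one) _
    have hT : (Ici t).indicator (1 : ℝ → ℝ) T ≤ 1 :=
      indicator_le_self' (fun _ _ => zero_le_one) T
    linarith
  have hterm : ∀ e ∈ P.intervals,
      |inner ℝ (φ e.1) (tpow (S (min e.2 t) - S (min e.1 t)) p) -
        inner ℝ ((1 - ramp t (t + ε) e.1) • φ e.1) (tpow (S e.2 - S e.1) p)| ≤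
      Φ * d ^ p * inner ℝ ((ramp (t - ε) t e.1 - ramp t (t + ε) e.1) • diagTens d p)
        (tpow (S e.2 - S e.1) p) +
        2 * Φ * δ ^ p * ((Ici t).indicator 1 e.2 - (Ici t).indicator 1 e.1) := fun e he =>
    abs_inner_stopped_sub_cutoff_le hp hp0 (hΦ e.1 (P.subset_Icc _ (P.mem_intervals.1 he).1)) hε
      (P.le_of_mem_intervals he).2.1 (hosc e he)
  rw [← Finset.sum_sub_distrib]
  refine (Finset.abs_sum_le_sum_abs _ _).trans ((Finset.sum_le_sum hterm).trans ?_)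
  rw [Finset.sum_add_distrib, ← Finset.mul_sum, ← Finset.mul_sum,
    P.sum_intervals_sub ((Ici t).indicator 1)]
  have hcoef : 0 ≤ 2 * Φ * δ ^ p := mul_nonneg (by positivity) (hp.pow_nonneg _)
  linarith [mul_le_of_le_one_right hcoef hmass]

theorem tendsto_sum_inner_stopped (hp : Even p) (hp0 : 0 < p) {π : ℕ → IntervalPartition 0 T}
    {μ : VectorMeasure (Icc (0 : ℝ) T) (Tens d p)} (hμ : HasPthVariation p π S μ)
    {φ : ℝ → Tens d p} (hφ : ContinuousOn φ (Icc 0 T)) (t : ℝ) :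
    Tendsto (fun n => ∑ e ∈ (π n).intervals,
      inner ℝ (φ e.1) (tpow (S (min e.2 t) - S (min e.1 t)) p)) atTop
      (𝓝 (tensorIntegral μ φ t)) := by
  have := nullSingletonClass_variation hμ.no_atoms
  obtain ⟨Φ₀, hΦ₀⟩ := isCompact_Icc.exists_bound_of_continuousOn hφ
  obtain ⟨Φ, hΦ0, hΦ⟩ : ∃ Φ : ℝ, 0 < Φ ∧ ∀ r ∈ Icc 0 T, ‖φ r‖ ≤ Φ :=
    ⟨max Φ₀ 1, by positivity, fun r hr => (hΦ₀ r hr).trans (le_max_left _ _)⟩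
  rw [Metric.tendsto_nhds]
  intro η hη
  obtain ⟨ε, hcut, hbump, hε⟩ : ∃ ε : ℝ,
      dist (μ.integral (fun x : Icc (0 : ℝ) T => (1 - ramp t (t + ε) x) • φ x) (innerSL ℝ))
        (tensorIntegral μ φ t) < η / 4 ∧
      Φ * d ^ p * μ.integral (fun x : Icc (0 : ℝ) T =>
        (ramp (t - ε) t x - ramp t (t + ε) x) • diagTens d p) (innerSL ℝ) < η / 4 ∧ 0 < ε := by
    have h := (tendsto_integral_bump μ (diagTens d p) t).const_mul (Φ * d ^ p)
    rw [mul_zero] at h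
    exact ((Metric.tendsto_nhds.1 (tendsto_integral_cutoff μ hφ t) _ (by positivity)).and
      ((h.eventually_lt_const (by positivity)).and self_mem_nhdsWithin)).exists
  obtain ⟨δ, hδ, hδη⟩ := exists_pos_mul_rpow_lt (θ := p) (by positivity) (2 * Φ)
    (show 0 < η / 4 by positivity)
  rw [Real.rpow_natCast] at hδη
  have hcutSum := Metric.tendsto_nhds.1 (hμ.tendsto (fun r => (1 - ramp t (t + ε) r) • φ r)
    ((continuous_const.sub (continuous_ramp _ _)).continuousOn.smul hφ)) (η / 4) (by positivity)
  have hbumpSum := ((hμ.tendsto (fun r => (ramp (t - ε) t r - ramp t (t + ε) r) • diagTens d p)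
    (((continuous_ramp _ _).sub (continuous_ramp _ _)).continuousOn.smul
      continuousOn_const)).const_mul (Φ * d ^ p)).eventually_lt_const hbump
  filter_upwards [hcutSum, hbumpSum, hμ.osc_tendsto δ hδ] with n h1 h2 hosc
  have hmain := abs_sum_inner_stopped_sub_cutoff_le hp hp0 (π n) t hΦ0.le hΦ hε
    fun e he r hr => hosc e he e.1 (left_mem_Icc.2 ((π n).le_of_mem_intervals he).2.1) r hr
  rw [Real.dist_eq, abs_lt] at h1 hcut ⊢
  rw [abs_le] at hmain
  constructor <;> linarith [h1.1, h1.2, hcut.1, hcut.2, hmain.1, hmain.2]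

end StoppedSums

/-! ### Taylor sums -/

section Taylor

variable {d n l : ℕ} {f : EuclideanSpace ℝ (Fin d) → ℝ} {B : Set (EuclideanSpace ℝ (Fin d))}
  {S : ℝ → EuclideanSpace ℝ (Fin d)}

theorem continuous_nabla (hf : ContDiff ℝ n f) : Continuous (nabla n f) := by
  refine (PiLp.continuous_toLp 2 _).comp (continuous_pi fun i => ?_)
  exact (ContinuousMultilinearMap.apply ℝ (fun _ : Fin n => EuclideanSpace ℝ (Fin d)) ℝ
    (fun j => EuclideanSpace.single (i j) (1 : ℝ))).continuous.comp
    (hf.continuous_iteratedFDeriv le_rfl)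

theorem norm_nabla_add_sub_taylor_le (hf : ContDiff ℝ (n + l : ℕ) f)
    (x v : EuclideanSpace ℝ (Fin d)) {ε : ℝ}
    (hε : ∀ θ ∈ Icc (0 : ℝ) 1,
      ‖iteratedFDeriv ℝ (n + l) f (x + θ • v) - iteratedFDeriv ℝ (n + l) f x‖ ≤ ε) :
    ‖nabla l f (x + v) - ∑ m ∈ Finset.range (n + 1),
      contract ((m.factorial : ℝ)⁻¹ • tpow v m) (nabla (m + l) f x)‖ ≤ d ^ l * (ε * ‖v‖ ^ n) := by
  have hcoord (j : Fin l → Fin d) : (nabla l f (x + v) - ∑ m ∈ Finset.range (n + 1),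
      contract ((m.factorial : ℝ)⁻¹ • tpow v m) (nabla (m + l) f x)) j =
      nabla l f (x + v) j - ∑ m ∈ Finset.range (n + 1), (m.factorial : ℝ)⁻¹ *
        contract (tpow v m) (nabla (m + l) f x) j := by
    rw [PiLp.sub_apply, WithLp.ofLp_sum, Finset.sum_apply]
    simp only [contract, PiLp.smul_apply, smul_eq_mul, Finset.mul_sum, mul_assoc]
  refine (norm_le_card_mul_of_forall_abs_le fun j => ?_).trans_eq
    (congrArg (· * (ε * ‖v‖ ^ n)) (by simp))
  exact (congrArg abs (hcoord j)).trans_le (abs_nabla_sub_taylor_le hf x v j hε)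

/-- The terms of orders `1, …, n` of the Taylor expansion of `f` at `x` in the direction `v`; they
are the summands of the compensated Riemann sums of `IsPathwiseIntegral`. -/
noncomputable def taylorSum (n : ℕ) (f : EuclideanSpace ℝ (Fin d) → ℝ)
    (x v : EuclideanSpace ℝ (Fin d)) : ℝ :=
  ∑ k ∈ Finset.Icc 1 n, (k.factorial : ℝ)⁻¹ * inner ℝ (nabla k f x) (tpow v k)

theorem nabla_zero_apply (x : EuclideanSpace ℝ (Fin d)) (i : Fin 0 → Fin d) :
    nabla 0 f x i = f x := by
  simp [nabla]

theorem contract_tpow_nabla_elim0 (k : ℕ) (x v : EuclideanSpace ℝ (Fin d)) :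
    contract (tpow v k) (nabla (k + 0) f x) Fin.elim0 = inner ℝ (nabla k f x) (tpow v k) := by
  rw [inner_eq_sum_mul]
  refine Finset.sum_congr rfl fun i _ => ?_
  rw [Fin.append_elim0, mul_comm]
  rfl

theorem abs_sub_sub_taylorSum_le (hf : ContDiff ℝ n f) (x v : EuclideanSpace ℝ (Fin d)) {ε : ℝ}
    (hε : ∀ θ ∈ Icc (0 : ℝ) 1,
      ‖iteratedFDeriv ℝ n f (x + θ • v) - iteratedFDeriv ℝ n f x‖ ≤ ε) :
    |f (x + v) - f x - taylorSum n f x v| ≤ ε * ‖v‖ ^ n := by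
  have htaylor := abs_nabla_sub_taylor_le (n := n) (l := 0) hf x v Fin.elim0 hε
  simp only [contract_tpow_nabla_elim0] at htaylor
  have hzero : (Nat.factorial 0 : ℝ)⁻¹ * inner ℝ (nabla 0 f x) (tpow v 0) = f x := by
    rw [inner_nabla_tpow, Nat.factorial_zero, Nat.cast_one, inv_one, one_mul,
      iteratedFDeriv_zero_apply]
  rwa [nabla_zero_apply, Finset.range_eq_Ico, Finset.sum_eq_sum_Ico_succ_bot n.succ_pos, hzero,
    ← sub_sub] at htaylor

theorem norm_smul_le_of_mem_Icc {E : Type*} [SeminormedAddCommGroup E] [NormedSpace ℝ E] {θ : ℝ}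
    (hθ : θ ∈ Icc (0 : ℝ) 1) (v : E) : ‖θ • v‖ ≤ ‖v‖ := by
  rw [norm_smul, Real.norm_of_nonneg hθ.1]
  exact mul_le_of_le_one_left (norm_nonneg v) hθ.2

theorem exists_abs_sub_sub_taylorSum_le (hf : ContDiff ℝ n f) (hB : IsCompact B)
    (hconv : Convex ℝ B) {η : ℝ} (hη : 0 < η) :
    ∃ ρ > 0, ∀ x ∈ B, ∀ y ∈ B, ‖y - x‖ < ρ →
      |f y - f x - taylorSum n f x (y - x)| ≤ η * ‖y - x‖ ^ n := by
  obtain ⟨ρ, hρ, h⟩ := Metric.uniformContinuousOn_iff.1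
    (hB.uniformContinuousOn_of_continuous (hf.continuous_iteratedFDeriv le_rfl).continuousOn) η hη
  refine ⟨ρ, hρ, fun x hx y hy hxy => ?_⟩
  have hle := abs_sub_sub_taylorSum_le hf x (y - x) (ε := η) fun θ hθ => by
    rw [← dist_eq_norm]
    refine (h _ (hconv.add_smul_sub_mem hx hy hθ) x hx ?_).le
    rw [dist_eq_norm, add_sub_cancel_left]
    exact (norm_smul_le_of_mem_Icc hθ _).trans_lt hxy
  rwa [add_sub_cancel] at hle

theorem exists_isCompact_convex_mapsTo {T : ℝ} (hS : ContinuousOn S (Icc 0 T)) :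
    ∃ B : Set (EuclideanSpace ℝ (Fin d)), IsCompact B ∧ Convex ℝ B ∧ MapsTo S (Icc 0 T) B := by
  obtain ⟨R, hR⟩ := isCompact_Icc.exists_bound_of_continuousOn hS
  exact ⟨Metric.closedBall 0 R, isCompact_closedBall 0 R, convex_closedBall 0 R,
    fun t ht => mem_closedBall_zero_iff.2 (hR t ht)⟩

end Taylor

section GradientPath

variable {d p k l : ℕ} {q T : ℝ} {f : EuclideanSpace ℝ (Fin d) → ℝ}
  {S : ℝ → EuclideanSpace ℝ (Fin d)}

theorem gradientPath_of_ne (hk : k ≠ 0) (s : ℝ) : gradientPath f S k s = nabla k f (S s) :=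
  if_neg hk

theorem continuousOn_gradientPath (hS : ContinuousOn S (Icc 0 T)) (hf : ContDiff ℝ k f) :
    ContinuousOn (gradientPath f S k) (Icc 0 T) := by
  by_cases hk : k = 0
  · subst hk
    exact continuousOn_const.congr fun s _ => if_pos rfl
  · exact ((continuous_nabla hf).comp_continuousOn hS).congr fun s _ => gradientPath_of_ne hk s

theorem isSymTens_gradientPath (hf : ContDiff ℝ k f) (s : ℝ) :
    IsSymTens (gradientPath f S k s) := by
  by_cases hk : k = 0
  · subst hk
    exact fun _ _ => rfl
  · rw [gradientPath_of_ne hk]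
    exact isSymTens_nabla hf _

theorem norm_controlledRemainder_gradientPath_le {V : ℝ → Tens d p} (hf : ContDiff ℝ p f)
    {K : NNReal} {B : Set (EuclideanSpace ℝ (Fin d))} (hB : Convex ℝ B)
    (hK : LipschitzOnWith K (iteratedFDeriv ℝ p f) B) {s t : ℝ} (hs : S s ∈ B) (ht : S t ∈ B)
    (hl : 1 ≤ l) (hlp : l ≤ p) :
    ‖controlledRemainder p (reducedLift S V) (gradientPath f S) l s t‖ ≤
      d ^ l * K * ‖S t - S s‖ ^ (p - l + 1) := by
  obtain ⟨n, rfl⟩ := Nat.exists_eq_add_of_le' hlp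
  have hε (θ : ℝ) (hθ : θ ∈ Icc (0 : ℝ) 1) :
      ‖iteratedFDeriv ℝ (n + l) f (S s + θ • (S t - S s)) - iteratedFDeriv ℝ (n + l) f (S s)‖ ≤
        K * ‖S t - S s‖ := by
    refine (hK.norm_sub_le (hB.add_smul_sub_mem hs ht hθ) hs).trans ?_
    rw [add_sub_cancel_left]
    gcongr
    exact norm_smul_le_of_mem_Icc hθ _
  have htaylor := norm_nabla_add_sub_taylor_le hf (S s) (S t - S s) hε
  have hterm (m : ℕ) (hm : m ∈ Finset.range (n + 1)) :
      contract (reducedLift S V m s t) (gradientPath f S (m + l) s) =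
        contract ((m.factorial : ℝ)⁻¹ • tpow (S t - S s) m) (nabla (m + l) f (S s)) := by
    rw [Finset.mem_range] at hm
    rw [gradientPath_of_ne (by omega), reducedLift_of_ne S V (by omega)]
  rw [controlledRemainder, gradientPath_of_ne (by omega), Nat.add_sub_cancel,
    Finset.sum_congr rfl hterm]
  rw [add_sub_cancel] at htaylor
  exact htaylor.trans_eq (by ring)

theorem norm_controlledRemainder_gradientPath_rpow_le {V : ℝ → Tens d p} (hf : ContDiff ℝ p f)
    {K : NNReal} {B : Set (EuclideanSpace ℝ (Fin d))} (hB : Convex ℝ B)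
    (hK : LipschitzOnWith K (iteratedFDeriv ℝ p f) B) {s t : ℝ} (hs : S s ∈ B) (ht : S t ∈ B)
    (hl : 1 ≤ l) (hlp : l ≤ p) (hq : 0 ≤ q) :
    ‖controlledRemainder p (reducedLift S V) (gradientPath f S) l s t‖ ^ (q / ((p : ℝ) - l + 1)) ≤
      (d ^ l * K : ℝ) ^ (q / ((p : ℝ) - l + 1)) * ‖S t - S s‖ ^ q := by
  have hcast : (p : ℝ) - l + 1 = (p - l + 1 : ℕ) := by
    rw [Nat.cast_add, Nat.cast_sub hlp, Nat.cast_one]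
  rw [hcast]
  calc ‖controlledRemainder p (reducedLift S V) (gradientPath f S) l s t‖ ^
        (q / (p - l + 1 : ℕ))
      ≤ (d ^ l * K * ‖S t - S s‖ ^ (p - l + 1)) ^ (q / (p - l + 1 : ℕ)) := by
        gcongr
        exact norm_controlledRemainder_gradientPath_le hf hB hK hs ht hl hlp
    _ = (d ^ l * K : ℝ) ^ (q / (p - l + 1 : ℕ)) * ‖S t - S s‖ ^ q := by
        rw [Real.mul_rpow (by positivity) (by positivity), ← Real.rpow_natCast ‖S t - S s‖,
          ← Real.rpow_mul (norm_nonneg _), mul_div_cancel₀ _ (by positivity)]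

theorem isControlled_gradientPath (hq0 : 0 ≤ q) (hq : ⌊q⌋₊ = p) (hS : ContinuousOn S (Icc 0 T))
    (hf : ContDiff ℝ p f) (hL : LocallyLipschitz (iteratedFDeriv ℝ p f)) (V : ℝ → Tens d p)
    {H : ℝ → ℝ} (hHc : ContinuousOn H (Icc 0 T)) (hHm : MonotoneOn H (Icc 0 T))
    (hSH : ∀ s t, 0 ≤ s → s ≤ t → t ≤ T → ‖S t - S s‖ ^ q ≤ H t - H s) :
    IsControlled q T (reducedLift S V) (gradientPath f S) where
  cont k hk := continuousOn_gradientPath hS (hf.of_le (by exact_mod_cast hk.trans hq.le))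
  symm k hk t _ := isSymTens_gradientPath (hf.of_le (by exact_mod_cast hk.trans hq.le)) t
  bound := by
    rw [hq]
    obtain ⟨B, hB, hconv, hSB⟩ := exists_isCompact_convex_mapsTo hS
    obtain ⟨K, hK⟩ := hL.locallyLipschitzOn.exists_lipschitzOnWith_of_compact hB
    let C := ∑ l ∈ Finset.Icc 1 p, (d ^ l * K : ℝ) ^ (q / ((p : ℝ) - l + 1))
    have hC : 0 ≤ C := Finset.sum_nonneg fun l _ => by positivity
    refine ⟨fun s t => C * H t - C * H s, isControl_sub (continuousOn_const.mul hHc)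
      fun s hs t ht hst => mul_le_mul_of_nonneg_left (hHm hs ht hst) hC, ?_⟩
    intro s t hs hst ht
    change _ ≤ C * H t - C * H s
    rw [← mul_sub]
    refine le_trans ?_ (mul_le_mul_of_nonneg_left (hSH s t hs hst ht) hC)
    rw [Finset.sum_mul]
    refine Finset.sum_le_sum fun l hl => ?_
    obtain ⟨hl1, hlp⟩ := Finset.mem_Icc.1 hl
    exact norm_controlledRemainder_gradientPath_rpow_le hf hconv hK (hSB ⟨hs, hst.trans ht⟩)
      (hSB ⟨hs.trans hst, ht⟩) hl1 hlp hq0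

end GradientPath

/-! ### The rough path integral and the pathwise integral -/

section Integrals

section FinePartitions

variable {F : Type*} [SeminormedAddCommGroup F] {a b : ℝ} {p : ℕ} {π : ℕ → IntervalPartition a b}
  {S : ℝ → F}

theorem IsGeometricallyFine.exists_forall_eventually (hπ : IsGeometricallyFine p π S) :
    ∃ M > 0, ∀ ρ > 0, ∀ᶠ n in atTop, ∃ δ, 0 ≤ δ ∧ δ < ρ ∧
      (∀ e ∈ (π n).intervals, ∀ s ∈ Icc e.1 e.2, ∀ t ∈ Icc e.1 e.2, ‖S t - S s‖ ≤ δ) ∧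
      ((π n).points.card + 2) * δ ^ p ≤ M := by
  obtain ⟨r, D, C, hr0, hr1, hosc, hcard⟩ := hπ
  have hC : 0 ≤ C := le_trans (by positivity) (hcard 0)
  refine ⟨3 * |D| ^ p * C + 1, by positivity, fun ρ hρ => ?_⟩
  have hlim : Tendsto (fun n : ℕ => |D| * r ^ n) atTop (𝓝 0) := by
    simpa only [mul_zero] using (tendsto_pow_atTop_nhds_zero_of_lt_one hr0.le hr1).const_mul |D|
  filter_upwards [hlim.eventually_lt_const hρ] with n hn
  refine ⟨|D| * r ^ n, by positivity, hn, fun e he s hs t ht =>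
    (hosc n e he s hs t ht).trans (by gcongr; exact le_abs_self D), ?_⟩
  have hpos : (1 : ℝ) ≤ (π n).points.card := by exact_mod_cast (π n).card_points_pos
  calc ((π n).points.card + 2) * (|D| * r ^ n) ^ p
      ≤ 3 * (π n).points.card * (|D| * r ^ n) ^ p := by gcongr; linarith
    _ = 3 * |D| ^ p * ((π n).points.card * (r ^ n) ^ p) := by rw [mul_pow]; ring
    _ ≤ 3 * |D| ^ p * C := by gcongr; exact hcard n
    _ ≤ 3 * |D| ^ p * C + 1 := by linarith

end FinePartitions

variable {d p : ℕ} {T : ℝ} {f : EuclideanSpace ℝ (Fin d) → ℝ} {S : ℝ → EuclideanSpace ℝ (Fin d)}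
  {μ : VectorMeasure (Icc (0 : ℝ) T) (Tens d p)} {π : ℕ → IntervalPartition 0 T}

theorem HasPthVariation.exists_sum_abs_pow_le (hp : Even p) (hμ : HasPthVariation p π S μ) :
    ∃ B : ℝ, ∀ n, ∑ e ∈ (π n).intervals, ∑ i, |S e.1 i - S e.2 i| ^ p ≤ B := by
  obtain ⟨B, hB⟩ := (hμ.tendsto (fun _ => diagTens d p) continuousOn_const).bddAbove_range
  refine ⟨B, fun n => (Finset.sum_congr rfl fun e _ => ?_).trans_le (hB ⟨n, rfl⟩)⟩
  rw [inner_diagTens]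
  refine Finset.sum_congr rfl fun i _ => ?_
  rw [abs_sub_comm, hp.pow_abs, PiLp.sub_apply]

theorem tensorIntegral_zero [NullSingletonClass μ.variation] (φ : ℝ → Tens d p) :
    tensorIntegral μ φ 0 = 0 := by
  have hsub {x : Icc (0 : ℝ) T} (hx : (x : ℝ) ≤ 0) : (x : ℝ) = 0 := le_antisymm hx x.2.1
  have hnull : μ.variation {x | (x : ℝ) ≤ 0} = 0 :=
    Set.Subsingleton.measure_zero (fun x hx y hy => Subtype.ext ((hsub hx).trans (hsub hy).symm)) _
  have hle := norm_integral_indicator_le μ (innerSL ℝ) (measurableSet_val_le 0)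
    (g := fun x : Icc (0 : ℝ) T => φ x) (η := ‖φ 0‖) fun x hx => by rw [hsub hx]
  rw [measureReal_def, hnull, ENNReal.toReal_zero, mul_zero, mul_zero] at hle
  exact norm_le_zero_iff.1 hle

/-- The value at `t` of the integral of `∇f(S)` predicted by the Itô formula, up to an additive
constant; the last term integrates `∇^p f(S)` against `[S]^p`. -/
noncomputable def itoPrimitive (f : EuclideanSpace ℝ (Fin d) → ℝ)
    (S : ℝ → EuclideanSpace ℝ (Fin d)) (μ : VectorMeasure (Icc (0 : ℝ) T) (Tens d p)) (t : ℝ) :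
    ℝ :=
  f (S t) - (p.factorial : ℝ)⁻¹ * tensorIntegral μ (fun r => nabla p f (S r)) t

section RoughIntegral

theorem compensatedGerm_gradientPath (hp0 : 0 < p) (V : ℝ → Tens d p) (s t : ℝ) :
    compensatedGerm p (reducedLift S V) (gradientPath f S) s t =
      taylorSum p f (S s) (S t - S s) -
        (p.factorial : ℝ)⁻¹ * inner ℝ (nabla p f (S s)) (V t - V s) := by
  have hterm (k : ℕ) (hk : k ∈ Finset.Icc 1 p) :
      inner ℝ (gradientPath f S k s) (reducedLift S V k s t) =
        (k.factorial : ℝ)⁻¹ * inner ℝ (nabla k f (S s)) (tpow (S t - S s) k) -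
          inner ℝ (nabla k f (S s)) (variationIncrement V k s t) := by
    rw [gradientPath_of_ne (Nat.one_le_iff_ne_zero.1 (Finset.mem_Icc.1 hk).1),
      reducedLift_eq_sub, inner_sub_right, real_inner_smul_right]
  have hsingle : ∑ k ∈ Finset.Icc 1 p, inner ℝ (nabla k f (S s)) (variationIncrement V k s t) =
      (p.factorial : ℝ)⁻¹ * inner ℝ (nabla p f (S s)) (V t - V s) := by
    rw [Finset.sum_eq_single_of_mem p (Finset.mem_Icc.2 ⟨hp0, le_rfl⟩) fun k _ hk => by
      rw [variationIncrement_of_ne V hk, inner_zero_right], variationIncrement_self,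
      real_inner_smul_right]
  rw [compensatedGerm, Finset.sum_congr rfl hterm, Finset.sum_sub_distrib, hsingle, taylorSum]

theorem exists_norm_itoPrimitive_sub_le (hp0 : 0 < p) (hS : ContinuousOn S (Icc 0 T))
    (hf : ContDiff ℝ p f) (μ : VectorMeasure (Icc (0 : ℝ) T) (Tens d p)) {η : ℝ} (hη : 0 < η) :
    ∃ ρ > 0, ∀ s t, 0 ≤ s → s ≤ t → t ≤ T → (∀ r ∈ Icc s t, ‖S r - S s‖ < ρ) →
      ‖itoPrimitive f S μ t - itoPrimitive f S μ s -
          compensatedGerm p (reducedLift S (pthVariation μ)) (gradientPath f S) s t‖ ≤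
        η * (‖S t - S s‖ ^ p + (massUpTo μ t - massUpTo μ s)) := by
  obtain ⟨B, hB, hconv, hSB⟩ := exists_isCompact_convex_mapsTo hS
  obtain ⟨ρ₁, hρ₁, htaylor⟩ := exists_abs_sub_sub_taylorSum_le hf hB hconv hη
  obtain ⟨ρ₂, hρ₂, hnabla⟩ := Metric.uniformContinuousOn_iff.1
    (hB.uniformContinuousOn_of_continuous (continuous_nabla hf).continuousOn) η hη
  refine ⟨min ρ₁ ρ₂, lt_min hρ₁ hρ₂, fun s t hs hst ht hosc => ?_⟩
  have hsB : S s ∈ B := hSB ⟨hs, hst.trans ht⟩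
  have hf_le := htaylor _ hsB _ (hSB ⟨hs.trans hst, ht⟩)
    ((hosc t ⟨hst, le_rfl⟩).trans_le (min_le_left _ _))
  have hμ_le := abs_tensorIntegral_sub_sub_inner_le μ (φ := fun r => nabla p f (S r))
    ((continuous_nabla hf).comp_continuousOn hS) (η := η) hst fun r hr => by
      rw [← dist_eq_norm]
      refine (hnabla _ (hSB ⟨hs.trans hr.1, hr.2.trans ht⟩) _ hsB ?_).le
      rw [dist_eq_norm]
      exact (hosc r hr).trans_le (min_le_right _ _)
  have hsplit : itoPrimitive f S μ t - itoPrimitive f S μ s -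
      compensatedGerm p (reducedLift S (pthVariation μ)) (gradientPath f S) s t =
      f (S t) - f (S s) - taylorSum p f (S s) (S t - S s) - (p.factorial : ℝ)⁻¹ •
        (tensorIntegral μ (fun r => nabla p f (S r)) t -
          tensorIntegral μ (fun r => nabla p f (S r)) s -
          inner ℝ (nabla p f (S s)) (pthVariation μ t - pthVariation μ s)) := by
    rw [compensatedGerm_gradientPath hp0, itoPrimitive, itoPrimitive, smul_eq_mul]
    ring
  rw [hsplit, mul_add]
  exact (norm_sub_le _ _).trans
    (add_le_add hf_le ((norm_inv_factorial_smul_le p _).trans hμ_le))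

theorem exists_norm_sum_itoPrimitive_sub_le (hp0 : 0 < p) (hS : ContinuousOn S (Icc 0 T))
    (hf : ContDiff ℝ p f) (hπ : IsGeometricallyFine p π S)
    (μ : VectorMeasure (Icc (0 : ℝ) T) (Tens d p)) {s t : ℝ} (hs : 0 ≤ s) (hst : s ≤ t)
    (ht : t ≤ T) {ε : ℝ} (hε : 0 < ε) :
    ∃ P : IntervalPartition s t, ‖∑ e ∈ P.intervals,
      (itoPrimitive f S μ e.2 - itoPrimitive f S μ e.1 -
        compensatedGerm p (reducedLift S (pthVariation μ)) (gradientPath f S) e.1 e.2)‖ ≤ ε := by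
  obtain ⟨M, hM, hfine⟩ := hπ.exists_forall_eventually
  have hmass : 0 ≤ massUpTo μ t - massUpTo μ s := sub_nonneg.2 (monotone_massUpTo μ hst)
  set L := M + (massUpTo μ t - massUpTo μ s)
  have hL : 0 < L := by positivity
  obtain ⟨ρ, hρ, hlocal⟩ := exists_norm_itoPrimitive_sub_le hp0 hS hf μ (div_pos hε hL)
  obtain ⟨n, δ, hδ, hδρ, hosc, hcard⟩ := (hfine ρ hρ).exists
  obtain ⟨Q, hQcard, hQ⟩ := (π n).exists_restrict hs hst ht
  have hterm (e : ℝ × ℝ) (he : e ∈ Q.intervals) :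
      ‖itoPrimitive f S μ e.2 - itoPrimitive f S μ e.1 -
        compensatedGerm p (reducedLift S (pthVariation μ)) (gradientPath f S) e.1 e.2‖ ≤
      ε / L * (δ ^ p + (massUpTo μ e.2 - massUpTo μ e.1)) := by
    obtain ⟨e', he', hle₁, hle₂⟩ := hQ e he
    obtain ⟨hse, he12, het⟩ := Q.le_of_mem_intervals he
    have hδe (r : ℝ) (hr : r ∈ Icc e.1 e.2) : ‖S r - S e.1‖ ≤ δ :=
      hosc e' he' _ ⟨hle₁, he12.trans hle₂⟩ _ ⟨hle₁.trans hr.1, hr.2.trans hle₂⟩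
    refine (hlocal e.1 e.2 (hs.trans hse) he12 (het.trans ht)
      fun r hr => (hδe r hr).trans_lt hδρ).trans ?_
    gcongr
    exact hδe e.2 ⟨he12, le_rfl⟩
  have hcard_le : (Q.intervals.card : ℝ) ≤ (π n).points.card + 2 := by
    exact_mod_cast Q.card_intervals_le.trans hQcard
  refine ⟨Q, (norm_sum_le_of_le _ hterm).trans ?_⟩
  rw [← Finset.mul_sum, Finset.sum_add_distrib, Q.sum_intervals_sub, Finset.sum_const, nsmul_eq_mul]
  calc ε / L * (Q.intervals.card * δ ^ p + (massUpTo μ t - massUpTo μ s)) ≤ ε / L * L := by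
        gcongr
        exact add_le_add_left
          ((mul_le_mul_of_nonneg_right hcard_le (by positivity)).trans hcard) _
    _ = ε := div_mul_cancel₀ _ hL.ne'

theorem isRoughIntegral_gradientPath {q : ℝ} (hp0 : 0 < p) (hq : ⌊q⌋₊ = p)
    (hS : ContinuousOn S (Icc 0 T)) (hf : ContDiff ℝ p f) (hπ : IsGeometricallyFine p π S)
    (hX : IsReducedRoughPath q T (reducedLift S (pthVariation μ)))
    (hY : IsControlled q T (reducedLift S (pthVariation μ)) (gradientPath f S)) {t : ℝ}
    (ht : t ≤ T) :
    IsRoughIntegral p (reducedLift S (pthVariation μ)) (gradientPath f S) t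
      (itoPrimitive f S μ t - itoPrimitive f S μ 0) := by
  subst hq
  have hq0 : 0 < q := Nat.pos_of_floor_pos hp0
  obtain ⟨H, hHc, hHm, hgerm⟩ := hY.exists_almostAdditive_compensatedGerm hq0 hX
  have hθ : 1 < ((⌊q⌋₊ : ℝ) + 1) / q := (one_lt_div hq0).2 (Nat.lt_floor_add_one q)
  have hE : AlmostAdditive 0 T ⌊q⌋₊ ((⌊q⌋₊ + 1 : ℝ) / q) H fun s t =>
      itoPrimitive f S μ t - itoPrimitive f S μ s -
        compensatedGerm ⌊q⌋₊ (reducedLift S (pthVariation μ)) (gradientPath f S) s t := by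
    intro s u t hs hsu hut ht
    refine Eq.trans_le ?_ (hgerm s u t hs hsu hut ht)
    rw [← norm_neg]
    congr 1
    ring
  intro ε hε
  obtain ⟨δ, hδ, hsmall⟩ := hE.exists_norm_sum_intervals_lt (Nat.cast_nonneg _) hθ hHm hHc
    (fun s t hs hst ht ε hε => exists_norm_sum_itoPrimitive_sub_le hp0 hS hf hπ μ hs hst ht hε)
    ht hε
  refine ⟨δ, hδ, fun P hP => ?_⟩
  have hlt := hsmall P hP
  rwa [Finset.sum_sub_distrib, P.sum_intervals_sub, norm_sub_rev] at hlt

end RoughIntegral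

section PathwiseIntegral

theorem taylorSum_succ (n : ℕ) (x v : EuclideanSpace ℝ (Fin d)) :
    taylorSum (n + 1) f x v = taylorSum n f x v +
      ((n + 1).factorial : ℝ)⁻¹ * inner ℝ (nabla (n + 1) f x) (tpow v (n + 1)) :=
  Finset.sum_Icc_succ_top n.succ_pos _

theorem taylorSum_zero_right (n : ℕ) (x : EuclideanSpace ℝ (Fin d)) : taylorSum n f x 0 = 0 :=
  Finset.sum_eq_zero fun k hk => by
    rw [tpow_zero_left (Nat.one_le_iff_ne_zero.1 (Finset.mem_Icc.1 hk).1), inner_zero_right,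
      mul_zero]

theorem abs_stopped_sub_taylorSum_le {n : ℕ} {η ρ δ a b : ℝ} (hη : 0 ≤ η) (hδ : 0 ≤ δ)
    (hδρ : δ < ρ) (hab : a ≤ b)
    (htaylor : ∀ s ∈ Icc a b, ‖S s - S a‖ < ρ →
      |f (S s) - f (S a) - taylorSum n f (S a) (S s - S a)| ≤ η * ‖S s - S a‖ ^ n)
    (hosc : ∀ s ∈ Icc a b, ‖S s - S a‖ ≤ δ) (t : ℝ) :
    |f (S (min b t)) - f (S (min a t)) - taylorSum n f (S a) (S (min b t) - S (min a t))| ≤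
      η * δ ^ n := by
  rcases le_total a t with hat | hta
  · have hmin : min b t ∈ Icc a b := ⟨le_min hab hat, min_le_left b t⟩
    rw [min_eq_left hat]
    refine (htaylor _ hmin ((hosc _ hmin).trans_lt hδρ)).trans ?_
    gcongr
    exact hosc _ hmin
  · rw [min_eq_right hta, min_eq_right (hta.trans hab), sub_self, sub_self, taylorSum_zero_right,
      sub_zero, abs_zero]
    positivity

theorem tendsto_sum_stopped_sub_taylorSum (hS : ContinuousOn S (Icc 0 T)) (hf : ContDiff ℝ p f)
    (hπ : IsGeometricallyFine p π S) (t : ℝ) :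
    Tendsto (fun n => ∑ e ∈ (π n).intervals, (f (S (min e.2 t)) - f (S (min e.1 t)) -
      taylorSum p f (S e.1) (S (min e.2 t) - S (min e.1 t)))) atTop (𝓝 0) := by
  obtain ⟨M, hM, hfine⟩ := hπ.exists_forall_eventually
  obtain ⟨B, hB, hconv, hSB⟩ := exists_isCompact_convex_mapsTo hS
  rw [Metric.tendsto_nhds]
  intro ε hε
  obtain ⟨ρ, hρ, htaylor⟩ := exists_abs_sub_sub_taylorSum_le hf hB hconv (half_pos (div_pos hε hM))
  filter_upwards [hfine ρ hρ] with n ⟨δ, hδ, hδρ, hosc, hcard⟩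
  have hterm (e : ℝ × ℝ) (he : e ∈ (π n).intervals) :
      ‖f (S (min e.2 t)) - f (S (min e.1 t)) -
        taylorSum p f (S e.1) (S (min e.2 t) - S (min e.1 t))‖ ≤ ε / M / 2 * δ ^ p := by
    obtain ⟨h0, h12, hT⟩ := (π n).le_of_mem_intervals he
    exact abs_stopped_sub_taylorSum_le (by positivity) hδ hδρ h12
      (fun s hs => htaylor _ (hSB ⟨h0, h12.trans hT⟩) _ (hSB ⟨h0.trans hs.1, hs.2.trans hT⟩))
      (fun s hs => hosc e he _ ⟨le_rfl, h12⟩ s hs) t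
  have hcard_le : ((π n).intervals.card : ℝ) ≤ (π n).points.card + 2 := by
    exact_mod_cast (π n).card_intervals_le.trans (Nat.le_add_right _ 2)
  rw [dist_zero_right]
  calc ‖∑ e ∈ (π n).intervals, (f (S (min e.2 t)) - f (S (min e.1 t)) -
        taylorSum p f (S e.1) (S (min e.2 t) - S (min e.1 t)))‖
      ≤ (π n).intervals.card * (ε / M / 2 * δ ^ p) := by
        simpa only [Finset.sum_const, nsmul_eq_mul] using norm_sum_le_of_le _ hterm
    _ ≤ ((π n).points.card + 2) * (ε / M / 2 * δ ^ p) := by gcongr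
    _ = ε / M / 2 * (((π n).points.card + 2) * δ ^ p) := by ring
    _ ≤ ε / M / 2 * M := by gcongr
    _ = ε / 2 := by rw [div_right_comm, div_mul_cancel₀ _ hM.ne']
    _ < ε := half_lt_self hε

theorem isPathwiseIntegral_itoPrimitive (hp : Even p) (hp0 : 0 < p)
    (hμ : HasPthVariation p π S μ) (hS : ContinuousOn S (Icc 0 T)) (hf : ContDiff ℝ p f)
    (hπ : IsGeometricallyFine p π S) {t : ℝ} (ht : t ∈ Icc 0 T) :
    IsPathwiseIntegral p π S f t (itoPrimitive f S μ t - itoPrimitive f S μ 0) := by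
  have := nullSingletonClass_variation hμ.no_atoms
  have hvariation := tendsto_sum_inner_stopped hp hp0 hμ (φ := fun r => nabla p f (S r))
    ((continuous_nabla hf).comp_continuousOn hS) t
  have hremainder := tendsto_sum_stopped_sub_taylorSum hS hf hπ t
  have htelescope (n : ℕ) :
      ∑ e ∈ (π n).intervals, (f (S (min e.2 t)) - f (S (min e.1 t))) = f (S t) - f (S 0) := by
    rw [(π n).sum_intervals_sub fun r => f (S (min r t)), min_eq_right ht.2, min_eq_left ht.1]
  obtain ⟨m, rfl⟩ := Nat.exists_eq_add_one.2 hp0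
  rw [itoPrimitive, itoPrimitive, tensorIntegral_zero, mul_zero, sub_zero, sub_right_comm]
  have hlim := ((tendsto_const_nhds (x := f (S t) - f (S 0))).sub
    (hvariation.const_mul ((m + 1).factorial : ℝ)⁻¹)).sub hremainder
  rw [sub_zero] at hlim
  refine hlim.congr fun n => ?_
  rw [← htelescope n, Finset.mul_sum, ← Finset.sum_sub_distrib, ← Finset.sum_sub_distrib]
  refine Finset.sum_congr rfl fun e _ => ?_
  rw [taylorSum_succ, taylorSum, Nat.add_sub_cancel]
  ring

end PathwiseIntegral

end Integrals

end PathwiseRough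

open PathwiseRough in
theorem mainTheorem7_general {d p : ℕ} (hp : Even p) (hp0 : 0 < p) {q : ℝ} (hpq : (p : ℝ) < q)
    (hq : ⌊q⌋₊ = p) {T : ℝ} (S : ℝ → EuclideanSpace ℝ (Fin d)) (hS : ContinuousOn S (Icc 0 T))
    (π : ℕ → IntervalPartition 0 T) (hπ : IsGeometricallyFine p π S)
    (μ : VectorMeasure (Icc (0 : ℝ) T) (Tens d p)) (hμ : HasPthVariation p π S μ)
    (f : EuclideanSpace ℝ (Fin d) → ℝ) (hf : ContDiff ℝ ⌊q⌋₊ f) :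
    IsReducedRoughPath q T (reducedLift S (pthVariation μ)) ∧
    (LocallyLipschitz (iteratedFDeriv ℝ ⌊q⌋₊ f) →
      IsControlled q T (reducedLift S (pthVariation μ)) (gradientPath f S)) ∧
    (IsControlled q T (reducedLift S (pthVariation μ)) (gradientPath f S) →
      ∀ t ∈ Icc 0 T, ∃ I : ℝ,
        IsRoughIntegral ⌊q⌋₊ (reducedLift S (pthVariation μ)) (gradientPath f S) t I ∧
        IsPathwiseIntegral p π S f t I) := by
  have := nullSingletonClass_variation hμ.no_atoms
  rw [hq] at hf ⊢
  obtain ⟨H, hHc, hHm, hSH⟩ := hπ.exists_norm_sub_rpow_le hS hpq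
  have hX : IsReducedRoughPath q T (reducedLift S (pthVariation μ)) :=
    isReducedRoughPath_reducedLift hp0 hpq hq (fun t => hμ.symm _) (H := H + massUpTo μ)
      (hHc.add (continuous_massUpTo μ)).continuousOn
      ((hHm.add (monotone_massUpTo μ)).monotoneOn _)
      (fun s t hs hst ht => (hSH s t hs hst ht).trans <| by
        simpa only [Pi.add_apply, add_sub_add_comm, le_add_iff_nonneg_right, sub_nonneg]
          using monotone_massUpTo μ hst)
      (fun s t _ hst _ => (norm_pthVariation_sub_le μ hst).trans <| by
        simpa only [Pi.add_apply, add_sub_add_comm, le_add_iff_nonneg_left, sub_nonneg]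
          using hHm hst)
  refine ⟨hX, fun hL => ?_, fun hY t ht => ⟨itoPrimitive f S μ t - itoPrimitive f S μ 0, ?_, ?_⟩⟩
  · exact isControlled_gradientPath (p.cast_nonneg.trans hpq.le) hq hS hf hL _ hHc.continuousOn
      (hHm.monotoneOn _) hSH
  · exact isRoughIntegral_gradientPath hp0 hq hS hf hπ hX hY ht.2
  · exact isPathwiseIntegral_itoPrimitive hp hp0 hμ hS hf hπ ht

theorem mainTheorem7 {d p : ℕ} (hp : Even p) (hp0 : 0 < p) {q : ℝ} (hpq : (p : ℝ) < q)
    (hq : ⌊q⌋₊ = p) {T : ℝ} (hT : 0 < T) (S : ℝ → EuclideanSpace ℝ (Fin d))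
    (hS : ContinuousOn S (Set.Icc 0 T))
    (μ : MeasureTheory.VectorMeasure (Set.Icc (0 : ℝ) T) (PathwiseRough.Tens d p))
    (hμ : PathwiseRough.HasPthVariation p (PathwiseRough.dyadicLebesgue hT.le hS) S μ)
    (f : EuclideanSpace ℝ (Fin d) → ℝ) (hf : ContDiff ℝ ⌊q⌋₊ f) :
    PathwiseRough.IsReducedRoughPath q T
      (PathwiseRough.reducedLift S (PathwiseRough.pthVariation μ)) ∧
    (LocallyLipschitz (iteratedFDeriv ℝ ⌊q⌋₊ f) →
      PathwiseRough.IsControlled q T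
        (PathwiseRough.reducedLift S (PathwiseRough.pthVariation μ))
        (PathwiseRough.gradientPath f S)) ∧
    (PathwiseRough.IsControlled q T
        (PathwiseRough.reducedLift S (PathwiseRough.pthVariation μ))
        (PathwiseRough.gradientPath f S) →
      ∀ t ∈ Set.Icc 0 T, ∃ I : ℝ,
        PathwiseRough.IsRoughIntegral ⌊q⌋₊
          (PathwiseRough.reducedLift S (PathwiseRough.pthVariation μ))
          (PathwiseRough.gradientPath f S) t I ∧
        PathwiseRough.IsPathwiseIntegral p (PathwiseRough.dyadicLebesgue hT.le hS) S f t I) := by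
  obtain ⟨B, hB⟩ := hμ.exists_sum_abs_pow_le hp
  exact mainTheorem7_general hp hp0 hpq hq S hS _
    (PathwiseRough.isGeometricallyFine_dyadicLebesgue hT.le hS hp0 hB) μ hμ f hf
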